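/- Let $A$ be an $n\times n$ Hermitian matrix (real or complex, $n\ge 1$) with eigenvalues $\lambda_1,\dots,\lambda_n$, orthonormal eigenvectors $u_1,\dots,u_n$, smallest eigenvalue $\lambda_{\min}$ and largest eigenvalue $\lambda_{\max}$. Let $\Phi(x)=\frac1n\sum_{i}\mathbb 1(\lambda_i\le x)$ be its cumulative empirical spectral measure (CESM). For a vector $v$ let $\Psi(x)=\sum_i |v^{\mathsf H}u_i|^2\,\mathbb 1(\lambda_i\le x)$ be the weighted CESM. Notation. $d_{\mathrm W}(\Upsilon_1,\Upsilon_2)=\int_{\mathbb R}|\Upsilon_1-\Upsilon_2|\,dx$, and $d_{\mathrm{TV}}(\Upsilon)=\int|d\Upsilon|$ is the total variation. A linear operator $f\mapsto[f]$ from functions to polynomials induces an approximation $[\Psi]$ of $\Psi$ by $\int f\,d[\Psi]:=\int [f]\,d\Psi$. For a probability distribution $\mu$ let $p_0,p_1,\dots$ be its orthonormal polynomials. Consider the following approximations of degree $s$. * Gaussian quadrature $[\Psi]^{\mathrm g}_{2k-1}$ ($k\ge1$, $s=2k-1$): $[f]$ is the interpolant of $f$ at the zeros of the degree-$k$ orthogonal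 polynomial of $\Psi$ itself. If $\Psi$ has only $N<k$ points of increase, $k$ is replaced by $N$ in this rule, so that $[\Psi]^{\mathrm g}_{2k-1}=\Psi$. * Quadrature by interpolation $[\Psi]^{\mathrm i}_s$: $[f]=[f]^{\mathrm i}_s$ is the interpolant of $f$ at the $s+1$ zeros of the degree-$(s+1)$ orthogonal polynomial of $\mu$. * Quadrature by approximation $[\Psi]^{\mathrm a}_s$: $[f]=[f]^{\mathrm a}_s=\sum_{i=0}^s\big(\int f p_i\,d\mu\big)p_i$. * Jackson-damped quadrature $[\Psi]^{\mathrm{d\text{-}a}}_s$, $[\Psi]^{\mathrm{d\text{-}i}}_s$ for the Chebyshev distribution $\mu=\mu^T_{a,b}$ with density $\frac{2}{\pi(b-a)}\big(1-(\tfrac{2x-a-b}{b-a})^2\big)^{-1/2}$ on $(a,b)$: $[f]=\sum_{i=0}^s\rho_i\big(\int f p_i\,d\mu\big)p_i$, respectively the same sum with $\int f p_i\,d\mu$ replaced by its $(s+1)$-point Gaussian quadrature for $\mu$, where $$\rho_i=\frac{(s-i+2)\cos\frac{i\pi}{s+2}+\sin\frac{i\pi}{s+2}\cot\frac{\pi}{s+2}}{s+2}.$$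 Theorem. Let $n_{\mathrm v}\ge1$, let $v_1,\dots,v_{n_{\mathrm v}}$ be independent and uniformly distributed on the real unit sphere $\mathbb S^{n-1}\subset\mathbb R^n$, let $\Psi_\ell$ be the weighted CESM of $v_\ell$, and for $\circ\in\{\mathrm g,\mathrm i,\mathrm a,\mathrm{d\text{-}i},\mathrm{d\text{-}a}\}$ let $\langle[\Psi_\ell]^\circ_s\rangle=\frac1{n_{\mathrm v}}\sum_{\ell}[\Psi_\ell]^\circ_s$ be the output of the prototypical algorithm. Let $\epsilon>0$ and $$\delta=2n\exp\Big(-\frac{n_{\mathrm v}(n+2)\epsilon^2}{4(\lambda_{\max}-\lambda_{\min})^2}\Big),\qquad \delta=0\ \text{ if }\lambda_{\max}=\lambda_{\min}.$$ 1. ($\circ=\mathrm g$.) If $k\ge1$ and $s=2k-1\ge -1+2\pi(\lambda_{\max}-\lambda_{\min})\epsilon^{-1}$, then $\mathbb P\big[d_{\mathrm W}(\Phi,\langle[\Psi_\ell]^{\mathrm g}_s\rangle)>\epsilon\big]\le\delta$. 2. ($\circ\in\{\mathrm i,\mathrm a\}$, $\mu$ arbitrary.) Let $[\lambda_{\min},\lambda_{\max}]\subset[a,b]$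 and let $\mu$ be any probability distribution supported in $[a,b]$. Let the degree $s\ge0$ be fixed or chosen depending on the sample, with $\mu$ having always at least $s+1$ points of support. Then $$\mathbb P\Big[\,s\ge -1+\pi\big(1+d_{\mathrm{TV}}(\langle[\Psi_\ell]^\circ_s\rangle)\big)(b-a)\epsilon^{-1}\ \text{ and }\ d_{\mathrm W}(\Phi,\langle[\Psi_\ell]^\circ_s\rangle)>\epsilon\Big]\le\delta .$$ In particular, if the inequality for $s$ holds almost surely, then $\mathbb P[d_{\mathrm W}(\Phi,\langle[\Psi_\ell]^\circ_s\rangle)>\epsilon]\le\delta$. 3. ($\circ\in\{\mathrm{d\text{-}i},\mathrm{d\text{-}a}\}$, $\mu=\mu^T_{a,b}$, Jackson's coefficients.) Let $a<b$ and $[\lambda_{\min},\lambda_{\max}]\subset[a,b]$. If $s\ge0$ and $s\ge -2+\pi^2(b-a)\epsilon^{-1}$, then $\mathbb P\big[d_{\mathrm W}(\Phi,\langle[\Psi_\ell]^\circ_s\rangle)>\epsilon\big]\le\delta$. -/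

import Mathlib

open MeasureTheory ProbabilityTheory Polynomial
open scoped ENNReal

noncomputable section

namespace RandQuad

/-! ### Distribution functions -/

/-- The Wasserstein (earth mover) distance `∫ |Υ₁ - Υ₂| dx` of two distribution functions, as an
extended nonnegative real. -/
def wassersteinDist (Υ₁ Υ₂ : ℝ → ℝ) : ℝ≥0∞ :=
  ∫⁻ x, ENNReal.ofReal |Υ₁ x - Υ₂ x|

/-- The total variation `∫ |dΥ|` of a distribution function. -/
def totalVar (Υ : ℝ → ℝ) : ℝ≥0∞ :=
  eVariationOn Υ Set.univ

/-- The average `⟨Υ_ℓ⟩ = (1/N) ∑_ℓ Υ_ℓ` of `N` distribution functions. -/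
def average {N : ℕ} (Υ : Fin N → ℝ → ℝ) : ℝ → ℝ :=
  fun x => (N : ℝ)⁻¹ * ∑ l, Υ l x

/-! ### Spectral distributions of a Hermitian matrix -/

section Spectral

variable {𝕜 : Type*} [RCLike 𝕜] {n : ℕ} {A : Matrix (Fin n) (Fin n) 𝕜}

/-- The largest eigenvalue. -/
def lamMax (hA : A.IsHermitian) : ℝ := ⨆ i, hA.eigenvalues i

/-- The smallest eigenvalue. -/
def lamMin (hA : A.IsHermitian) : ℝ := ⨅ i, hA.eigenvalues i

/-- The cumulative empirical spectral measure
`Φ(x) = ∑ i, (1/n) 1(λ_i ≤ x)`. -/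
def cesm (hA : A.IsHermitian) : ℝ → ℝ :=
  fun x => ∑ i, (1 / (n : ℝ)) * (if hA.eigenvalues i ≤ x then 1 else 0)

/-- The real vector `v`, regarded as a vector over `𝕜`. -/
def toField (𝕜 : Type*) [RCLike 𝕜] {n : ℕ} (v : EuclideanSpace ℝ (Fin n)) :
    EuclideanSpace 𝕜 (Fin n) :=
  WithLp.toLp 2 (fun j => ((v j : ℝ) : 𝕜))

/-- The weighted spectral measure `dΨ = ∑ i, |vᴴ u_i|² δ_{λ_i}`, where `u_i` are orthonormal
eigenvectors. Its distribution function `x ↦ ∑ i, |vᴴ u_i|² 1(λ_i ≤ x)` is the weighted CESM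
`Ψ`. -/
def weightedSpectralMeasure (hA : A.IsHermitian) (v : EuclideanSpace ℝ (Fin n)) : Measure ℝ :=
  ∑ i, ENNReal.ofReal (‖inner 𝕜 (toField 𝕜 v) (hA.eigenvectorBasis i)‖ ^ 2) •
    Measure.dirac (hA.eigenvalues i)

end Spectral

/-- The uniform distribution on the real unit sphere of `ℝⁿ`, as a measure on `ℝⁿ`. -/
def unifSphere (n : ℕ) : Measure (EuclideanSpace ℝ (Fin n)) :=
  (ProbabilityTheory.cond
    (volume : Measure (EuclideanSpace ℝ (Fin n))).toSphere Set.univ).map Subtype.val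

/-! ### Orthogonal polynomials -/

/-- The monic orthogonal polynomials of `μ`: Gram–Schmidt applied to the monomials
`1, x, x², …` in the inner product `∫ f g dμ`, without normalization. -/
def monicOrth (μ : Measure ℝ) (i : ℕ) : ℝ[X] :=
  X ^ i - ∑ j : Fin i,
    C ((∫ x, x ^ i * (monicOrth μ j).eval x ∂μ) / (∫ x, ((monicOrth μ j).eval x) ^ 2 ∂μ)) *
      monicOrth μ j
termination_by i
decreasing_by all_goals exact j.2

/-- The orthonormal polynomials `p_i` of `μ` (with positive leading coefficient). -/
def orthPoly (μ : Measure ℝ) (i : ℕ) : ℝ[X] :=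
  C (Real.sqrt (∫ x, ((monicOrth μ i).eval x) ^ 2 ∂μ))⁻¹ * monicOrth μ i

/-- The zeros of the degree `k` orthogonal polynomial of `μ`. -/
def orthNodes (μ : Measure ℝ) (k : ℕ) : Finset ℝ :=
  (monicOrth μ k).roots.toFinset

/-! ### Polynomial approximation operators `f ↦ [f]_s` -/

/-- The polynomial interpolating `f` at the given nodes. -/
def interpAt (nodes : Finset ℝ) (f : ℝ → ℝ) : ℝ[X] :=
  Lagrange.interpolate nodes id f

/-- `[f]_s^i`: the polynomial of degree at most `s` interpolating `f` at the zeros of the degree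
`s + 1` orthogonal polynomial of `μ`. -/
def opInterp (μ : Measure ℝ) (s : ℕ) (f : ℝ → ℝ) : ℝ[X] :=
  interpAt (orthNodes μ (s + 1)) f

/-- `[f]_s^a`: the `μ`-orthogonal projection `∑_{i ≤ s} (∫ f p_i dμ) p_i`. -/
def opApprox (μ : Measure ℝ) (s : ℕ) (f : ℝ → ℝ) : ℝ[X] :=
  ∑ i ∈ Finset.range (s + 1), C (∫ x, f x * (orthPoly μ i).eval x ∂μ) * orthPoly μ i

/-- The number of nodes of the `k`-point Gaussian quadrature rule of `ν`: it is `k` as long as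
`p_0, …, p_{k-1}` exist. If `ν` has only `N < k` points of support, it is `N` (the Lanczos
recurrence terminates after `N` steps). -/
def gaussCount (ν : Measure ℝ) (k : ℕ) : ℕ :=
  open Classical in
  Nat.findGreatest (fun j => ∀ i < j, ∫ x, ((monicOrth ν i).eval x) ^ 2 ∂ν ≠ 0) k

/-- The nodes of the `k`-point Gaussian quadrature rule of `ν`. -/
def gaussNodes (ν : Measure ℝ) (k : ℕ) : Finset ℝ :=
  orthNodes ν (gaussCount ν k)

/-- The integral `∫ f d[ν]^g_{2k-1}` against the `k`-point Gaussian quadrature rule of `ν`. -/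
def gaussIntegral (ν : Measure ℝ) (k : ℕ) (f : ℝ → ℝ) : ℝ :=
  ∫ x, (interpAt (gaussNodes ν k) f).eval x ∂ν

/-- Jackson's damping coefficients `ρ_i^J`, `i = 0, …, s`. -/
def jackson (s i : ℕ) : ℝ :=
  (((s : ℝ) - i + 2) * Real.cos (i * Real.pi / (s + 2)) +
    Real.sin (i * Real.pi / (s + 2)) * Real.cot (Real.pi / (s + 2))) / (s + 2)

/-- `[f]_s^{d-a}` with Jackson's coefficients: `x ↦ ∫ P_x f dμ`, where
`P_x(y) = ∑_{i ≤ s} ρ_i p_i(x) p_i(y)`. -/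
def opDampedApprox (μ : Measure ℝ) (s : ℕ) (f : ℝ → ℝ) : ℝ[X] :=
  ∑ i ∈ Finset.range (s + 1),
    C (jackson s i * ∫ x, f x * (orthPoly μ i).eval x ∂μ) * orthPoly μ i

/-- `[f]_s^{d-i}` with Jackson's coefficients: `x ↦ ∫ P_x f d[μ]^g_{2s+1}`, the integral being
against the `(s+1)`-point Gaussian quadrature rule of `μ`. -/
def opDampedInterp (μ : Measure ℝ) (s : ℕ) (f : ℝ → ℝ) : ℝ[X] :=
  ∑ i ∈ Finset.range (s + 1),
    C (jackson s i * gaussIntegral μ (s + 1) (fun x => f x * (orthPoly μ i).eval x)) *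
      orthPoly μ i

/-- The Chebyshev distribution of the first kind `μ^T_{a,b}`. -/
def chebMeasure (a b : ℝ) : Measure ℝ :=
  (volume.restrict (Set.Ioo a b)).withDensity fun t =>
    ENNReal.ofReal (2 / (Real.pi * (b - a)) *
      (1 / Real.sqrt (1 - (2 / (b - a) * t - (b + a) / (b - a)) ^ 2)))

/-! ### Quadrature approximations `[Ψ]_s` -/

/-- The distribution function of the quadrature approximation of `ν` that is induced by a linear
operator `f ↦ [f]` through `∫ f d[ν] = ∫ [f] dν`; that is, its value at `x` is given by this
relation with `f = 1_{(-∞, x]}`. -/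
def inducedQuad (op : (ℝ → ℝ) → ℝ[X]) (ν : Measure ℝ) : ℝ → ℝ :=
  fun x => ∫ y, (op (Set.indicator (Set.Iic x) fun _ => 1)).eval y ∂ν

/-- `[ν]_{2k-1}^g`: Gaussian quadrature with `k` nodes. -/
def quadGauss (k : ℕ) (ν : Measure ℝ) : ℝ → ℝ := inducedQuad (interpAt (gaussNodes ν k)) ν

/-- `[ν]_s^i`: quadrature by interpolation. -/
def quadInterp (μ : Measure ℝ) (s : ℕ) (ν : Measure ℝ) : ℝ → ℝ := inducedQuad (opInterp μ s) ν

/-- `[ν]_s^a`: quadrature by approximation. -/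
def quadApprox (μ : Measure ℝ) (s : ℕ) (ν : Measure ℝ) : ℝ → ℝ := inducedQuad (opApprox μ s) ν

/-- `[ν]_s^{d-i}`: Jackson-damped quadrature by interpolation for `μ^T_{a,b}`. -/
def quadDampedInterp (a b : ℝ) (s : ℕ) (ν : Measure ℝ) : ℝ → ℝ :=
  inducedQuad (opDampedInterp (chebMeasure a b) s) ν

/-- `[ν]_s^{d-a}`: Jackson-damped quadrature by approximation for `μ^T_{a,b}`. -/
def quadDampedApprox (a b : ℝ) (s : ℕ) (ν : Measure ℝ) : ℝ → ℝ :=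
  inducedQuad (opDampedApprox (chebMeasure a b) s) ν

/-- The output `⟨[Ψ_ℓ]_s⟩` of the prototypical algorithm for the sampled vectors `v_ℓ` and the
quadrature approximation `Q : Ψ ↦ [Ψ]_s`. -/
def protoOutput {𝕜 : Type*} [RCLike 𝕜] {n N : ℕ} {A : Matrix (Fin n) (Fin n) 𝕜}
    (hA : A.IsHermitian) (Q : Measure ℝ → ℝ → ℝ) (v : Fin N → EuclideanSpace ℝ (Fin n)) : ℝ → ℝ :=
  average fun l => Q (weightedSpectralMeasure hA (v l))

/-- The failure probability `2n exp(-N (n+2) ε² / (4 w²))`, where `w` is the width of the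
spectrum, with the convention `exp(-∞) = 0` for `w = 0`. -/
def failureBound (n N : ℕ) (w ε : ℝ) : ℝ :=
  if w = 0 then 0
  else 2 * n * Real.exp (-((N : ℝ) * (n + 2) * ε ^ 2 / (4 * w ^ 2)))

end RandQuad

end

/-!
The triangle inequality splits the error at the averaged weighted CESM `⟨Ψ_ℓ⟩`.

For a fixed `x`, `Ψ(x)` is a quadratic form in `v` with eigenvalues in `[0, 1]`. Its moments on the
sphere are dominated by those of a beta distribution, so `Ψ(x) - Φ(x)` is sub-Gaussian with variance
proxy `1 / (2 (n + 2))`. Between consecutive eigenvalues both functions are constant, hence a union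
bound over the `n` eigenvalues controls `|⟨Ψ_ℓ⟩ - Φ|` everywhere, and `d_W` is at most its supremum
times the width of the spectrum.

The remaining distance `d_W(⟨Ψ_ℓ⟩, ⟨[Ψ_ℓ]⟩)` is deterministic. By duality it is a supremum over
`1`-Lipschitz functions `f` of `∫ f dΨ - ∫ f d[Ψ]`, which depends only on the error of approximating
`f` by polynomials of degree `s`, because the quadrature rules are exact on polynomials. Jackson's
theorem bounds that error by `π (b - a) / (2 (s + 2))`. Each of the two measures contributes it
once, weighted by its total variation; for the damped rules `[f]` itself is the Jackson approximant
and only one contribution remains.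
-/

namespace RandQuad

open Set Filter
open scoped Real NNReal Topology

/-! ### Distribution functions of signed measures with a density -/

section Density

variable {κ ν : Measure ℝ} {u w g : ℝ → ℝ} {a b x y M : ℝ}

/-- The distribution function of the signed measure `w dκ`. The quadrature approximations `[Ψ]` are
of this form, with `κ` the measure that defines the approximation operator. -/
noncomputable def densityCDF (κ : Measure ℝ) (w : ℝ → ℝ) : ℝ → ℝ :=
  fun x => ∫ y in Iic x, w y ∂κ

lemma ae_mem_Icc (hκ : κ (Icc a b)ᶜ = 0) : ∀ᵐ y ∂κ, y ∈ Icc a b := hκ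

lemma measurable_densityCDF (hw : Integrable w κ) : Measurable (densityCDF κ w) := by
  have hmono {f : ℝ → ℝ} (hf : Integrable f κ) (h0 : 0 ≤ f) : Monotone (densityCDF κ f) :=
    fun x y hxy => setIntegral_mono_set hf.integrableOn (ae_of_all _ h0)
      (Iic_subset_Iic.2 hxy).eventuallyLE
  have hsplit : densityCDF κ w = densityCDF κ (fun y => max (w y) 0) -
      densityCDF κ fun y => max (-w y) 0 := by
    funext x
    rw [Pi.sub_apply, densityCDF, densityCDF, densityCDF,
      ← integral_sub hw.pos_part.integrableOn hw.neg_part.integrableOn]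
    exact integral_congr_ae (ae_of_all _ fun y => (max_zero_sub_eq_self (w y)).symm)
  rw [hsplit]
  exact (hmono hw.pos_part fun _ => le_max_right _ _).measurable.sub
    (hmono hw.neg_part fun _ => le_max_right _ _).measurable

lemma abs_densityCDF_le (hw : Integrable w κ) (x : ℝ) : |densityCDF κ w x| ≤ ∫ y, |w y| ∂κ :=
  abs_integral_le_integral_abs.trans
    (setIntegral_le_integral hw.abs (ae_of_all _ fun _ => abs_nonneg _))

lemma densityCDF_eq_zero_of_lt (hκ : κ (Icc a b)ᶜ = 0) (hx : x < a) : densityCDF κ w x = 0 :=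
  setIntegral_measure_zero _ <| measure_mono_null
    (t := (Icc a b)ᶜ) (fun _ hy hy' => (hy'.1.trans hy).not_gt hx) hκ

lemma densityCDF_eq_integral_of_le (hκ : κ (Icc a b)ᶜ = 0) (hx : b ≤ x) :
    densityCDF κ w x = ∫ y, w y ∂κ := by
  rw [densityCDF, Measure.restrict_eq_self_of_ae_mem]
  filter_upwards [ae_mem_Icc hκ] with y hy using hy.2.trans hx

lemma densityCDF_sub_densityCDF (hw : Integrable w κ) (hxy : x ≤ y) :
    densityCDF κ w y - densityCDF κ w x = ∫ t in Ioc x y, w t ∂κ := by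
  rw [densityCDF, densityCDF, ← Iic_union_Ioc_eq_Iic hxy, setIntegral_union
    (Iic_disjoint_Ioc le_rfl) measurableSet_Ioc hw.integrableOn hw.integrableOn,
    add_sub_cancel_left]

lemma integral_indicator_Ici_eq_intervalIntegral (hy : y ∈ Icc a b) (g : ℝ → ℝ) :
    ∫ x in Ioc a b, (Ici y).indicator g x = ∫ x in y..b, g x := by
  have hset : Ioi y ∩ Ioc a b = Ioc y b := by
    rw [inter_comm, Ioc_inter_Ioi, max_eq_right hy.1]
  rw [integral_indicator measurableSet_Ici, Measure.restrict_restrict measurableSet_Ici,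
    intervalIntegral.integral_of_le hy.2, ← hset]
  exact setIntegral_congr_set (Ioi_ae_eq_Ici.symm.inter (ae_eq_refl _))

/-- Fubini: swapping the integrals moves the antiderivative from the density to the test
function. -/
lemma integral_mul_densityCDF [SFinite κ] (hab : a ≤ b) (hκ : κ (Icc a b)ᶜ = 0)
    (hw : Integrable w κ) (hg : Measurable g) (hg1 : ∀ x, |g x| ≤ 1) :
    ∫ x in a..b, g x * densityCDF κ w x = ∫ y, (∫ x in y..b, g x) * w y ∂κ := by
  set F : ℝ × ℝ → ℝ := {p : ℝ × ℝ | p.2 ≤ p.1}.indicator fun p => g p.1 * w p.2 with hF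
  have hFint : Integrable F ((volume.restrict (Ioc a b)).prod κ) := by
    exact ((hw.comp_snd _).bdd_mul (hg.comp measurable_fst).aestronglyMeasurable
      (ae_of_all _ fun p => hg1 p.1)).indicator (measurableSet_le measurable_snd measurable_fst)
  have hFleft (x : ℝ) : g x * densityCDF κ w x = ∫ y, F (x, y) ∂κ := by
    rw [densityCDF, ← integral_indicator measurableSet_Iic, ← integral_const_mul]
    congr 1 with y
    by_cases h : y ≤ x <;> simp [hF, indicator, h]
  have hFright (x y : ℝ) : F (x, y) = (Ici y).indicator g x * w y := by
    by_cases h : y ≤ x <;> simp [hF, indicator, h]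
  simp_rw [intervalIntegral.integral_of_le hab, hFleft]
  rw [integral_integral_swap (f := fun x y => F (x, y)) hFint]
  refine integral_congr_ae ?_
  filter_upwards [ae_mem_Icc hκ] with y hy
  simp_rw [hFright]
  rw [integral_mul_const, integral_indicator_Ici_eq_intervalIntegral hy]

lemma lipschitzWith_intervalIntegral (hg : Measurable g) (hg1 : ∀ x, |g x| ≤ 1) (b : ℝ) :
    LipschitzWith 1 fun y => ∫ x in y..b, g x := by
  have hi (u v : ℝ) : IntervalIntegrable g volume u v :=
    (intervalIntegrable_const (c := (1 : ℝ))).mono_fun hg.aestronglyMeasurable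
      (ae_of_all _ fun x => by simpa using hg1 x)
  refine LipschitzWith.of_dist_le_mul fun y z => ?_
  rw [Real.dist_eq, Real.dist_eq, NNReal.coe_one, abs_sub_comm y z,
    intervalIntegral.integral_interval_sub_interval_comm (hi y b) (hi z b) (hi y z),
    intervalIntegral.integral_same, sub_zero]
  exact intervalIntegral.norm_integral_le_of_norm_le_const (f := g) fun x _ => hg1 x

lemma intervalIntegrable_mul_densityCDF (hw : Integrable w κ) (hg : Measurable g)
    (hg1 : ∀ x, |g x| ≤ 1) (a b : ℝ) :
    IntervalIntegrable (fun x => g x * densityCDF κ w x) volume a b := by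
  refine (intervalIntegrable_const (c := ∫ y, |w y| ∂κ)).mono_fun
    (hg.mul (measurable_densityCDF hw)).aestronglyMeasurable (ae_of_all _ fun x => ?_)
  simp only [norm_mul, Real.norm_eq_abs]
  exact (mul_le_of_le_one_left (abs_nonneg _) (hg1 x)).trans
    ((abs_densityCDF_le hw x).trans (le_abs_self _))

lemma wassersteinDist_densityCDF_eq_ofReal (hab : a ≤ b)
    (hν : ν (Icc a b)ᶜ = 0) (hκ : κ (Icc a b)ᶜ = 0) (hu : Integrable u ν) (hw : Integrable w κ)
    (hmass : ∫ y, u y ∂ν = ∫ y, w y ∂κ) :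
    wassersteinDist (densityCDF ν u) (densityCDF κ w) =
      ENNReal.ofReal (∫ x in a..b, |densityCDF ν u x - densityCDF κ w x|) := by
  have hzero (x : ℝ) (hx : x ∉ Icc a b) : densityCDF ν u x - densityCDF κ w x = 0 := by
    rcases lt_or_ge x a with hxa | hxa
    · rw [densityCDF_eq_zero_of_lt hν hxa, densityCDF_eq_zero_of_lt hκ hxa, sub_zero]
    · have hbx : b ≤ x := (not_le.1 fun hxb => hx ⟨hxa, hxb⟩).le
      rw [densityCDF_eq_integral_of_le hν hbx, densityCDF_eq_integral_of_le hκ hbx, hmass, sub_self]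
  have hint : IntervalIntegrable (fun x => |densityCDF ν u x - densityCDF κ w x|) volume a b := by
    have hi := intervalIntegrable_mul_densityCDF hu measurable_one (by simp) a b
    have hi' := intervalIntegrable_mul_densityCDF hw measurable_one (by simp) a b
    simpa using (hi.sub hi').abs
  rw [wassersteinDist, intervalIntegral.integral_of_le hab, ofReal_integral_eq_lintegral_ofReal
    ((intervalIntegrable_iff_integrableOn_Ioc_of_le hab).1 hint)
    (ae_of_all _ fun _ => abs_nonneg _), restrict_Ioc_eq_restrict_Icc,
    setLIntegral_eq_of_support_subset fun x hx => ?_]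
  by_contra hxab
  exact hx (by simp only [hzero x hxab, abs_zero, ENNReal.ofReal_zero])

/-- One half of Kantorovich–Rubinstein duality. -/
lemma wassersteinDist_densityCDF_le [SFinite ν] [SFinite κ] (hab : a ≤ b)
    (hν : ν (Icc a b)ᶜ = 0) (hκ : κ (Icc a b)ᶜ = 0) (hu : Integrable u ν) (hw : Integrable w κ)
    (hmass : ∫ y, u y ∂ν = ∫ y, w y ∂κ)
    (h : ∀ f : ℝ → ℝ, LipschitzWith 1 f → ∫ y, f y * u y ∂ν - ∫ y, f y * w y ∂κ ≤ M) :
    wassersteinDist (densityCDF ν u) (densityCDF κ w) ≤ ENNReal.ofReal M := by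
  set D : ℝ → ℝ := fun x => densityCDF ν u x - densityCDF κ w x
  set g : ℝ → ℝ := fun x => if 0 ≤ D x then 1 else -1 with hg
  have hD : Measurable D := (measurable_densityCDF hu).sub (measurable_densityCDF hw)
  have hgm : Measurable g :=
    Measurable.ite (measurableSet_le measurable_const hD) measurable_const measurable_const
  have hg1 (x : ℝ) : |g x| ≤ 1 := by simp only [hg]; split_ifs <;> simp
  have hgD (x : ℝ) : |D x| = g x * densityCDF ν u x - g x * densityCDF κ w x := by
    rw [← mul_sub]
    simp only [hg]
    split_ifs with h0
    · rw [abs_of_nonneg h0, one_mul]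
    · rw [abs_of_neg (not_le.1 h0), neg_one_mul]
  rw [wassersteinDist_densityCDF_eq_ofReal hab hν hκ hu hw hmass]
  refine ENNReal.ofReal_le_ofReal ?_
  calc ∫ x in a..b, |D x|
      = (∫ x in a..b, g x * densityCDF ν u x) - ∫ x in a..b, g x * densityCDF κ w x := by
        simp_rw [hgD]
        exact intervalIntegral.integral_sub (intervalIntegrable_mul_densityCDF hu hgm hg1 a b)
          (intervalIntegrable_mul_densityCDF hw hgm hg1 a b)
    _ = ∫ y, (∫ x in y..b, g x) * u y ∂ν - ∫ y, (∫ x in y..b, g x) * w y ∂κ := by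
        rw [integral_mul_densityCDF hab hν hu hgm hg1, integral_mul_densityCDF hab hκ hw hgm hg1]
    _ ≤ M := h _ (lipschitzWith_intervalIntegral hgm hg1 b)

lemma abs_setIntegral_Ioc_mul_le {h : ℝ → ℝ} {η c d : ℝ} (hw : Integrable w κ)
    (hhw : Integrable (fun y => h y * w y) κ) (hcd : c ≤ d) (hM : |h c| ≤ M)
    (hη : ∀ x ∈ Ioc c d, |h x - h c| ≤ η) :
    |∫ y in Ioc c d, h y * w y ∂κ| ≤
      M * |densityCDF κ w d - densityCDF κ w c| + η * ∫ y in Ioc c d, |w y| ∂κ := by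
  have hdiff : Integrable (fun y => (h y - h c) * w y) κ := by
    simp_rw [sub_mul]
    exact hhw.sub (hw.const_mul (h c))
  have hsplit : ∫ y in Ioc c d, h y * w y ∂κ =
      h c * (∫ y in Ioc c d, w y ∂κ) + ∫ y in Ioc c d, (h y - h c) * w y ∂κ := by
    rw [← integral_const_mul, ← integral_add (hw.const_mul _).integrableOn hdiff.integrableOn]
    congr 1 with y
    ring
  rw [hsplit, densityCDF_sub_densityCDF hw hcd]
  refine (abs_add_le _ _).trans (add_le_add ?_ ?_)
  · rw [abs_mul]
    gcongr
  · rw [← integral_const_mul]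
    refine abs_integral_le_integral_abs.trans <| setIntegral_mono_on hdiff.abs.integrableOn
      (hw.abs.const_mul _).integrableOn measurableSet_Ioc fun y hy => ?_
    rw [abs_mul]
    gcongr
    exact hη y hy

lemma abs_setIntegral_Ioc_mul_le_sum {h : ℝ → ℝ} {η : ℝ} (hw : Integrable w κ)
    (hh : Measurable h) (hM : ∀ x, |h x| ≤ M) {t : ℕ → ℝ} (ht : Monotone t)
    (hη : ∀ i, ∀ x ∈ Ioc (t i) (t (i + 1)), |h x - h (t i)| ≤ η) (n : ℕ) :
    |∫ y in Ioc (t 0) (t n), h y * w y ∂κ| ≤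
      M * (∑ i ∈ Finset.range n, |densityCDF κ w (t (i + 1)) - densityCDF κ w (t i)|) +
      η * ∫ y in Ioc (t 0) (t n), |w y| ∂κ := by
  have hhw : Integrable (fun y => h y * w y) κ :=
    hw.bdd_mul hh.aestronglyMeasurable (ae_of_all _ hM)
  induction n with
  | zero => simp
  | succ n ih =>
    have hdisj : Disjoint (Ioc (t 0) (t n)) (Ioc (t n) (t (n + 1))) :=
      Ioc_disjoint_Ioc_of_le le_rfl
    have hstep := abs_setIntegral_Ioc_mul_le hw hhw (ht n.le_succ) (hM _) (hη n)
    rw [← Ioc_union_Ioc_eq_Ioc (ht n.zero_le) (ht n.le_succ),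
      setIntegral_union hdisj measurableSet_Ioc hhw.integrableOn hhw.integrableOn,
      setIntegral_union hdisj measurableSet_Ioc hw.abs.integrableOn hw.abs.integrableOn,
      Finset.sum_range_succ]
    refine (abs_add_le _ _).trans ?_
    linarith

lemma ofReal_sum_abs_sub_le_totalVar (Υ : ℝ → ℝ) {t : ℕ → ℝ} (ht : Monotone t) (n : ℕ) :
    ENNReal.ofReal (∑ i ∈ Finset.range n, |Υ (t (i + 1)) - Υ (t i)|) ≤ totalVar Υ := by
  rw [ENNReal.ofReal_sum_of_nonneg fun _ _ => abs_nonneg _]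
  simp_rw [← Real.dist_eq, ← edist_dist]
  exact eVariationOn.sum_le ht fun _ => mem_univ _

lemma ofReal_abs_integral_mul_le_of_uniformContinuous [IsFiniteMeasure κ] {h : ℝ → ℝ}
    (hκ : κ (Icc a b)ᶜ = 0) (hw : Integrable w κ) (hh : UniformContinuous h)
    (hM : ∀ x, |h x| ≤ M) :
    ENNReal.ofReal |∫ y, h y * w y ∂κ| ≤ ENNReal.ofReal M * totalVar (densityCDF κ w) := by
  have hM0 : 0 ≤ M := (abs_nonneg _).trans (hM 0)
  set W := ∫ y, |w y| ∂κ
  have hW : 0 < W + 1 := add_pos_of_nonneg_of_pos (integral_nonneg fun _ => abs_nonneg _) one_pos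
  refine ENNReal.le_of_forall_pos_le_add fun ε hε _ => ?_
  obtain ⟨δ, hδ, hhδ⟩ := Metric.uniformContinuous_iff.1 hh (ε / (W + 1)) (div_pos hε hW)
  set t : ℕ → ℝ := fun i => a - δ / 2 + i * (δ / 2) with htdef
  have ht : Monotone t := fun i j hij => by
    simp only [htdef]
    gcongr
  have htsucc (i : ℕ) : t (i + 1) = t i + δ / 2 := by
    simp only [htdef]
    push_cast
    ring
  obtain ⟨n, hn⟩ := exists_nat_gt ((b - a + δ / 2) / (δ / 2))
  have htn : b ≤ t n := by
    rw [div_lt_iff₀ (half_pos hδ)] at hn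
    simp only [htdef]
    linarith
  have hmem : ∀ᵐ y ∂κ, y ∈ Ioc (t 0) (t n) := by
    filter_upwards [ae_mem_Icc hκ] with y hy
    refine ⟨?_, hy.2.trans htn⟩
    simp only [htdef, Nat.cast_zero, zero_mul, add_zero]
    linarith [hy.1]
  have hbound := abs_setIntegral_Ioc_mul_le_sum hw hh.continuous.measurable hM ht
    (η := ε / (W + 1)) (fun i x hx => (hhδ <| by
      rw [Real.dist_eq, abs_of_pos (sub_pos.2 hx.1)]
      linarith [hx.2, htsucc i]).le) n
  rw [Measure.restrict_eq_self_of_ae_mem hmem] at hbound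
  have hrest : ε / (W + 1) * W ≤ ε := by
    rw [div_mul_eq_mul_div]
    exact div_le_of_le_mul₀ hW.le ε.coe_nonneg (by gcongr; linarith)
  calc ENNReal.ofReal |∫ y, h y * w y ∂κ|
      ≤ ENNReal.ofReal (M * ∑ i ∈ Finset.range n, |densityCDF κ w (t (i + 1)) -
          densityCDF κ w (t i)| + ε) := ENNReal.ofReal_le_ofReal (hbound.trans (by gcongr))
    _ ≤ ENNReal.ofReal M * totalVar (densityCDF κ w) + ε := by
        rw [ENNReal.ofReal_add (by positivity) ε.coe_nonneg, ENNReal.ofReal_mul hM0,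
          ENNReal.ofReal_coe_nnreal]
        gcongr
        exact ofReal_sum_abs_sub_le_totalVar _ ht n

lemma ofReal_abs_integral_mul_le_totalVar [IsFiniteMeasure κ] {h : ℝ → ℝ} (hab : a ≤ b)
    (hκ : κ (Icc a b)ᶜ = 0) (hw : Integrable w κ) (hh : Continuous h)
    (hM : ∀ x ∈ Icc a b, |h x| ≤ M) :
    ENNReal.ofReal |∫ y, h y * w y ∂κ| ≤ ENNReal.ofReal M * totalVar (densityCDF κ w) := by
  have hcont : Continuous fun x : Icc a b => h x := hh.comp continuous_subtype_val
  have hext : ∫ y, h y * w y ∂κ = ∫ y, IccExtend hab (fun x : Icc a b => h x) y * w y ∂κ := by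
    refine integral_congr_ae ?_
    filter_upwards [ae_mem_Icc hκ] with y hy
    rw [IccExtend_of_mem hab _ hy]
  rw [hext]
  exact ofReal_abs_integral_mul_le_of_uniformContinuous hκ hw
    ((CompactSpace.uniformContinuous_of_continuous hcont).comp
      (LipschitzWith.projIcc hab).uniformContinuous) fun x => hM _ (projIcc a b hab x).2

end Density

section OrthogonalPolynomials

/-- Every polynomial is integrable, so that `∫ p q dμ` makes sense on polynomials. -/
def PolyIntegrable (μ : Measure ℝ) : Prop := ∀ p : ℝ[X], Integrable (fun x => p.eval x) μ

lemma integrable_continuous_mul {μ : Measure ℝ} {a b : ℝ} (hμ : μ (Icc a b)ᶜ = 0) {f g : ℝ → ℝ}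
    (hf : Continuous f) (hg : Integrable g μ) : Integrable (fun y => f y * g y) μ := by
  obtain ⟨C, hC⟩ := isCompact_Icc.exists_bound_of_continuousOn (s := Icc a b) hf.continuousOn
  refine hg.bdd_mul (c := C) hf.aestronglyMeasurable ?_
  filter_upwards [ae_mem_Icc hμ] with y hy using hC y hy

lemma integrable_of_continuous {μ : Measure ℝ} [IsFiniteMeasure μ] {a b : ℝ}
    (hμ : μ (Icc a b)ᶜ = 0) {f : ℝ → ℝ} (hf : Continuous f) : Integrable f μ := by
  simpa only [mul_one] using integrable_continuous_mul hμ hf (integrable_const (1 : ℝ))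

lemma polyIntegrable_of_compl_Icc {μ : Measure ℝ} [IsFiniteMeasure μ] {a b : ℝ}
    (hμ : μ (Icc a b)ᶜ = 0) : PolyIntegrable μ :=
  fun p => integrable_of_continuous hμ p.continuous

/-- Integration of polynomials as a linear functional. -/
noncomputable def polyInt {μ : Measure ℝ} (h : PolyIntegrable μ) : ℝ[X] →ₗ[ℝ] ℝ where
  toFun p := ∫ x, p.eval x ∂μ
  map_add' p q := by simp only [eval_add]; exact integral_add (h p) (h q)
  map_smul' c p := by simp [integral_const_mul]

/-- The orthogonal polynomials of degree less than `m` have nonzero norm, which is to say that `μ`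
has at least `m` points of support. -/
def OrthNondeg (μ : Measure ℝ) (m : ℕ) : Prop :=
  ∀ i < m, ∫ x, ((monicOrth μ i).eval x) ^ 2 ∂μ ≠ 0

variable {μ : Measure ℝ}

lemma polyInt_apply (h : PolyIntegrable μ) (p : ℝ[X]) : polyInt h p = ∫ x, p.eval x ∂μ := rfl

lemma polyInt_C_mul (h : PolyIntegrable μ) (c : ℝ) (p : ℝ[X]) :
    polyInt h (C c * p) = c * polyInt h p := by
  rw [← smul_eq_C_mul, map_smul, smul_eq_mul]

lemma polyInt_mul_self (h : PolyIntegrable μ) (p : ℝ[X]) :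
    polyInt h (p * p) = ∫ x, (p.eval x) ^ 2 ∂μ := by
  simp only [polyInt_apply, eval_mul, sq]

lemma polyInt_mul_self_nonneg (h : PolyIntegrable μ) (p : ℝ[X]) : 0 ≤ polyInt h (p * p) :=
  polyInt_mul_self h p ▸ integral_nonneg fun _ => sq_nonneg _

lemma ae_eval_eq_zero_of_polyInt_eq_zero (h : PolyIntegrable μ) {p : ℝ[X]}
    (hp0 : ∀ᵐ x ∂μ, 0 ≤ p.eval x) (hp : polyInt h p = 0) : ∀ᵐ x ∂μ, p.eval x = 0 := by
  rwa [polyInt_apply, integral_eq_zero_iff_of_nonneg_ae hp0 (h _)] at hp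

lemma ae_eval_eq_zero_of_polyInt_mul_self (h : PolyIntegrable μ) {p : ℝ[X]}
    (hp : polyInt h (p * p) = 0) : ∀ᵐ x ∂μ, p.eval x = 0 := by
  filter_upwards [ae_eval_eq_zero_of_polyInt_eq_zero h
    (Eventually.of_forall fun x => by simpa only [eval_mul] using mul_self_nonneg _) hp] with x hx
  simpa using hx

lemma polyInt_mul_eq_zero_of_ae (h : PolyIntegrable μ) {p : ℝ[X]}
    (hp : ∀ᵐ x ∂μ, p.eval x = 0) (q : ℝ[X]) : polyInt h (p * q) = 0 := by
  refine integral_eq_zero_of_ae ?_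
  filter_upwards [hp] with x hx
  simp [hx]

lemma degree_C_mul_le_degree (c : ℝ) (p : ℝ[X]) : (C c * p).degree ≤ p.degree := by
  rw [← smul_eq_C_mul]
  exact degree_smul_le c p

lemma degree_sum_lt {ι : Type*} {s : Finset ι} {p : ι → ℝ[X]} {m : ℕ}
    (hp : ∀ i ∈ s, (p i).degree < m) : (∑ i ∈ s, p i).degree < m :=
  mem_degreeLT.1 (Submodule.sum_mem _ fun i hi => mem_degreeLT.2 (hp i hi))

lemma exists_sum_eq_of_degree_lt (S : Polynomial.Sequence ℝ) {m : ℕ} {q : ℝ[X]}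
    (hq : q.degree < m) : ∃ c : ℕ → ℝ, ∑ i ∈ Finset.range m, C (c i) * S i = q := by
  have hmem : q ∈ Submodule.span ℝ (S '' ↑(Finset.range m)) := by
    rw [Finset.coe_range, S.span_degreeLT fun i _ => (leadingCoeff_ne_zero.2 (S.ne_zero i)).isUnit]
    exact mem_degreeLT.2 hq
  simpa only [smul_eq_C_mul] using Submodule.mem_span_image_finset_iff_exists_fun' ℝ |>.1 hmem

lemma polyInt_sum_mul (h : PolyIntegrable μ) {S : ℕ → ℝ[X]}
    (horth : ∀ i j, i ≠ j → polyInt h (S i * S j) = 0) (c : ℕ → ℝ) {m j : ℕ} (hj : j < m) :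
    polyInt h ((∑ i ∈ Finset.range m, C (c i) * S i) * S j) = c j * polyInt h (S j * S j) := by
  rw [Finset.sum_mul, map_sum, Finset.sum_eq_single_of_mem j (Finset.mem_range.2 hj),
    mul_assoc, polyInt_C_mul]
  intro i _ hij
  rw [mul_assoc, polyInt_C_mul, horth i j hij, mul_zero]

lemma eq_zero_of_forall_polyInt_mul_eq_zero (h : PolyIntegrable μ) {S : Polynomial.Sequence ℝ}
    (horth : ∀ i j, i ≠ j → polyInt h (S i * S j) = 0) {m : ℕ}
    (hne : ∀ i < m, polyInt h (S i * S i) ≠ 0) {q : ℝ[X]} (hq : q.degree < m)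
    (h0 : ∀ i < m, polyInt h (q * S i) = 0) : q = 0 := by
  obtain ⟨c, rfl⟩ := exists_sum_eq_of_degree_lt S hq
  refine Finset.sum_eq_zero fun i hi => ?_
  have hi := Finset.mem_range.1 hi
  have hci : c i = 0 := by simpa [polyInt_sum_mul h horth c hi, hne i hi] using h0 i hi
  rw [hci, C_0, zero_mul]

/-! ### Monic orthogonal polynomials -/

lemma monicOrth_monic_and_degree (μ : Measure ℝ) (i : ℕ) :
    (monicOrth μ i).Monic ∧ (monicOrth μ i).degree = i := by
  induction i using Nat.strong_induction_on with
  | _ i ih =>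
    rw [monicOrth]
    set r := ∑ j : Fin i,
      C ((∫ x, x ^ i * (monicOrth μ j).eval x ∂μ) / (∫ x, ((monicOrth μ j).eval x) ^ 2 ∂μ)) *
        monicOrth μ j
    have hr : r.degree < (X ^ i : ℝ[X]).degree := by
      rw [degree_X_pow]
      refine degree_sum_lt fun j _ => (degree_C_mul_le_degree _ _).trans_lt ?_
      rw [(ih j j.2).2]
      exact_mod_cast j.2
    exact ⟨(monic_X_pow i).sub_of_left hr, by rw [degree_sub_eq_left_of_degree_lt hr, degree_X_pow]⟩

lemma monicOrth_monic (μ : Measure ℝ) (i : ℕ) : (monicOrth μ i).Monic :=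
  (monicOrth_monic_and_degree μ i).1

lemma degree_monicOrth (μ : Measure ℝ) (i : ℕ) : (monicOrth μ i).degree = i :=
  (monicOrth_monic_and_degree μ i).2

lemma natDegree_monicOrth (μ : Measure ℝ) (i : ℕ) : (monicOrth μ i).natDegree = i :=
  natDegree_eq_of_degree_eq_some (degree_monicOrth μ i)

/-- The monic orthogonal polynomials, bundled with the fact that the `i`-th one has degree `i`. -/
noncomputable def monicOrthSequence (μ : Measure ℝ) : Polynomial.Sequence ℝ where
  elems' := monicOrth μ
  degree_eq' := degree_monicOrth μ

lemma polyInt_monicOrth_mul_of_lt (h : PolyIntegrable μ) (i : ℕ) :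
    ∀ j < i, polyInt h (monicOrth μ i * monicOrth μ j) = 0 := by
  induction i using Nat.strong_induction_on with
  | _ i ih =>
    intro j hj
    have horth : ∀ k : Fin i, k ≠ ⟨j, hj⟩ → polyInt h (monicOrth μ k * monicOrth μ j) = 0 := by
      intro k hk
      rcases lt_or_gt_of_ne (Fin.val_ne_of_ne hk) with hk | hk
      · rw [mul_comm]; exact ih j hj k hk
      · exact ih k k.2 j hk
    have hmom : ∫ x, x ^ i * (monicOrth μ j).eval x ∂μ = polyInt h (X ^ i * monicOrth μ j) := by
      simp [polyInt_apply]
    rw [monicOrth, sub_mul, map_sub, Finset.sum_mul, map_sum, Finset.sum_eq_single ⟨j, hj⟩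
      (fun k _ hk => by rw [mul_assoc, polyInt_C_mul, horth k hk, mul_zero]) (by simp),
      mul_assoc, polyInt_C_mul, hmom, ← polyInt_mul_self h]
    by_cases h0 : polyInt h (monicOrth μ j * monicOrth μ j) = 0
    · rw [h0, mul_comm (X ^ i),
        polyInt_mul_eq_zero_of_ae h (ae_eval_eq_zero_of_polyInt_mul_self h h0), mul_zero, sub_zero]
    · rw [div_mul_cancel₀ _ h0, sub_self]

lemma polyInt_monicOrth_mul_of_ne (h : PolyIntegrable μ) (i j : ℕ) (hij : i ≠ j) :
    polyInt h (monicOrth μ i * monicOrth μ j) = 0 := by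
  rcases lt_or_gt_of_ne hij with hij | hij
  · rw [mul_comm, polyInt_monicOrth_mul_of_lt h j i hij]
  · exact polyInt_monicOrth_mul_of_lt h i j hij

lemma polyInt_monicOrth_mul (h : PolyIntegrable μ) {i : ℕ} {q : ℝ[X]} (hq : q.degree < i) :
    polyInt h (monicOrth μ i * q) = 0 := by
  obtain ⟨c, rfl⟩ := exists_sum_eq_of_degree_lt (monicOrthSequence μ) hq
  rw [Finset.mul_sum, map_sum]
  refine Finset.sum_eq_zero fun j hj => ?_
  rw [mul_left_comm, polyInt_C_mul]
  exact mul_eq_zero_of_right _ (polyInt_monicOrth_mul_of_lt h i j (Finset.mem_range.1 hj))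

lemma OrthNondeg.polyInt_ne_zero (h : PolyIntegrable μ) {m i : ℕ} (hm : OrthNondeg μ m)
    (hi : i < m) : polyInt h (monicOrth μ i * monicOrth μ i) ≠ 0 :=
  polyInt_mul_self h (monicOrth μ i) ▸ hm i hi

lemma OrthNondeg.eq_zero_of_ae (h : PolyIntegrable μ) {m : ℕ} (hm : OrthNondeg μ m) {q : ℝ[X]}
    (hq : q.degree < m) (h0 : ∀ᵐ x ∂μ, q.eval x = 0) : q = 0 :=
  eq_zero_of_forall_polyInt_mul_eq_zero h (S := monicOrthSequence μ)
    (polyInt_monicOrth_mul_of_ne h) (fun _ hi => hm.polyInt_ne_zero h hi) hq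
    fun _ _ => polyInt_mul_eq_zero_of_ae h h0 _

lemma orthNondeg_of_encard_support_le (h : PolyIntegrable μ) {m : ℕ}
    (hm : (m : ℕ∞) ≤ μ.support.encard) : OrthNondeg μ m := by
  intro i hi h0
  rw [← polyInt_mul_self h] at h0
  have hsub : μ.support ⊆ ((monicOrth μ i).roots.toFinset : Set ℝ) := by
    refine Measure.support_subset_of_isClosed (Finset.finite_toSet _).isClosed ?_
    filter_upwards [ae_eval_eq_zero_of_polyInt_mul_self h h0] with x hx
    simpa [(monicOrth_monic μ i).ne_zero] using hx
  have hroots : (monicOrth μ i).roots.toFinset.card ≤ i :=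
    (Multiset.toFinset_card_le _).trans ((card_roots' _).trans (natDegree_monicOrth μ i).le)
  have hle : (m : ℕ∞) ≤ ((monicOrth μ i).roots.toFinset.card : ℕ∞) := by
    rw [← Set.encard_coe_eq_coe_finsetCard]
    exact hm.trans (Set.encard_le_encard hsub)
  exact absurd (Nat.cast_le.1 hle) (by omega)

/-! ### Zeros of orthogonal polynomials -/

lemma OrthNondeg.natDegree_eq_zero_of_ae_pos (h : PolyIntegrable μ) {m : ℕ} (hm : OrthNondeg μ m)
    {f g : ℝ[X]} (hfg : monicOrth μ m = f * g) (hf : ∀ᵐ x ∂μ, 0 < f.eval x) :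
    f.natDegree = 0 := by
  by_contra hdeg
  have hfg0 : f * g ≠ 0 := hfg ▸ (monicOrth_monic μ m).ne_zero
  have hg0 : g ≠ 0 := right_ne_zero_of_mul hfg0
  have hgm : g.degree < m := by
    have hadd := natDegree_mul (left_ne_zero_of_mul hfg0) hg0
    rw [← hfg, natDegree_monicOrth] at hadd
    rw [degree_eq_natDegree hg0]
    exact_mod_cast by omega
  have hint := polyInt_monicOrth_mul h hgm
  rw [hfg, mul_assoc] at hint
  refine hg0 (hm.eq_zero_of_ae h hgm ?_)
  have hnonneg : ∀ᵐ x ∂μ, 0 ≤ (f * (g * g)).eval x := by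
    filter_upwards [hf] with x hx
    simpa only [eval_mul] using mul_nonneg hx.le (mul_self_nonneg _)
  filter_upwards [ae_eval_eq_zero_of_polyInt_eq_zero h hnonneg hint, hf] with x hx hfx
  simpa [hfx.ne'] using hx

lemma OrthNondeg.natDegree_eq_zero_of_ae_neg (h : PolyIntegrable μ) {m : ℕ} (hm : OrthNondeg μ m)
    {f g : ℝ[X]} (hfg : monicOrth μ m = f * g) (hf : ∀ᵐ x ∂μ, f.eval x < 0) :
    f.natDegree = 0 := by
  rw [← natDegree_neg]
  refine hm.natDegree_eq_zero_of_ae_pos h (g := -g) (by rw [hfg, neg_mul_neg]) ?_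
  filter_upwards [hf] with x hx
  simpa using hx

lemma forall_pos_or_forall_neg {f : ℝ → ℝ} (hf : Continuous f) (h0 : ∀ x, f x ≠ 0) :
    (∀ x, 0 < f x) ∨ ∀ x, f x < 0 := by
  by_contra! hsign
  obtain ⟨⟨x, hx⟩, y, hy⟩ := hsign
  obtain ⟨z, hz⟩ := mem_range_of_exists_le_of_exists_ge hf ⟨x, hx⟩ ⟨y, hy⟩
  exact h0 z hz

lemma OrthNondeg.card_roots (h : PolyIntegrable μ) {m : ℕ} (hm : OrthNondeg μ m) :
    Multiset.card (monicOrth μ m).roots = m := by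
  obtain ⟨q, hq, hcard, hroots⟩ := exists_prod_multiset_X_sub_C_mul (monicOrth μ m)
  rw [mul_comm] at hq
  have hq0 : q ≠ 0 := left_ne_zero_of_mul (hq ▸ (monicOrth_monic μ m).ne_zero)
  have hqne : ∀ x, q.eval x ≠ 0 := fun x hx => by
    simpa [hroots] using (mem_roots hq0).2 hx
  have hqdeg : q.natDegree = 0 := by
    rcases forall_pos_or_forall_neg q.continuous hqne with hpos | hneg
    · exact hm.natDegree_eq_zero_of_ae_pos h hq.symm (Eventually.of_forall hpos)
    · exact hm.natDegree_eq_zero_of_ae_neg h hq.symm (Eventually.of_forall hneg)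
  rwa [hqdeg, add_zero, natDegree_monicOrth] at hcard

lemma OrthNondeg.nodup_roots (h : PolyIntegrable μ) {m : ℕ} (hm : OrthNondeg μ m) :
    (monicOrth μ m).roots.Nodup := by
  rw [Multiset.nodup_iff_count_le_one]
  intro r
  by_contra hr
  rw [count_roots] at hr
  obtain ⟨q, hq⟩ : (X - C r) ^ 2 ∣ monicOrth μ m :=
    (le_rootMultiplicity_iff (monicOrth_monic μ m).ne_zero).1 (by omega)
  have hq0 : q ≠ 0 := right_ne_zero_of_mul (hq ▸ (monicOrth_monic μ m).ne_zero)
  have hdeg : m = 2 + q.natDegree := by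
    have := congrArg natDegree hq
    rwa [natDegree_monicOrth, natDegree_mul (pow_ne_zero _ (X_sub_C_ne_zero r)) hq0,
      natDegree_pow, natDegree_X_sub_C, mul_one] at this
  have hqm : q.degree < m := by
    rw [degree_eq_natDegree hq0]
    exact_mod_cast by omega
  have hrqm : ((X - C r) * q).degree < (m : WithBot ℕ) := by
    rw [degree_mul, degree_X_sub_C, degree_eq_natDegree hq0]
    exact_mod_cast by omega
  have hint := polyInt_monicOrth_mul h hqm
  rw [hq, show (X - C r) ^ 2 * q * q = ((X - C r) * q) * ((X - C r) * q) by ring] at hint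
  exact mul_ne_zero (X_sub_C_ne_zero r) hq0
    (hm.eq_zero_of_ae h hrqm (ae_eval_eq_zero_of_polyInt_mul_self h hint))

lemma OrthNondeg.card_orthNodes (h : PolyIntegrable μ) {m : ℕ} (hm : OrthNondeg μ m) :
    (orthNodes μ m).card = m := by
  rw [orthNodes, Multiset.toFinset_card_of_nodup (hm.nodup_roots h), hm.card_roots h]

lemma eval_monicOrth_of_mem_orthNodes {m : ℕ} {r : ℝ} (hr : r ∈ orthNodes μ m) :
    (monicOrth μ m).eval r = 0 := by
  rw [orthNodes, Multiset.mem_toFinset] at hr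
  exact (mem_roots'.1 hr).2

lemma OrthNondeg.orthNodes_subset_Icc (h : PolyIntegrable μ) {a b : ℝ} (hμ : μ (Icc a b)ᶜ = 0)
    {m : ℕ} (hm : OrthNondeg μ m) : ↑(orthNodes μ m) ⊆ Icc a b := by
  intro r hr
  obtain ⟨q, hq⟩ := dvd_iff_isRoot.2 (eval_monicOrth_of_mem_orthNodes hr)
  by_contra hab
  refine absurd (natDegree_X_sub_C r) ?_
  rcases not_and_or.1 hab with hra | hrb
  · rw [hm.natDegree_eq_zero_of_ae_pos h hq]
    · exact zero_ne_one
    · filter_upwards [ae_mem_Icc hμ] with x hx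
      simpa using (not_le.1 hra).trans_le hx.1
  · rw [hm.natDegree_eq_zero_of_ae_neg h hq]
    · exact zero_ne_one
    · filter_upwards [ae_mem_Icc hμ] with x hx
      simpa using hx.2.trans_lt (not_le.1 hrb)

/-! ### Orthonormal polynomials -/

lemma degree_orthPoly_le (μ : Measure ℝ) (i : ℕ) : (orthPoly μ i).degree ≤ i :=
  (degree_C_mul_le_degree _ _).trans (degree_monicOrth μ i).le

lemma OrthNondeg.sum_orthPoly_eq (h : PolyIntegrable μ) {m : ℕ} (hm : OrthNondeg μ m) {q : ℝ[X]}
    (hq : q.degree < m) :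
    ∑ i ∈ Finset.range m, C (polyInt h (q * orthPoly μ i)) * orthPoly μ i = q := by
  obtain ⟨c, hc⟩ := exists_sum_eq_of_degree_lt (monicOrthSequence μ) hq
  refine (Finset.sum_congr rfl fun i hi => ?_).trans hc
  have hi := Finset.mem_range.1 hi
  set N := polyInt h (monicOrth μ i * monicOrth μ i) with hN
  have hcoeff : polyInt h (q * monicOrth μ i) = c i * N := by
    rw [← hc]
    exact polyInt_sum_mul h (polyInt_monicOrth_mul_of_ne h) c hi
  change _ = C (c i) * monicOrth μ i
  rw [orthPoly, ← polyInt_mul_self h, ← hN, mul_left_comm q, polyInt_C_mul, hcoeff, ← mul_assoc,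
    ← C_mul, mul_right_comm, ← mul_inv, Real.mul_self_sqrt (polyInt_mul_self_nonneg h _),
    mul_comm (c i), inv_mul_cancel_left₀ (hm.polyInt_ne_zero h hi)]

section Uniqueness

variable {S : Polynomial.Sequence ℝ}

lemma eq_leadingCoeff_mul_monicOrth (h : PolyIntegrable μ)
    (horth : ∀ i j, polyInt h (S i * S j) = if i = j then 1 else 0) (i : ℕ) :
    S i = C (S i).leadingCoeff * monicOrth μ i := by
  have hlead : (S i).leadingCoeff ≠ 0 := leadingCoeff_ne_zero.2 (S.ne_zero i)
  have hdeg : (S i - C (S i).leadingCoeff * monicOrth μ i).degree < i := by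
    rw [← S.degree_eq i]
    refine degree_sub_lt_left ?_ (S.ne_zero i) ?_
    · rw [degree_C_mul hlead, degree_monicOrth, S.degree_eq]
    · rw [leadingCoeff_mul, leadingCoeff_C, (monicOrth_monic μ i).leadingCoeff, mul_one]
  refine sub_eq_zero.1 (eq_zero_of_forall_polyInt_mul_eq_zero h
    (fun i j hij => by rw [horth, if_neg hij]) (fun j _ => by simp [horth]) hdeg fun j hj => ?_)
  have hjdeg : (S j).degree < i := by
    rw [S.degree_eq]
    exact_mod_cast hj
  rw [sub_mul, map_sub, horth, if_neg hj.ne', mul_assoc, polyInt_C_mul,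
    polyInt_monicOrth_mul h hjdeg, mul_zero, sub_zero]

lemma sq_leadingCoeff_mul_integral_sq (h : PolyIntegrable μ)
    (horth : ∀ i j, polyInt h (S i * S j) = if i = j then 1 else 0) (i : ℕ) :
    (S i).leadingCoeff ^ 2 * ∫ x, ((monicOrth μ i).eval x) ^ 2 ∂μ = 1 := by
  have hnorm := horth i i
  rwa [if_pos rfl, eq_leadingCoeff_mul_monicOrth h horth i, mul_mul_mul_comm, ← C_mul,
    polyInt_C_mul, polyInt_mul_self, ← sq] at hnorm

lemma orthNondeg_of_orthonormal (h : PolyIntegrable μ)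
    (horth : ∀ i j, polyInt h (S i * S j) = if i = j then 1 else 0) (m : ℕ) :
    OrthNondeg μ m :=
  fun i _ h0 => by simpa [h0] using sq_leadingCoeff_mul_integral_sq h horth i

lemma orthPoly_eq_of_orthonormal (h : PolyIntegrable μ)
    (horth : ∀ i j, polyInt h (S i * S j) = if i = j then 1 else 0) {i : ℕ}
    (hlead : 0 < (S i).leadingCoeff) : orthPoly μ i = S i := by
  have hnorm : ∫ x, ((monicOrth μ i).eval x) ^ 2 ∂μ = ((S i).leadingCoeff ^ 2)⁻¹ :=
    eq_inv_of_mul_eq_one_right (sq_leadingCoeff_mul_integral_sq h horth i)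
  rw [orthPoly, hnorm, Real.sqrt_inv, Real.sqrt_sq hlead.le, inv_inv]
  exact (eq_leadingCoeff_mul_monicOrth h horth i).symm

end Uniqueness

/-! ### Gaussian quadrature -/

/-- The weight of the node `x` in the interpolatory quadrature rule with the given nodes. -/
noncomputable def quadWeight (μ : Measure ℝ) (nodes : Finset ℝ) (x : ℝ) : ℝ :=
  ∫ y, (Lagrange.basis nodes id x).eval y ∂μ

lemma integral_interpAt (h : PolyIntegrable μ) (nodes : Finset ℝ) (f : ℝ → ℝ) :
    ∫ y, (interpAt nodes f).eval y ∂μ = ∑ x ∈ nodes, f x * quadWeight μ nodes x := by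
  rw [← polyInt_apply h, interpAt, Lagrange.interpolate_apply, map_sum]
  exact Finset.sum_congr rfl fun x _ => polyInt_C_mul h _ _

lemma interpAt_eval_eq_self {nodes : Finset ℝ} {p : ℝ[X]} (hp : p.degree < nodes.card) :
    interpAt nodes (fun x => p.eval x) = p :=
  (Lagrange.eq_interpolate (v := id) Function.injective_id.injOn hp).symm

lemma OrthNondeg.interpAt_eval_eq_modByMonic (h : PolyIntegrable μ) {m : ℕ} (hm : OrthNondeg μ m)
    (p : ℝ[X]) : interpAt (orthNodes μ m) (fun x => p.eval x) = p %ₘ monicOrth μ m := by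
  have hdeg : (p %ₘ monicOrth μ m).degree < (orthNodes μ m).card := by
    rw [hm.card_orthNodes h, ← degree_monicOrth μ m]
    exact degree_modByMonic_lt _ (monicOrth_monic μ m)
  rw [← interpAt_eval_eq_self hdeg]
  refine Lagrange.interpolate_eq_of_values_eq_on _ _ fun x hx => ?_
  conv_lhs => rw [← modByMonic_add_div p (monicOrth μ m)]
  rw [eval_add, eval_mul, eval_monicOrth_of_mem_orthNodes hx, zero_mul, add_zero]

lemma degree_divByMonic_monicOrth_lt {m : ℕ} {p : ℝ[X]} (hp : p.degree < (2 * m : ℕ)) :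
    (p /ₘ monicOrth μ m).degree < m := by
  by_cases h0 : p /ₘ monicOrth μ m = 0
  · rw [h0, degree_zero]
    exact WithBot.bot_lt_coe m
  · have hp0 : p ≠ 0 := by
      rintro rfl
      exact h0 (zero_divByMonic _)
    have hpm := (natDegree_lt_iff_degree_lt hp0).2 hp
    rw [degree_eq_natDegree h0, natDegree_divByMonic _ (monicOrth_monic μ m), natDegree_monicOrth]
    exact_mod_cast by omega

lemma OrthNondeg.integral_interpAt_eval (h : PolyIntegrable μ) {m : ℕ} (hm : OrthNondeg μ m)
    {p : ℝ[X]} (hp : p.degree < (2 * m : ℕ)) :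
    ∫ y, (interpAt (orthNodes μ m) (fun x => p.eval x)).eval y ∂μ = ∫ y, p.eval y ∂μ := by
  rw [hm.interpAt_eval_eq_modByMonic h, ← polyInt_apply h, ← polyInt_apply h]
  conv_rhs => rw [← modByMonic_add_div p (monicOrth μ m)]
  rw [map_add, polyInt_monicOrth_mul h (degree_divByMonic_monicOrth_lt hp), add_zero]

lemma OrthNondeg.quadWeight_nonneg (h : PolyIntegrable μ) {m : ℕ} (hm : OrthNondeg μ m) {x : ℝ}
    (hx : x ∈ orthNodes μ m) : 0 ≤ quadWeight μ (orthNodes μ m) x := by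
  set ℓ := Lagrange.basis (orthNodes μ m) id x
  have hdeg : ℓ.degree = ((m - 1 : ℕ) : WithBot ℕ) := by
    rw [Lagrange.degree_basis Function.injective_id.injOn hx, hm.card_orthNodes h]
  have hm0 : 0 < m := hm.card_orthNodes h ▸ Finset.card_pos.2 ⟨x, hx⟩
  have hℓx : ℓ.eval x = 1 := Lagrange.eval_basis_self (v := id) Function.injective_id.injOn hx
  have hℓy : ∀ y ∈ orthNodes μ m, y ≠ x → ℓ.eval y = 0 := fun y hy hyx =>
    Lagrange.eval_basis_of_ne (v := id) hyx.symm hy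
  have hweight : quadWeight μ (orthNodes μ m) x = ∫ y, (ℓ * ℓ).eval y ∂μ := by
    rw [← hm.integral_interpAt_eval h (p := ℓ * ℓ)
      (by rw [degree_mul, hdeg]; exact_mod_cast by omega), integral_interpAt h,
      Finset.sum_eq_single_of_mem x hx fun y hy hyx => by simp [hℓy y hy hyx]]
    simp [hℓx]
  exact hweight ▸ polyInt_mul_self_nonneg h ℓ

end OrthogonalPolynomials

/-! ### The Chebyshev distribution -/

section Chebyshev

variable {a b : ℝ}

/-- The point of `[a, b]` with angle `θ`: the image of `cos θ` under the increasing affine bijection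
of `[-1, 1]` onto `[a, b]`. -/
noncomputable def chebPoint (a b θ : ℝ) : ℝ := (b - a) / 2 * Real.cos θ + (a + b) / 2

lemma exists_chebPoint_eq (hab : a < b) {x : ℝ} (hx : x ∈ Icc a b) : ∃ θ, chebPoint a b θ = x := by
  have hba : 0 < b - a := sub_pos.2 hab
  refine ⟨Real.arccos ((2 * x - a - b) / (b - a)), ?_⟩
  rw [chebPoint, Real.cos_arccos]
  · field_simp
    ring
  · rw [le_div_iff₀ hba]
    linarith [hx.1]
  · rw [div_le_iff₀ hba]
    linarith [hx.2]

lemma integral_chebMeasure (hab : a < b) (f : ℝ → ℝ) :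
    ∫ x, f x ∂chebMeasure a b = π⁻¹ * ∫ θ in (0 : ℝ)..π, f (chebPoint a b θ) := by
  have hba : 0 < b - a := sub_pos.2 hab
  rw [chebMeasure, integral_withDensity_eq_integral_toReal_smul (by fun_prop)
    (Eventually.of_forall fun x => ENNReal.ofReal_lt_top)]
  have hnn : ∀ t, 0 ≤ 2 / (π * (b - a)) *
      (1 / √(1 - (2 / (b - a) * t - (b + a) / (b - a)) ^ 2)) := fun t => by positivity
  simp_rw [ENNReal.toReal_ofReal (hnn _), smul_eq_mul]
  rw [← integral_Ioc_eq_integral_Ioo, ← intervalIntegral.integral_of_le hab.le]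
  set G : ℝ → ℝ := fun x => 2 / (π * (b - a)) * (1 / √(1 - x ^ 2)) *
    f ((b - a) / 2 * x + (a + b) / 2) with hG
  have hsubst : ∀ t, 2 / (π * (b - a)) *
      (1 / √(1 - (2 / (b - a) * t - (b + a) / (b - a)) ^ 2)) * f t =
      G (2 / (b - a) * t - (b + a) / (b - a)) := by
    intro t
    have : (b - a) / 2 * (2 / (b - a) * t - (b + a) / (b - a)) + (a + b) / 2 = t := by
      field_simp
      ring
    simp only [hG, this]
  have hleft : 2 / (b - a) * a - (b + a) / (b - a) = -1 := by field_simp; ring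
  have hright : 2 / (b - a) * b - (b + a) / (b - a) = 1 := by field_simp; ring
  simp_rw [hsubst, chebPoint]
  rw [intervalIntegral.integral_comp_mul_sub G (by positivity), hleft, hright,
    ← Chebyshev.integral_measureT_eq_integral_cos
      (f := fun x => f ((b - a) / 2 * x + (a + b) / 2)), Chebyshev.integral_measureT, smul_eq_mul,
    ← intervalIntegral.integral_const_mul, ← intervalIntegral.integral_const_mul]
  refine intervalIntegral.integral_congr fun x _ => ?_
  simp only [hG, Real.sqrt_inv]
  field_simp

lemma chebMeasure_compl_Icc (a b : ℝ) : chebMeasure a b (Icc a b)ᶜ = 0 := by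
  refine withDensity_absolutelyContinuous _ _ ?_
  rw [Measure.restrict_apply measurableSet_Icc.compl,
    (disjoint_compl_left_iff_subset.2 Ioo_subset_Icc_self).inter_eq, measure_empty]

lemma isProbabilityMeasure_chebMeasure (hab : a < b) : IsProbabilityMeasure (chebMeasure a b) := by
  have h := integral_chebMeasure hab fun _ => 1
  rw [integral_const, intervalIntegral.integral_const, smul_eq_mul, smul_eq_mul, mul_one, mul_one,
    sub_zero, inv_mul_cancel₀ Real.pi_ne_zero, Measure.real, ENNReal.toReal_eq_one_iff] at h
  exact ⟨h⟩

lemma polyIntegrable_chebMeasure (hab : a < b) : PolyIntegrable (chebMeasure a b) :=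
  have := isProbabilityMeasure_chebMeasure hab
  polyIntegrable_of_compl_Icc (chebMeasure_compl_Icc a b)

/-- The Chebyshev polynomials of the first kind, transplanted from `[-1, 1]` to `[a, b]`. -/
noncomputable def chebPoly (a b : ℝ) (i : ℕ) : ℝ[X] :=
  (Chebyshev.T ℝ i).comp (C (2 / (b - a)) * X + C (-((b + a) / (b - a))))

/-- The transplanted Chebyshev polynomials, normalized in `L²` of the Chebyshev distribution. -/
noncomputable def chebOrth (a b : ℝ) (i : ℕ) : ℝ[X] :=
  C (if i = 0 then 1 else √2) * chebPoly a b i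

lemma eval_chebPoly_chebPoint (hab : a < b) (i : ℕ) (θ : ℝ) :
    (chebPoly a b i).eval (chebPoint a b θ) = Real.cos (i * θ) := by
  have hba : b - a ≠ 0 := (sub_pos.2 hab).ne'
  have : 2 / (b - a) * ((b - a) / 2 * Real.cos θ + (a + b) / 2) + -((b + a) / (b - a)) =
      Real.cos θ := by
    field_simp
    ring
  rw [chebPoly, chebPoint, eval_comp, eval_add, eval_mul, eval_C, eval_C, eval_X, this,
    Chebyshev.T_real_cos, Int.cast_natCast]

lemma eval_chebPoly_one (hab : a < b) (y : ℝ) :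
    (chebPoly a b 1).eval y = (2 * y - a - b) / (b - a) := by
  have hba : b - a ≠ 0 := (sub_pos.2 hab).ne'
  simp only [chebPoly, Nat.cast_one, Chebyshev.T_one, X_comp, eval_add, eval_mul, eval_C, eval_X]
  field_simp
  ring

lemma chebPoly_two (a b : ℝ) :
    chebPoly a b 2 = C 2 * (chebPoly a b 1 * chebPoly a b 1) - 1 := by
  have : Chebyshev.T ℝ ((2 : ℕ) : ℤ) = C 2 * (X * X) - 1 := by
    rw [Nat.cast_ofNat, Chebyshev.T_two, sq, map_ofNat]
  rw [chebPoly, this, chebPoly]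
  simp

lemma chebOrth_zero (a b : ℝ) : chebOrth a b 0 = 1 := by simp [chebOrth, chebPoly]

lemma natDegree_chebPoly (hab : a < b) (i : ℕ) : (chebPoly a b i).natDegree = i := by
  have hba : 0 < 2 / (b - a) := div_pos two_pos (sub_pos.2 hab)
  rw [chebPoly, natDegree_comp, natDegree_linear hba.ne', Chebyshev.natDegree_T, mul_one,
    Int.natAbs_natCast]

lemma leadingCoeff_chebPoly_pos (hab : a < b) (i : ℕ) : 0 < (chebPoly a b i).leadingCoeff := by
  have hba : 0 < 2 / (b - a) := div_pos two_pos (sub_pos.2 hab)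
  rw [chebPoly, leadingCoeff_comp (by rw [natDegree_linear hba.ne']; exact one_ne_zero),
    leadingCoeff_linear hba.ne', Chebyshev.leadingCoeff_T]
  positivity

lemma leadingCoeff_chebOrth_pos (hab : a < b) (i : ℕ) : 0 < (chebOrth a b i).leadingCoeff := by
  rw [chebOrth, leadingCoeff_mul, leadingCoeff_C]
  refine mul_pos ?_ (leadingCoeff_chebPoly_pos hab i)
  split_ifs <;> simp

lemma degree_chebOrth (hab : a < b) (i : ℕ) : (chebOrth a b i).degree = i := by
  rw [degree_eq_natDegree (leadingCoeff_ne_zero.1 (leadingCoeff_chebOrth_pos hab i).ne'), chebOrth,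
    natDegree_C_mul (by split_ifs <;> simp), natDegree_chebPoly hab]

lemma integral_chebPoly_mul (hab : a < b) (i j : ℕ) :
    ∫ x, (chebPoly a b i * chebPoly a b j).eval x ∂chebMeasure a b =
      if i = j then (if i = 0 then 1 else 1 / 2) else 0 := by
  have hT : ∀ θ : ℝ, Real.cos (i * θ) * Real.cos (j * θ) =
      (fun x => (Chebyshev.T ℝ i).eval x * (Chebyshev.T ℝ j).eval x) (Real.cos θ) := by
    intro θ
    simp [Chebyshev.T_real_cos]
  rw [integral_chebMeasure hab]
  simp_rw [eval_mul, eval_chebPoly_chebPoint hab, hT]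
  rw [← Chebyshev.integral_measureT_eq_integral_cos
    (f := fun x => (Chebyshev.T ℝ i).eval x * (Chebyshev.T ℝ j).eval x)]
  split_ifs with hij h0
  · subst hij h0
    have hmass := Chebyshev.integral_eval_T_real_mul_self_measureT_zero
    simp only [Nat.cast_zero]
    rw [hmass]
    field_simp
  · subst hij
    rw [Chebyshev.integral_T_real_mul_self_measureT_of_ne_zero h0]
    field_simp
  · rw [Chebyshev.integral_eval_T_real_mul_eval_T_real_measureT_of_ne hij, mul_zero]

lemma polyInt_chebOrth_mul (hab : a < b) (i j : ℕ) :
    polyInt (polyIntegrable_chebMeasure hab) (chebOrth a b i * chebOrth a b j) =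
      if i = j then 1 else 0 := by
  rw [chebOrth, chebOrth, mul_mul_mul_comm, ← C_mul, polyInt_C_mul, polyInt_apply,
    integral_chebPoly_mul hab]
  by_cases hij : i = j
  · subst hij
    by_cases h0 : i = 0 <;> simp [h0]
  · simp [hij]

/-- The sequence of the `chebOrth a b i`, bundled with their degrees. -/
noncomputable def chebOrthSequence (hab : a < b) : Polynomial.Sequence ℝ where
  elems' := chebOrth a b
  degree_eq' := degree_chebOrth hab

lemma orthPoly_chebMeasure (hab : a < b) (i : ℕ) :
    orthPoly (chebMeasure a b) i = chebOrth a b i :=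
  orthPoly_eq_of_orthonormal (S := chebOrthSequence hab) (polyIntegrable_chebMeasure hab)
    (polyInt_chebOrth_mul hab) (leadingCoeff_chebOrth_pos hab i)

lemma orthNondeg_chebMeasure (hab : a < b) (m : ℕ) : OrthNondeg (chebMeasure a b) m :=
  orthNondeg_of_orthonormal (S := chebOrthSequence hab) (polyIntegrable_chebMeasure hab)
    (polyInt_chebOrth_mul hab) m

end Chebyshev

/-! ### Jackson's kernel -/

lemma sum_mul_autocorrelation_succ {R : Type*} [CommSemiring R] (g c : ℕ → R) (m : ℕ) :
    ∑ i ∈ Finset.range (m + 1), g (i + 1) *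
        ∑ j ∈ Finset.range (m + 1 - (i + 1)), c j * c (j + (i + 1)) =
      (∑ i ∈ Finset.range m, g (i + 1) *
        ∑ j ∈ Finset.range (m - (i + 1)), c j * c (j + (i + 1))) +
      ∑ i ∈ Finset.range m, g (m - i) * (c i * c m) := by
  rw [Finset.sum_range_succ, Nat.sub_self, Finset.range_zero, Finset.sum_empty, mul_zero, add_zero,
    ← Finset.sum_range_reflect (fun i => g (m - i) * (c i * c m)), ← Finset.sum_add_distrib]
  refine Finset.sum_congr rfl fun i hi => ?_
  have hi := Finset.mem_range.1 hi
  rw [show m + 1 - (i + 1) = m - (i + 1) + 1 by omega, Finset.sum_range_succ,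
    show m - 1 - i = m - (i + 1) by omega, show m - (i + 1) + (i + 1) = m by omega,
    show m - (m - (i + 1)) = i + 1 by omega, mul_add]

lemma sum_cos_sub_mul (c : ℕ → ℝ) (θ : ℝ) (m : ℕ) :
    ∑ i ∈ Finset.range m, Real.cos ((m - i : ℕ) * θ) * c i =
      Real.cos (m * θ) * (∑ j ∈ Finset.range m, c j * Real.cos (j * θ)) +
        Real.sin (m * θ) * (∑ j ∈ Finset.range m, c j * Real.sin (j * θ)) := by
  rw [Finset.mul_sum, Finset.mul_sum, ← Finset.sum_add_distrib]
  refine Finset.sum_congr rfl fun i hi => ?_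
  rw [Nat.cast_sub (Finset.mem_range.1 hi).le, sub_mul, Real.cos_sub]
  ring

lemma sq_add_sq_eq_autocorrelation (c : ℕ → ℝ) (θ : ℝ) (m : ℕ) :
    (∑ j ∈ Finset.range m, c j * Real.cos (j * θ)) ^ 2 +
      (∑ j ∈ Finset.range m, c j * Real.sin (j * θ)) ^ 2 =
    (∑ j ∈ Finset.range m, c j * c j) +
      2 * ∑ i ∈ Finset.range m, Real.cos ((i + 1 : ℕ) * θ) *
        ∑ j ∈ Finset.range (m - (i + 1)), c j * c (j + (i + 1)) := by
  induction m with
  | zero => simp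
  | succ m ih =>
    rw [sum_mul_autocorrelation_succ (fun i => Real.cos (i * θ))]
    simp_rw [← mul_assoc, ← Finset.sum_mul]
    rw [sum_cos_sub_mul, Finset.sum_range_succ, Finset.sum_range_succ, Finset.sum_range_succ]
    linear_combination ih + c m ^ 2 * Real.sin_sq_add_cos_sq (m * θ)

lemma sum_sin_mul_sin (α : ℝ) (i n : ℕ) :
    2 * Real.sin α * ∑ j ∈ Finset.range n,
      Real.sin ((j + 1 : ℕ) * α) * Real.sin ((j + i + 1 : ℕ) * α) =
    n * Real.cos (i * α) * Real.sin α - Real.sin (n * α) * Real.cos ((n + 1 + i) * α) := by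
  induction n with
  | zero => simp
  | succ n ih =>
    rw [Finset.sum_range_succ, mul_add, ih]
    push_cast
    set x := n * α
    set z := (n + 1 + i) * α with hz
    have hx : (n + 1) * α = x + α := by ring
    have hz' : (n + i + 1) * α = z := by rw [hz]; ring
    have hzα : (n + 1 + 1 + i) * α = z + α := by rw [hz]; ring
    have hi : i * α = z - (x + α) := by rw [hz]; ring
    rw [hx, hz', hzα, hi, Real.cos_sub, Real.cos_add z, Real.sin_add x, Real.cos_add x]
    linear_combination (Real.sin x * Real.cos z) * Real.sin_sq_add_cos_sq α

section Jackson

variable (s : ℕ)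

lemma sin_pi_div_add_two_pos : 0 < Real.sin (π / (s + 2)) := by
  have hpi := Real.pi_pos
  refine Real.sin_pos_of_pos_of_lt_pi (by positivity) (div_lt_self hpi ?_)
  linarith [(Nat.cast_nonneg s : (0 : ℝ) ≤ s)]

/-- Jackson's coefficients are the normalized autocorrelations of a discrete sine, which makes the
kernel below a squared modulus. -/
lemma sum_sin_mul_sin_eq_jackson {i : ℕ} (hi : i ≤ s) :
    ∑ j ∈ Finset.range (s + 1 - i), Real.sin ((j + 1 : ℕ) * (π / (s + 2))) *
      Real.sin ((j + i + 1 : ℕ) * (π / (s + 2))) = (s + 2) / 2 * jackson s i := by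
  set α := π / ((s : ℝ) + 2) with hα
  have hsin : Real.sin α ≠ 0 := (sin_pi_div_add_two_pos s).ne'
  have h := sum_sin_mul_sin α i (s + 1 - i)
  have hcast : ((s + 1 - i : ℕ) : ℝ) = (s : ℝ) + 1 - i := by
    rw [Nat.cast_sub (by omega)]
    push_cast
    ring
  have hpi : ((s : ℝ) + 1 - i + 1 + i) * α = π := by rw [hα]; field_simp; ring
  have hsub : ((s : ℝ) + 1 - i) * α = π - (i * α + α) := by rw [← hpi]; ring
  rw [hcast, hpi, hsub, Real.cos_pi, Real.sin_pi_sub, Real.sin_add] at h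
  rw [jackson, show (i : ℝ) * π / (s + 2) = i * α by rw [hα]; ring, ← hα, Real.cot_eq_cos_div_sin]
  refine mul_left_cancel₀ (mul_ne_zero two_ne_zero hsin) (h.trans ?_)
  field_simp
  ring

/-- The trigonometric kernel with Jackson's coefficients. -/
noncomputable def jacksonKernel (θ : ℝ) : ℝ :=
  jackson s 0 + 2 * ∑ i ∈ Finset.range s, jackson s (i + 1) * Real.cos ((i + 1 : ℕ) * θ)

lemma jacksonKernel_eq_sq_add_sq (θ : ℝ) :
    jacksonKernel s θ = 2 / (s + 2) *
      ((∑ j ∈ Finset.range (s + 1), Real.sin ((j + 1 : ℕ) * (π / (s + 2))) *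
          Real.cos (j * θ)) ^ 2 +
        (∑ j ∈ Finset.range (s + 1), Real.sin ((j + 1 : ℕ) * (π / (s + 2))) *
          Real.sin (j * θ)) ^ 2) := by
  have hcorr : ∑ i ∈ Finset.range (s + 1), Real.cos ((i + 1 : ℕ) * θ) *
      ∑ j ∈ Finset.range (s + 1 - (i + 1)), Real.sin ((j + 1 : ℕ) * (π / (s + 2))) *
        Real.sin ((j + (i + 1) + 1 : ℕ) * (π / (s + 2))) =
      (s + 2) / 2 * ∑ i ∈ Finset.range s, jackson s (i + 1) * Real.cos ((i + 1 : ℕ) * θ) := by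
    rw [Finset.sum_range_succ, Nat.sub_self, Finset.range_zero, Finset.sum_empty, mul_zero,
      add_zero, Finset.mul_sum]
    refine Finset.sum_congr rfl fun i hi => ?_
    rw [← mul_assoc, ← sum_sin_mul_sin_eq_jackson s (Finset.mem_range.1 hi), mul_comm]
  have hzero := sum_sin_mul_sin_eq_jackson s (Nat.zero_le s)
  simp only [tsub_zero, add_zero] at hzero
  rw [sq_add_sq_eq_autocorrelation (fun j => Real.sin ((j + 1 : ℕ) * (π / (s + 2)))), hcorr,
    hzero, jacksonKernel]
  simp only [mul_comm _ θ]
  field_simp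

lemma jacksonKernel_nonneg (θ : ℝ) : 0 ≤ jacksonKernel s θ := by
  rw [jacksonKernel_eq_sq_add_sq]
  positivity

lemma jackson_zero : jackson s 0 = 1 := by
  simp only [jackson, Nat.cast_zero, zero_mul, zero_div, Real.cos_zero, Real.sin_zero]
  field_simp
  ring

lemma jackson_one : jackson s 1 = Real.cos (π / (s + 2)) := by
  have hsin := sin_pi_div_add_two_pos s
  rw [jackson, Nat.cast_one, one_mul, Real.cot_eq_cos_div_sin, mul_div_cancel₀ _ hsin.ne']
  field_simp
  ring

lemma jackson_two : jackson s 2 =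
    2 * Real.cos (π / (s + 2)) ^ 2 - 1 + 2 * Real.sin (π / (s + 2)) ^ 2 / (s + 2) := by
  have hsin := sin_pi_div_add_two_pos s
  rw [jackson, Nat.cast_ofNat, mul_div_assoc, Real.cot_eq_cos_div_sin, Real.cos_two_mul,
    Real.sin_two_mul, Real.sin_sq]
  field_simp
  ring

lemma jackson_zero_two : jackson 0 2 = 0 := by
  rw [jackson_two]
  simp

lemma jackson_succ_self : jackson s (s + 1) = 0 := by
  have hsin := sin_pi_div_add_two_pos s
  have hangle : ((s + 1 : ℕ) : ℝ) * π / (s + 2) = π - π / (s + 2) := by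
    push_cast
    field_simp
    ring
  rw [jackson, hangle, Real.cos_pi_sub, Real.sin_pi_sub, Real.cot_eq_cos_div_sin,
    mul_div_cancel₀ _ hsin.ne']
  push_cast
  field_simp
  ring

lemma le_jackson_two : 2 * jackson s 1 ^ 2 - 1 ≤ jackson s 2 := by
  rw [jackson_one, jackson_two]
  exact le_add_of_nonneg_right (by positivity)

lemma jackson_two_le_one : jackson s 2 ≤ 1 := by
  have hsin : 2 * Real.sin (π / (s + 2)) ^ 2 / (s + 2) ≤ 2 * Real.sin (π / (s + 2)) ^ 2 / 2 :=
    div_le_div_of_nonneg_left (by positivity) two_pos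
      (le_add_of_nonneg_left (Nat.cast_nonneg s))
  rw [jackson_two]
  nlinarith [Real.sin_sq_add_cos_sq (π / (s + 2)), sq_nonneg (Real.sin (π / (s + 2)))]

/-- The left side is the second moment `∫ (u - y)² P_u(y) dy` of Jackson's kernel on `[-1, 1]`. -/
lemma jackson_moment_le {u : ℝ} (hu : u ^ 2 ≤ 1) :
    u ^ 2 - 2 * u * (jackson s 1 * u) + (1 + jackson s 2 * (2 * u ^ 2 - 1)) / 2 ≤
      (π / (s + 2)) ^ 2 := by
  have hcos : 2 * (1 - jackson s 1) ≤ (π / (s + 2)) ^ 2 := by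
    rw [jackson_one]
    linarith [Real.one_sub_sq_div_two_le_cos (x := π / (s + 2))]
  refine le_trans ?_ hcos
  nlinarith [mul_nonneg (sub_nonneg.2 hu) (sq_nonneg (1 - jackson s 1)),
    mul_nonneg (sub_nonneg.2 hu) (sub_nonneg.2 (le_jackson_two s)),
    mul_nonneg (sq_nonneg u) (sub_nonneg.2 (jackson_two_le_one s))]

end Jackson

/-! ### Jackson's theorem -/

section JacksonTheorem

variable {a b : ℝ}

/-- The positive kernel `y ↦ P_x(y) = ∑_{i ≤ s} ρ_i p_i(x) p_i(y)` of Jackson-damped Chebyshev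
expansions. -/
noncomputable def jacksonPoly (a b : ℝ) (s : ℕ) (x : ℝ) : ℝ[X] :=
  ∑ i ∈ Finset.range (s + 1), C (jackson s i * (chebOrth a b i).eval x) * chebOrth a b i

lemma jacksonPoly_zero (a b x : ℝ) : jacksonPoly a b 0 x = 1 := by
  simp [jacksonPoly, jackson_zero, chebOrth_zero]

lemma eval_jacksonPoly_chebPoint (hab : a < b) (s : ℕ) (θ φ : ℝ) :
    (jacksonPoly a b s (chebPoint a b θ)).eval (chebPoint a b φ) =
      (jacksonKernel s (θ - φ) + jacksonKernel s (θ + φ)) / 2 := by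
  have hterm : ∀ i ∈ Finset.range s, (C (jackson s (i + 1) *
        (chebOrth a b (i + 1)).eval (chebPoint a b θ)) * chebOrth a b (i + 1)).eval
        (chebPoint a b φ) =
      jackson s (i + 1) * Real.cos ((i + 1 : ℕ) * (θ - φ)) +
        jackson s (i + 1) * Real.cos ((i + 1 : ℕ) * (θ + φ)) := by
    intro i _
    rw [chebOrth, if_neg (Nat.succ_ne_zero i)]
    simp only [eval_mul, eval_C, eval_chebPoly_chebPoint hab]
    rw [mul_sub, mul_add, Real.cos_sub, Real.cos_add]
    linear_combination jackson s (i + 1) * Real.cos ((i + 1 : ℕ) * θ) *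
      Real.cos ((i + 1 : ℕ) * φ) * Real.mul_self_sqrt (zero_le_two (α := ℝ))
  rw [jacksonPoly, eval_finsetSum, Finset.sum_range_succ', jacksonKernel, jacksonKernel,
    Finset.sum_congr rfl hterm, Finset.sum_add_distrib, chebOrth_zero]
  simp only [eval_mul, eval_C, eval_one]
  ring

lemma eval_jacksonPoly_nonneg (hab : a < b) (s : ℕ) {x y : ℝ} (hx : x ∈ Icc a b)
    (hy : y ∈ Icc a b) : 0 ≤ (jacksonPoly a b s x).eval y := by
  obtain ⟨θ, rfl⟩ := exists_chebPoint_eq hab hx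
  obtain ⟨φ, rfl⟩ := exists_chebPoint_eq hab hy
  rw [eval_jacksonPoly_chebPoint hab]
  exact div_nonneg (add_nonneg (jacksonKernel_nonneg s _) (jacksonKernel_nonneg s _)) two_pos.le

lemma abs_sub_le_of_lipschitzWith {f : ℝ → ℝ} (hf : LipschitzWith 1 f) {t : ℝ} (ht : 0 < t)
    (x y : ℝ) : |f x - f y| ≤ t / 2 + 1 / (2 * t) * (x - y) ^ 2 := by
  have hlip : |f x - f y| ≤ |x - y| := by
    simpa only [Real.dist_eq, NNReal.coe_one, one_mul] using hf.dist_le_mul x y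
  have hsq : t / 2 + 1 / (2 * t) * (x - y) ^ 2 - |x - y| = (|x - y| - t) ^ 2 / (2 * t) := by
    rw [← sq_abs (x - y)]
    field_simp
    ring
  have : 0 ≤ (|x - y| - t) ^ 2 / (2 * t) := by positivity
  linarith

lemma abs_sub_integral_le_of_moment {κ : Measure ℝ} [IsFiniteMeasure κ]
    (hκ : κ (Icc a b)ᶜ = 0) {p : ℝ[X]} (hp : ∀ y ∈ Icc a b, 0 ≤ p.eval y)
    (hp1 : ∫ y, p.eval y ∂κ = 1) {x t : ℝ} (ht : 0 < t)
    (hm : ∫ y, (x - y) ^ 2 * p.eval y ∂κ ≤ t ^ 2) {f : ℝ → ℝ} (hf : LipschitzWith 1 f) :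
    |f x - ∫ y, f y * p.eval y ∂κ| ≤ t := by
  have hint : ∀ {g : ℝ → ℝ}, Continuous g → Integrable g κ := integrable_of_continuous hκ
  have hfc := hf.continuous
  have hsub : f x - ∫ y, f y * p.eval y ∂κ = ∫ y, (f x - f y) * p.eval y ∂κ := by
    simp_rw [sub_mul]
    rw [integral_sub (hint (by fun_prop)) (hint (by fun_prop)), integral_const_mul, hp1, mul_one]
  rw [hsub]
  calc |∫ y, (f x - f y) * p.eval y ∂κ|
      ≤ ∫ y, |(f x - f y) * p.eval y| ∂κ := abs_integral_le_integral_abs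
    _ ≤ ∫ y, (t / 2) * p.eval y + (1 / (2 * t)) * ((x - y) ^ 2 * p.eval y) ∂κ := by
        refine integral_mono_ae (hint (by fun_prop)) (hint (by fun_prop)) ?_
        filter_upwards [ae_mem_Icc hκ] with y hy
        rw [abs_mul, abs_of_nonneg (hp y hy), ← mul_assoc, ← add_mul]
        exact mul_le_mul_of_nonneg_right (abs_sub_le_of_lipschitzWith hf ht x y) (hp y hy)
    _ = t / 2 + 1 / (2 * t) * ∫ y, (x - y) ^ 2 * p.eval y ∂κ := by
        rw [integral_add (hint (by fun_prop)) (hint (by fun_prop)), integral_const_mul,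
          integral_const_mul, hp1, mul_one]
    _ ≤ t / 2 + 1 / (2 * t) * t ^ 2 := by gcongr
    _ = t := by field_simp; ring

lemma polyInt_chebOrth_mul_jacksonPoly {κ : Measure ℝ} (h : PolyIntegrable κ) {s j : ℕ}
    (hj : j ≤ s + 1)
    (horth : ∀ i ≤ s, polyInt h (chebOrth a b j * chebOrth a b i) = if j = i then 1 else 0)
    (x : ℝ) :
    polyInt h (chebOrth a b j * jacksonPoly a b s x) = jackson s j * (chebOrth a b j).eval x := by
  have hterm : ∀ i ∈ Finset.range (s + 1), polyInt h (chebOrth a b j *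
      (C (jackson s i * (chebOrth a b i).eval x) * chebOrth a b i)) =
      if j = i then jackson s i * (chebOrth a b i).eval x else 0 := by
    intro i hi
    rw [mul_left_comm, polyInt_C_mul, horth i (Nat.lt_succ_iff.1 (Finset.mem_range.1 hi)), mul_ite,
      mul_one, mul_zero]
  rw [jacksonPoly, Finset.mul_sum, map_sum, Finset.sum_congr rfl hterm, Finset.sum_ite_eq]
  split_ifs with hjs
  · rfl
  · obtain rfl : j = s + 1 := by
      rw [Finset.mem_range] at hjs
      omega
    rw [jackson_succ_self, zero_mul]

/-- `κ` is exact enough for Jackson's bound: it integrates the products of low-degree Chebyshev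
polynomials like the Chebyshev distribution, while in degree two a one-sided bound suffices. This
holds for the Chebyshev distribution and for its Gaussian quadrature with `s + 1` nodes. -/
structure ChebExact (a b : ℝ) (s : ℕ) {κ : Measure ℝ} (h : PolyIntegrable κ) : Prop where
  low : ∀ j ≤ 1, ∀ i ≤ s,
    polyInt h (chebOrth a b j * chebOrth a b i) = if j = i then 1 else 0
  two : ∀ x, polyInt h (chebOrth a b 2 * jacksonPoly a b s x) ≤
    jackson s 2 * (chebOrth a b 2).eval x

lemma chebExact_chebMeasure (hab : a < b) (s : ℕ) :
    ChebExact a b s (polyIntegrable_chebMeasure hab) := by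
  refine ⟨fun j _ i _ => polyInt_chebOrth_mul hab j i, fun x => ?_⟩
  have h := polyIntegrable_chebMeasure hab
  rcases Nat.eq_zero_or_pos s with rfl | hs
  · rw [jackson_zero_two, zero_mul, jacksonPoly_zero, ← chebOrth_zero a b,
      polyInt_chebOrth_mul hab, if_neg two_ne_zero]
  · exact (polyInt_chebOrth_mul_jacksonPoly h (Nat.succ_le_succ hs)
      (fun i _ => polyInt_chebOrth_mul hab 2 i) x).le

namespace ChebExact

variable {κ : Measure ℝ} {h : PolyIntegrable κ} {s : ℕ}

lemma polyInt_jacksonPoly (hex : ChebExact a b s h) (x : ℝ) :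
    polyInt h (jacksonPoly a b s x) = 1 := by
  have hzero := polyInt_chebOrth_mul_jacksonPoly h (by omega) (hex.low 0 (by omega)) x
  rwa [chebOrth_zero, one_mul, jackson_zero, eval_one, mul_one] at hzero

lemma polyInt_chebPoly_one_mul (hex : ChebExact a b s h) (x : ℝ) :
    polyInt h (chebPoly a b 1 * jacksonPoly a b s x) = jackson s 1 * (chebPoly a b 1).eval x := by
  have hone := polyInt_chebOrth_mul_jacksonPoly h (by omega) (hex.low 1 le_rfl) x
  rwa [chebOrth, if_neg one_ne_zero, mul_assoc, polyInt_C_mul, eval_mul, eval_C, mul_left_comm,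
    mul_right_inj' (Real.sqrt_ne_zero'.2 two_pos)] at hone

lemma polyInt_chebPoly_one_sq_mul_le (hex : ChebExact a b s h) (x : ℝ) :
    polyInt h (chebPoly a b 1 * chebPoly a b 1 * jacksonPoly a b s x) ≤
      (1 + jackson s 2 * (2 * (chebPoly a b 1).eval x ^ 2 - 1)) / 2 := by
  have htwo := hex.two x
  rw [chebOrth, if_neg two_ne_zero, mul_assoc, polyInt_C_mul, eval_mul, eval_C, mul_left_comm,
    mul_le_mul_iff_right₀ (Real.sqrt_pos.2 two_pos), chebPoly_two, sub_mul, map_sub,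
    mul_assoc (C 2), polyInt_C_mul, one_mul, hex.polyInt_jacksonPoly] at htwo
  simp only [eval_sub, eval_mul, eval_C, eval_one] at htwo
  rw [sq]
  linarith

lemma integral_sq_sub_mul_jacksonPoly_le (hex : ChebExact a b s h) (hab : a < b) {x : ℝ}
    (hx : x ∈ Icc a b) :
    ∫ y, (x - y) ^ 2 * (jacksonPoly a b s x).eval y ∂κ ≤ (π * (b - a) / (2 * (s + 2))) ^ 2 := by
  have hba : 0 < b - a := sub_pos.2 hab
  set P := jacksonPoly a b s x
  set τ := chebPoly a b 1
  have hexpand : ∫ y, (x - y) ^ 2 * P.eval y ∂κ = polyInt h (C (((b - a) / 2) ^ 2) *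
      (C (τ.eval x ^ 2) * P - C (2 * τ.eval x) * (τ * P) + τ * τ * P)) := by
    rw [polyInt_apply]
    congr 1
    funext y
    have hxy : x - y = (b - a) / 2 * (τ.eval x - τ.eval y) := by
      rw [eval_chebPoly_one hab, eval_chebPoly_one hab]
      field_simp
      ring
    simp only [eval_mul, eval_add, eval_sub, eval_C]
    rw [hxy]
    ring
  have hu : τ.eval x ^ 2 ≤ 1 := by
    rw [eval_chebPoly_one hab, div_pow, div_le_one (by positivity)]
    exact sq_le_sq' (by linarith [hx.1]) (by linarith [hx.2])
  rw [hexpand, polyInt_C_mul, map_add, map_sub, polyInt_C_mul, polyInt_C_mul,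
    hex.polyInt_jacksonPoly, hex.polyInt_chebPoly_one_mul, mul_one]
  calc ((b - a) / 2) ^ 2 * (τ.eval x ^ 2 - 2 * τ.eval x * (jackson s 1 * τ.eval x) +
        polyInt h (τ * τ * P))
      ≤ ((b - a) / 2) ^ 2 * (π / (s + 2)) ^ 2 := by
        refine mul_le_mul_of_nonneg_left (le_trans ?_ (jackson_moment_le s hu)) (sq_nonneg _)
        gcongr
        exact hex.polyInt_chebPoly_one_sq_mul_le x
    _ = (π * (b - a) / (2 * (s + 2))) ^ 2 := by field_simp

lemma abs_sub_integral_jacksonPoly_le [IsFiniteMeasure κ] (hex : ChebExact a b s h) (hab : a < b)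
    (hκ : κ (Icc a b)ᶜ = 0) {f : ℝ → ℝ} (hf : LipschitzWith 1 f) {x : ℝ} (hx : x ∈ Icc a b) :
    |f x - ∫ y, f y * (jacksonPoly a b s x).eval y ∂κ| ≤ π * (b - a) / (2 * (s + 2)) := by
  have hpos : 0 < π * (b - a) / (2 * (s + 2)) :=
    div_pos (mul_pos Real.pi_pos (sub_pos.2 hab)) (by positivity)
  exact abs_sub_integral_le_of_moment hκ (fun y hy => eval_jacksonPoly_nonneg hab s hx hy)
    (by rw [← polyInt_apply h, hex.polyInt_jacksonPoly]) hpos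
    (hex.integral_sq_sub_mul_jacksonPoly_le hab hx) hf

end ChebExact

/-- The operator `f ↦ ∑ i ∈ I, (∫ f e_i dκ) q_i` with values in polynomials. The quadrature rules
other than the Gaussian one are induced by operators of this form. -/
noncomputable def kernelOp {ι : Type*} (κ : Measure ℝ) (I : Finset ι) (e : ι → ℝ → ℝ)
    (q : ι → ℝ[X]) (f : ℝ → ℝ) : ℝ[X] :=
  ∑ i ∈ I, C (∫ y, f y * e i y ∂κ) * q i

/-- The Jackson-damped Chebyshev expansion whose coefficients are integrals against `κ`. -/
noncomputable def jacksonOp (a b : ℝ) (s : ℕ) (κ : Measure ℝ) : (ℝ → ℝ) → ℝ[X] :=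
  kernelOp κ (Finset.range (s + 1)) (fun i y => jackson s i * (chebOrth a b i).eval y)
    (chebOrth a b)

lemma eval_jacksonOp {κ : Measure ℝ} [IsFiniteMeasure κ] (hκ : κ (Icc a b)ᶜ = 0) (s : ℕ)
    {f : ℝ → ℝ} (hf : Continuous f) (x : ℝ) :
    (jacksonOp a b s κ f).eval x = ∫ y, f y * (jacksonPoly a b s x).eval y ∂κ := by
  simp only [jacksonOp, kernelOp, jacksonPoly, eval_finsetSum, eval_mul, eval_C, Finset.mul_sum]
  rw [integral_finsetSum]
  swap
  · exact fun i _ => integrable_of_continuous hκ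
      (hf.mul (continuous_const.mul (chebOrth a b i).continuous))
  refine Finset.sum_congr rfl fun i _ => ?_
  rw [← integral_mul_const]
  congr 1
  funext y
  ring

lemma opDampedApprox_eq_jacksonOp (hab : a < b) (s : ℕ) :
    opDampedApprox (chebMeasure a b) s = jacksonOp a b s (chebMeasure a b) := by
  funext f
  refine Finset.sum_congr rfl fun i _ => ?_
  rw [← integral_const_mul]
  simp_rw [mul_left_comm, orthPoly_chebMeasure hab]

lemma ChebExact.abs_sub_jacksonOp_le {κ : Measure ℝ} [IsFiniteMeasure κ] {h : PolyIntegrable κ}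
    {s : ℕ} (hex : ChebExact a b s h) (hab : a < b) (hκ : κ (Icc a b)ᶜ = 0) {f : ℝ → ℝ}
    (hf : LipschitzWith 1 f) {x : ℝ} (hx : x ∈ Icc a b) :
    |f x - (jacksonOp a b s κ f).eval x| ≤ π * (b - a) / (2 * (s + 2)) := by
  rw [eval_jacksonOp hκ s hf.continuous]
  exact hex.abs_sub_integral_jacksonPoly_le hab hκ hf hx

lemma ChebExact.jacksonOp_one {κ : Measure ℝ} [IsFiniteMeasure κ] {h : PolyIntegrable κ} {s : ℕ}
    (hex : ChebExact a b s h) (hκ : κ (Icc a b)ᶜ = 0) : jacksonOp a b s κ (fun _ => 1) = 1 := by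
  refine Polynomial.funext fun x => ?_
  simp_rw [eval_jacksonOp hκ s continuous_const, one_mul]
  rw [← polyInt_apply h, hex.polyInt_jacksonPoly, eval_one]

lemma degree_opDampedApprox_lt (μ : Measure ℝ) (s : ℕ) (f : ℝ → ℝ) :
    (opDampedApprox μ s f).degree < (s + 1 : ℕ) := by
  refine degree_sum_lt fun i hi => ?_
  refine ((degree_C_mul_le_degree _ _).trans (degree_orthPoly_le _ i)).trans_lt ?_
  exact_mod_cast Finset.mem_range.1 hi

lemma exists_poly_abs_sub_le (hab : a ≤ b) (s : ℕ) {f : ℝ → ℝ} (hf : LipschitzWith 1 f) :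
    ∃ p : ℝ[X], p.degree < (s + 1 : ℕ) ∧
      ∀ x ∈ Icc a b, |f x - p.eval x| ≤ π * (b - a) / (2 * (s + 2)) := by
  rcases hab.lt_or_eq with hab | rfl
  · have := isProbabilityMeasure_chebMeasure hab
    refine ⟨opDampedApprox (chebMeasure a b) s f, degree_opDampedApprox_lt _ s f, fun x hx => ?_⟩
    rw [opDampedApprox_eq_jacksonOp hab]
    exact (chebExact_chebMeasure hab s).abs_sub_jacksonOp_le hab (chebMeasure_compl_Icc a b) hf hx
  · refine ⟨C (f a), degree_C_le.trans_lt (by exact_mod_cast Nat.succ_pos s), fun x hx => ?_⟩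
    rw [Icc_self, mem_singleton_iff] at hx
    simp [hx]

end JacksonTheorem

/-! ### Gaussian quadrature as an atomic measure -/

section Gauss

variable {ι : Type*} {I : Finset ι} {c x : ι → ℝ} {a b : ℝ} {ν : Measure ℝ} {k : ℕ}

/-- The measure `∑ i ∈ I, c_i δ_{x_i}`; negative weights are truncated to `0`. -/
noncomputable def atomicMeasure (I : Finset ι) (c x : ι → ℝ) : Measure ℝ :=
  ∑ i ∈ I, ENNReal.ofReal (c i) • Measure.dirac (x i)

lemma integrable_atomicMeasure (f : ℝ → ℝ) : Integrable f (atomicMeasure I c x) := by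
  rw [atomicMeasure, integrable_finsetSum_measure]
  exact fun i _ => (integrable_dirac (by simp)).smul_measure ENNReal.ofReal_ne_top

instance : IsFiniteMeasure (atomicMeasure I c x) :=
  (integrable_const_iff_isFiniteMeasure one_ne_zero).1 (integrable_atomicMeasure fun _ => 1)

lemma integral_atomicMeasure (hc : ∀ i ∈ I, 0 ≤ c i) (f : ℝ → ℝ) :
    ∫ y, f y ∂atomicMeasure I c x = ∑ i ∈ I, f (x i) * c i := by
  rw [atomicMeasure, integral_finsetSum_measure fun i _ =>
    (integrable_dirac (by simp)).smul_measure ENNReal.ofReal_ne_top]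
  refine Finset.sum_congr rfl fun i hi => ?_
  rw [integral_smul_measure, integral_dirac, ENNReal.toReal_ofReal (hc i hi), smul_eq_mul, mul_comm]

lemma atomicMeasure_compl_Icc (hx : ∀ i ∈ I, x i ∈ Icc a b) :
    atomicMeasure I c x (Icc a b)ᶜ = 0 := by
  rw [atomicMeasure, Measure.finsetSum_apply]
  refine Finset.sum_eq_zero fun i hi => ?_
  rw [Measure.smul_apply, Measure.dirac_apply' _ measurableSet_Icc.compl,
    indicator_of_notMem (not_not.2 (hx i hi)), smul_zero]

lemma orthNondeg_gaussCount (ν : Measure ℝ) (k : ℕ) : OrthNondeg ν (gaussCount ν k) := by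
  classical
  have := Nat.findGreatest_spec (P := OrthNondeg ν) (Nat.zero_le k)
    fun i hi => absurd hi (Nat.not_lt_zero i)
  unfold gaussCount
  convert this
  exact Iff.rfl

lemma gaussCount_le (ν : Measure ℝ) (k : ℕ) : gaussCount ν k ≤ k :=
  Nat.findGreatest_le k

lemma OrthNondeg.le_gaussCount {j : ℕ} (hj : OrthNondeg ν j) (hjk : j ≤ k) : j ≤ gaussCount ν k :=
  Nat.le_findGreatest hjk hj

lemma OrthNondeg.gaussNodes_eq (hk : OrthNondeg ν k) : gaussNodes ν k = orthNodes ν k := by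
  rw [gaussNodes, le_antisymm (gaussCount_le ν k) (hk.le_gaussCount le_rfl)]

/-- Below `k` nodes the rule is terminated by `p_N = 0` almost everywhere, so `ν` lives on the nodes
and interpolation does not change integrands. -/
lemma integral_interpAt_gaussNodes_of_lt (h : PolyIntegrable ν) (hlt : gaussCount ν k < k)
    (f : ℝ → ℝ) : ∫ y, (interpAt (gaussNodes ν k) f).eval y ∂ν = ∫ y, f y ∂ν := by
  set N := gaussCount ν k
  have hzero : polyInt h (monicOrth ν N * monicOrth ν N) = 0 := by
    by_contra hne
    have hsucc : OrthNondeg ν (N + 1) := fun i hi => by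
      rcases Nat.lt_succ_iff_lt_or_eq.1 hi with hi | rfl
      · exact orthNondeg_gaussCount ν k i hi
      · rwa [← polyInt_mul_self h]
    exact absurd (hsucc.le_gaussCount hlt) (by omega)
  refine integral_congr_ae ?_
  filter_upwards [ae_eval_eq_zero_of_polyInt_mul_self h hzero] with y hy
  have hmem : y ∈ gaussNodes ν k := by
    rw [gaussNodes, orthNodes, Multiset.mem_toFinset, mem_roots (monicOrth_monic _ _).ne_zero]
    exact hy
  exact Lagrange.eval_interpolate_at_node (v := id) _ Function.injective_id.injOn hmem

lemma integral_interpAt_gaussNodes (h : PolyIntegrable ν) {p : ℝ[X]} (hp : p.degree < (2 * k : ℕ)) :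
    ∫ y, (interpAt (gaussNodes ν k) (fun x => p.eval x)).eval y ∂ν = ∫ y, p.eval y ∂ν := by
  rcases (gaussCount_le ν k).lt_or_eq with hlt | heq
  · exact integral_interpAt_gaussNodes_of_lt h hlt _
  · have hk : OrthNondeg ν k := heq ▸ orthNondeg_gaussCount ν k
    rw [hk.gaussNodes_eq]
    exact hk.integral_interpAt_eval h hp

/-- The Gaussian quadrature rule of `ν`, as a measure. -/
noncomputable def gaussMeasure (ν : Measure ℝ) (k : ℕ) : Measure ℝ :=
  atomicMeasure (gaussNodes ν k) (quadWeight ν (gaussNodes ν k)) id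

instance : IsFiniteMeasure (gaussMeasure ν k) :=
  inferInstanceAs (IsFiniteMeasure (atomicMeasure _ _ _))

lemma integral_gaussMeasure (h : PolyIntegrable ν) (k : ℕ) (f : ℝ → ℝ) :
    ∫ y, f y ∂gaussMeasure ν k = gaussIntegral ν k f := by
  have hweight : ∀ x ∈ gaussNodes ν k, 0 ≤ quadWeight ν (gaussNodes ν k) x := fun x hx =>
    (orthNondeg_gaussCount ν k).quadWeight_nonneg h hx
  rw [gaussMeasure, integral_atomicMeasure hweight, gaussIntegral, integral_interpAt h]
  rfl

lemma integral_eval_gaussMeasure (h : PolyIntegrable ν) {p : ℝ[X]} (hp : p.degree < (2 * k : ℕ)) :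
    ∫ y, p.eval y ∂gaussMeasure ν k = ∫ y, p.eval y ∂ν :=
  (integral_gaussMeasure h k _).trans (integral_interpAt_gaussNodes h hp)

lemma isProbabilityMeasure_gaussMeasure [IsProbabilityMeasure ν] (h : PolyIntegrable ν)
    (hk : 1 ≤ k) : IsProbabilityMeasure (gaussMeasure ν k) := by
  have hone := integral_eval_gaussMeasure (k := k) h (p := 1)
    (degree_one_le.trans_lt (by exact_mod_cast (by omega : 0 < 2 * k)))
  simpa [isProbabilityMeasure_iff_real] using hone

lemma gaussNodes_subset_Icc (h : PolyIntegrable ν) (hν : ν (Icc a b)ᶜ = 0) (k : ℕ) :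
    ↑(gaussNodes ν k) ⊆ Icc a b :=
  (orthNondeg_gaussCount ν k).orthNodes_subset_Icc h hν

lemma gaussMeasure_compl_Icc (h : PolyIntegrable ν) (hν : ν (Icc a b)ᶜ = 0) (k : ℕ) :
    gaussMeasure ν k (Icc a b)ᶜ = 0 :=
  atomicMeasure_compl_Icc fun _ hx => gaussNodes_subset_Icc h hν k hx

lemma polyInt_gaussMeasure_chebOrth_mul (hab : a < b)
    (h : PolyIntegrable (gaussMeasure (chebMeasure a b) k)) {i j : ℕ} (hij : i + j < 2 * k) :
    polyInt h (chebOrth a b i * chebOrth a b j) = if i = j then 1 else 0 := by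
  rw [← polyInt_chebOrth_mul hab i j, polyInt_apply, polyInt_apply]
  refine integral_eval_gaussMeasure (polyIntegrable_chebMeasure hab) ?_
  rw [degree_mul, degree_chebOrth hab, degree_chebOrth hab]
  exact_mod_cast hij

lemma polyInt_gaussMeasure_chebPoly_sq (hab : a < b)
    (h : PolyIntegrable (gaussMeasure (chebMeasure a b) k)) (hk : k ≠ 0) :
    polyInt h (chebPoly a b k * chebPoly a b k) = 0 := by
  have hT := polyIntegrable_chebMeasure hab
  rw [polyInt_apply, integral_gaussMeasure hT, gaussIntegral, integral_interpAt hT]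
  refine Finset.sum_eq_zero fun y hy => ?_
  rw [(orthNondeg_chebMeasure hab k).gaussNodes_eq] at hy
  have hroot : (chebOrth a b k).eval y = 0 := by
    rw [← orthPoly_chebMeasure hab, orthPoly, eval_mul, eval_monicOrth_of_mem_orthNodes hy,
      mul_zero]
  rw [chebOrth, if_neg hk, eval_mul, eval_C] at hroot
  rw [eval_mul, (mul_eq_zero.1 hroot).resolve_left (by positivity), zero_mul, zero_mul]

lemma chebExact_gaussMeasure (hab : a < b) (s : ℕ)
    (h : PolyIntegrable (gaussMeasure (chebMeasure a b) (s + 1))) : ChebExact a b s h := by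
  have horth : ∀ {i j}, i + j < 2 * (s + 1) →
      polyInt h (chebOrth a b i * chebOrth a b j) = if i = j then 1 else 0 :=
    polyInt_gaussMeasure_chebOrth_mul hab h
  refine ⟨fun j hj i hi => horth (by omega), fun x => ?_⟩
  rcases Nat.eq_zero_or_pos s with rfl | hs
  · have hone := horth (i := 0) (j := 0) two_pos
    rw [chebOrth_zero, if_pos rfl, mul_one] at hone
    rw [jackson_zero_two, zero_mul, jacksonPoly_zero, mul_one, chebOrth, if_neg two_ne_zero,
      polyInt_C_mul, chebPoly_two, map_sub, polyInt_C_mul, hone,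
      polyInt_gaussMeasure_chebPoly_sq hab h one_ne_zero]
    linarith [Real.sqrt_nonneg 2]
  · exact (polyInt_chebOrth_mul_jacksonPoly h (Nat.succ_le_succ hs)
      (fun i hi => horth (by omega)) x).le

lemma opDampedInterp_eq_jacksonOp (hab : a < b) (s : ℕ) :
    opDampedInterp (chebMeasure a b) s =
      jacksonOp a b s (gaussMeasure (chebMeasure a b) (s + 1)) := by
  funext f
  refine Finset.sum_congr rfl fun i _ => ?_
  rw [← integral_gaussMeasure (polyIntegrable_chebMeasure hab), ← integral_const_mul]
  simp_rw [mul_left_comm, orthPoly_chebMeasure hab]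

end Gauss

/-! ### Quadrature induced by a kernel operator -/

section Kernel

variable {ι : Type*} {I : Finset ι} {e : ι → ℝ → ℝ} {q : ι → ℝ[X]} {κ ν : Measure ℝ} {a b M : ℝ}
  {s : ℕ}

/-- The density with respect to `κ` of the quadrature approximation of `ν` that `kernelOp κ I e q`
induces. -/
noncomputable def kernelDensity (I : Finset ι) (e : ι → ℝ → ℝ) (q : ι → ℝ[X]) (ν : Measure ℝ)
    (y : ℝ) : ℝ :=
  ∑ i ∈ I, (∫ z, (q i).eval z ∂ν) * e i y

lemma integrable_kernelDensity (he : ∀ i ∈ I, Integrable (e i) κ) :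
    Integrable (kernelDensity I e q ν) κ :=
  integrable_finsetSum _ fun i hi => (he i hi).const_mul _

lemma integral_kernelOp (hν : PolyIntegrable ν) {f : ℝ → ℝ}
    (hf : ∀ i ∈ I, Integrable (fun y => f y * e i y) κ) :
    ∫ y, (kernelOp κ I e q f).eval y ∂ν = ∫ y, f y * kernelDensity I e q ν y ∂κ := by
  simp only [kernelDensity, Finset.mul_sum, mul_left_comm (f _)]
  rw [← polyInt_apply hν, kernelOp, map_sum,
    integral_finsetSum _ fun i hi => (hf i hi).const_mul _]
  refine Finset.sum_congr rfl fun i _ => ?_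
  rw [polyInt_C_mul, polyInt_apply, mul_comm, ← integral_const_mul]

lemma inducedQuad_kernelOp (hν : PolyIntegrable ν) (he : ∀ i ∈ I, Integrable (e i) κ) :
    inducedQuad (kernelOp κ I e q) ν = densityCDF κ (kernelDensity I e q ν) := by
  funext x
  have hind : ∀ (g : ℝ → ℝ) y, (Iic x).indicator (fun _ => (1 : ℝ)) y * g y =
      (Iic x).indicator g y := fun g y => by
    simp only [← indicator_mul_left, one_mul]
  rw [inducedQuad, integral_kernelOp hν, densityCDF, ← integral_indicator measurableSet_Iic]
  · simp_rw [hind]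
  · intro i hi
    simp_rw [hind]
    exact (he i hi).indicator measurableSet_Iic

lemma cdf_eq_densityCDF (ν : Measure ℝ) [IsProbabilityMeasure ν] :
    ⇑(cdf ν) = densityCDF ν fun _ => 1 := by
  funext x
  rw [cdf_eq_real, densityCDF, setIntegral_const, smul_eq_mul, mul_one]

lemma integral_sub_le_of_abs_sub_le [IsProbabilityMeasure ν] (hν : ν (Icc a b)ᶜ = 0)
    {f g : ℝ → ℝ} (hf : Continuous f) (hg : Continuous g) (h : ∀ x ∈ Icc a b, |f x - g x| ≤ M) :
    ∫ y, f y ∂ν - ∫ y, g y ∂ν ≤ M := by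
  rw [← integral_sub (integrable_of_continuous hν hf) (integrable_of_continuous hν hg)]
  calc ∫ y, f y - g y ∂ν ≤ ∫ _, M ∂ν := by
        refine integral_mono_ae (integrable_of_continuous hν (hf.sub hg)) (integrable_const _) ?_
        filter_upwards [ae_mem_Icc hν] with y hy using (le_abs_self _).trans (h y hy)
    _ = M := by rw [integral_const, probReal_univ, one_smul]

variable [IsFiniteMeasure κ] [IsProbabilityMeasure ν]

lemma wassersteinDist_kernelOp_le (hab : a ≤ b) (hκ : κ (Icc a b)ᶜ = 0) (hν : ν (Icc a b)ᶜ = 0)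
    (he : ∀ i ∈ I, Integrable (e i) κ) (hone : ∫ y, (kernelOp κ I e q fun _ => 1).eval y ∂ν = 1)
    (h : ∀ f : ℝ → ℝ, LipschitzWith 1 f →
      ∫ y, f y ∂ν - ∫ y, (kernelOp κ I e q f).eval y ∂ν ≤ M) :
    wassersteinDist (cdf ν) (inducedQuad (kernelOp κ I e q) ν) ≤ ENNReal.ofReal M := by
  have hνp := polyIntegrable_of_compl_Icc hν
  rw [cdf_eq_densityCDF, inducedQuad_kernelOp hνp he]
  refine wassersteinDist_densityCDF_le hab hν hκ (integrable_const 1) (integrable_kernelDensity he)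
    ?_ fun f hf => ?_
  · rw [integral_kernelOp hνp (by simpa using he)] at hone
    simpa using hone.symm
  · simp_rw [mul_one]
    rw [← integral_kernelOp hνp fun i hi => integrable_continuous_mul hκ hf.continuous (he i hi)]
    exact h f hf

lemma ofReal_integral_sub_integral_kernelOp_le (hab : a ≤ b) (hκ : κ (Icc a b)ᶜ = 0)
    (hν : ν (Icc a b)ᶜ = 0) (he : ∀ i ∈ I, Integrable (e i) κ) {f : ℝ → ℝ} (hf : Continuous f)
    {p : ℝ[X]} (hp : kernelOp κ I e q (fun y => p.eval y) = p)
    (hfp : ∀ x ∈ Icc a b, |f x - p.eval x| ≤ M) :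
    ENNReal.ofReal (∫ y, f y ∂ν - ∫ y, (kernelOp κ I e q f).eval y ∂ν) ≤
      ENNReal.ofReal M * (1 + totalVar (inducedQuad (kernelOp κ I e q) ν)) := by
  have hνp := polyIntegrable_of_compl_Icc hν
  have hw := integrable_kernelDensity (q := q) (ν := ν) he
  have hrule : ∀ {g : ℝ → ℝ}, Continuous g →
      ∫ y, (kernelOp κ I e q g).eval y ∂ν = ∫ y, g y * kernelDensity I e q ν y ∂κ := fun hg =>
    integral_kernelOp hνp fun i hi => integrable_continuous_mul hκ hg (he i hi)
  have hp' := hrule p.continuous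
  rw [hp] at hp'
  have hsplit : ∫ y, f y ∂ν - ∫ y, (kernelOp κ I e q f).eval y ∂ν =
      (∫ y, f y ∂ν - ∫ y, p.eval y ∂ν) +
        -∫ y, (f y - p.eval y) * kernelDensity I e q ν y ∂κ := by
    simp_rw [sub_mul]
    rw [integral_sub (integrable_continuous_mul hκ hf hw)
      (integrable_continuous_mul hκ p.continuous hw), ← hp', hrule hf]
    ring
  rw [hsplit, mul_add, mul_one, inducedQuad_kernelOp hνp he]
  refine ENNReal.ofReal_add_le.trans (add_le_add (ENNReal.ofReal_le_ofReal
    (integral_sub_le_of_abs_sub_le hν hf p.continuous hfp)) ?_)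
  exact (ENNReal.ofReal_le_ofReal (neg_le_abs _)).trans
    (ofReal_abs_integral_mul_le_totalVar hab hκ hw (hf.sub p.continuous) hfp)

lemma wassersteinDist_kernelOp_le_totalVar (hab : a ≤ b) (hκ : κ (Icc a b)ᶜ = 0)
    (hν : ν (Icc a b)ᶜ = 0) (he : ∀ i ∈ I, Integrable (e i) κ)
    (hexact : ∀ p : ℝ[X], p.degree < (s + 1 : ℕ) → kernelOp κ I e q (fun y => p.eval y) = p) :
    wassersteinDist (cdf ν) (inducedQuad (kernelOp κ I e q) ν) ≤
      ENNReal.ofReal (π * (b - a) / (2 * (s + 2))) *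
        (1 + totalVar (inducedQuad (kernelOp κ I e q) ν)) := by
  set B := ENNReal.ofReal (π * (b - a) / (2 * (s + 2))) *
    (1 + totalVar (inducedQuad (kernelOp κ I e q) ν))
  rcases eq_or_ne B ⊤ with htop | htop
  · exact htop ▸ le_top
  rw [← ENNReal.ofReal_toReal htop]
  refine wassersteinDist_kernelOp_le hab hκ hν he ?_ fun f hf => ?_
  · have hone := hexact 1 (degree_one_le.trans_lt (by exact_mod_cast Nat.succ_pos s))
    simp only [eval_one] at hone
    simp only [hone, eval_one, integral_const, probReal_univ, one_smul]
  · obtain ⟨p, hp, hfp⟩ := exists_poly_abs_sub_le hab s hf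
    exact (ENNReal.ofReal_le_iff_le_toReal htop).1
      (ofReal_integral_sub_integral_kernelOp_le hab hκ hν he hf.continuous (hexact p hp) hfp)

end Kernel

/-! ### Error bounds for a single probability distribution -/

section ErrorBounds

variable {a b : ℝ} {μ ν : Measure ℝ} {s k : ℕ}

lemma interpAt_eq_kernelOp (nodes : Finset ℝ) :
    interpAt nodes = kernelOp (atomicMeasure nodes (fun _ => 1) id) nodes
      (fun x => indicator {x} fun _ => 1) (Lagrange.basis nodes id) := by
  funext f
  rw [interpAt, Lagrange.interpolate_apply, kernelOp]
  refine Finset.sum_congr rfl fun x hx => ?_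
  rw [integral_atomicMeasure fun _ _ => zero_le_one, Finset.sum_eq_single_of_mem x hx]
  · simp
  · intro y _ hyx
    simp [hyx]

lemma opApprox_eq_kernelOp (μ : Measure ℝ) (s : ℕ) :
    opApprox μ s = kernelOp μ (Finset.range (s + 1)) (fun i y => (orthPoly μ i).eval y)
      (orthPoly μ) := rfl

lemma OrthNondeg.opInterp_eval (h : PolyIntegrable μ) (hs : OrthNondeg μ (s + 1)) {p : ℝ[X]}
    (hp : p.degree < (s + 1 : ℕ)) : opInterp μ s (fun y => p.eval y) = p :=
  interpAt_eval_eq_self (by rwa [hs.card_orthNodes h])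

lemma OrthNondeg.opApprox_eval (h : PolyIntegrable μ) (hs : OrthNondeg μ (s + 1)) {p : ℝ[X]}
    (hp : p.degree < (s + 1 : ℕ)) : opApprox μ s (fun y => p.eval y) = p := by
  conv_rhs => rw [← hs.sum_orthPoly_eq h hp]
  simp only [opApprox, polyInt_apply, eval_mul]

variable [IsProbabilityMeasure ν]

lemma wassersteinDist_quadInterp_le (hab : a ≤ b) (h : PolyIntegrable μ) (hμ : μ (Icc a b)ᶜ = 0)
    (hν : ν (Icc a b)ᶜ = 0) (hs : OrthNondeg μ (s + 1)) :
    wassersteinDist (cdf ν) (quadInterp μ s ν) ≤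
      ENNReal.ofReal (π * (b - a) / (2 * (s + 2))) * (1 + totalVar (quadInterp μ s ν)) := by
  have hker : opInterp μ s = _ := interpAt_eq_kernelOp (orthNodes μ (s + 1))
  rw [quadInterp, hker]
  exact wassersteinDist_kernelOp_le_totalVar hab
    (atomicMeasure_compl_Icc fun x hx => hs.orthNodes_subset_Icc h hμ hx) hν
    (fun x _ => integrable_atomicMeasure _) fun p hp => hker ▸ hs.opInterp_eval h hp

lemma wassersteinDist_quadApprox_le [IsFiniteMeasure μ] (hab : a ≤ b) (hμ : μ (Icc a b)ᶜ = 0)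
    (hν : ν (Icc a b)ᶜ = 0) (hs : OrthNondeg μ (s + 1)) :
    wassersteinDist (cdf ν) (quadApprox μ s ν) ≤
      ENNReal.ofReal (π * (b - a) / (2 * (s + 2))) * (1 + totalVar (quadApprox μ s ν)) := by
  have h := polyIntegrable_of_compl_Icc hμ
  rw [quadApprox, opApprox_eq_kernelOp]
  exact wassersteinDist_kernelOp_le_totalVar hab hμ hν (fun i _ => h _) fun p hp =>
    hs.opApprox_eval h hp

lemma two_mul_jackson_rate_le (hab : a ≤ b) (hk : 1 ≤ k) :
    2 * (π * (b - a) / (2 * ((2 * k - 1 : ℕ) + 2))) ≤ π * (b - a) / (2 * k) := by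
  have hk' : (1 : ℝ) ≤ k := by exact_mod_cast hk
  have hnum : 0 ≤ π * (b - a) := mul_nonneg Real.pi_pos.le (sub_nonneg.2 hab)
  have hs : ((2 * k - 1 : ℕ) : ℝ) + 2 = 2 * k + 1 := by
    rw [Nat.cast_sub (by omega)]
    push_cast
    ring
  rw [hs, ← mul_div_assoc, mul_div_mul_left _ _ (two_ne_zero' ℝ)]
  exact div_le_div_of_nonneg_left hnum (by linarith) (by linarith)

/-- Both `ν` and its Gaussian rule integrate the approximating polynomial alike, and each is a
probability distribution on `[a, b]`, so each contributes one approximation error. -/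
lemma integral_sub_gaussIntegral_le (hab : a ≤ b) (hν : ν (Icc a b)ᶜ = 0) (hk : 1 ≤ k) {f : ℝ → ℝ}
    (hf : LipschitzWith 1 f) :
    ∫ y, f y ∂ν - gaussIntegral ν k f ≤ π * (b - a) / (2 * k) := by
  have h := polyIntegrable_of_compl_Icc hν
  have := isProbabilityMeasure_gaussMeasure h hk
  obtain ⟨p, hp, hfp⟩ := exists_poly_abs_sub_le hab (2 * k - 1) hf
  rw [show 2 * k - 1 + 1 = 2 * k by omega] at hp
  have hexact := integral_eval_gaussMeasure h hp
  have hν_err := integral_sub_le_of_abs_sub_le hν hf.continuous p.continuous hfp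
  have hgauss_err := integral_sub_le_of_abs_sub_le (gaussMeasure_compl_Icc h hν k) p.continuous
    hf.continuous fun x hx => abs_sub_comm (f x) (p.eval x) ▸ hfp x hx
  rw [← integral_gaussMeasure h]
  linarith [two_mul_jackson_rate_le hab hk]

lemma wassersteinDist_quadGauss_le (hab : a ≤ b) (hν : ν (Icc a b)ᶜ = 0) (hk : 1 ≤ k) :
    wassersteinDist (cdf ν) (quadGauss k ν) ≤ ENNReal.ofReal (π * (b - a) / (2 * k)) := by
  have h := polyIntegrable_of_compl_Icc hν
  have := isProbabilityMeasure_gaussMeasure h hk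
  have hker := interpAt_eq_kernelOp (gaussNodes ν k)
  rw [quadGauss, hker]
  refine wassersteinDist_kernelOp_le hab
    (atomicMeasure_compl_Icc fun x hx => gaussNodes_subset_Icc h hν k hx) hν
    (fun x _ => integrable_atomicMeasure _) ?_ fun f hf => ?_
  · have hone := integral_gaussMeasure h k fun _ => 1
    rwa [integral_const, probReal_univ, one_smul, gaussIntegral, hker, eq_comm] at hone
  · rw [← hker]
    exact integral_sub_gaussIntegral_le hab hν hk hf

lemma ChebExact.wassersteinDist_jacksonOp_le {κ : Measure ℝ} [IsFiniteMeasure κ]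
    {h : PolyIntegrable κ} (hex : ChebExact a b s h) (hab : a < b) (hκ : κ (Icc a b)ᶜ = 0)
    (hν : ν (Icc a b)ᶜ = 0) :
    wassersteinDist (cdf ν) (inducedQuad (jacksonOp a b s κ) ν) ≤
      ENNReal.ofReal (π * (b - a) / (2 * (s + 2))) := by
  refine wassersteinDist_kernelOp_le hab.le hκ hν (fun i _ => (h _).const_mul _) ?_ fun f hf =>
    integral_sub_le_of_abs_sub_le hν hf.continuous (Polynomial.continuous _) fun x hx =>
      hex.abs_sub_jacksonOp_le hab hκ hf hx
  have hone := hex.jacksonOp_one hκ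
  rw [jacksonOp] at hone
  simp only [hone, eval_one, integral_const, probReal_univ, one_smul]

lemma wassersteinDist_quadDampedApprox_le (hab : a < b) (hν : ν (Icc a b)ᶜ = 0) (s : ℕ) :
    wassersteinDist (cdf ν) (quadDampedApprox a b s ν) ≤
      ENNReal.ofReal (π * (b - a) / (2 * (s + 2))) := by
  have := isProbabilityMeasure_chebMeasure hab
  rw [quadDampedApprox, opDampedApprox_eq_jacksonOp hab]
  exact (chebExact_chebMeasure hab s).wassersteinDist_jacksonOp_le hab
    (chebMeasure_compl_Icc a b) hν

lemma wassersteinDist_quadDampedInterp_le (hab : a < b) (hν : ν (Icc a b)ᶜ = 0) (s : ℕ) :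
    wassersteinDist (cdf ν) (quadDampedInterp a b s ν) ≤
      ENNReal.ofReal (π * (b - a) / (2 * (s + 2))) := by
  have hκ := gaussMeasure_compl_Icc (polyIntegrable_chebMeasure hab) (chebMeasure_compl_Icc a b)
    (s + 1)
  have hex := chebExact_gaussMeasure hab s (polyIntegrable_of_compl_Icc hκ)
  rw [quadDampedInterp, opDampedInterp_eq_jacksonOp hab]
  exact hex.wassersteinDist_jacksonOp_le hab hκ hν

end ErrorBounds

/-! ### Moments of quadratic forms on the sphere -/

section GaussianMoments

variable {ι E : Type*} [Fintype ι] [NormedAddCommGroup E] [InnerProductSpace ℝ E]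

/-- The squared norm of the projection to the span of some vectors of an orthonormal basis. -/
noncomputable def projSq (w : OrthonormalBasis ι ℝ E) (S : Finset ι) (v : E) : ℝ :=
  ∑ j ∈ S, inner ℝ (w j) v ^ 2

variable (w : OrthonormalBasis ι ℝ E) (S : Finset ι)

lemma continuous_projSq : Continuous (projSq w S) := by
  unfold projSq
  fun_prop

lemma projSq_univ (v : E) : projSq w Finset.univ v = ‖v‖ ^ 2 := by
  simp only [projSq, ← w.sum_sq_norm_inner_right v, Real.norm_eq_abs, sq_abs]

lemma projSq_nonneg (v : E) : 0 ≤ projSq w S v :=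
  Finset.sum_nonneg fun _ _ => sq_nonneg _

lemma projSq_smul (r : ℝ) (v : E) : projSq w S (r • v) = r ^ 2 * projSq w S v := by
  simp_rw [projSq, inner_smul_right, mul_pow, Finset.mul_sum]

lemma projSq_add_compl [DecidableEq ι] (v : E) : projSq w S v + projSq w Sᶜ v = ‖v‖ ^ 2 := by
  rw [← projSq_univ w, projSq, projSq, projSq, Finset.sum_add_sum_compl]

lemma exp_neg_normSq_mul_exp_projSq [DecidableEq ι] (t : ℝ) (x : E) :
    Real.exp (-‖x‖ ^ 2) * Real.exp (t * projSq w S x) =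
      ∏ j, Real.exp (-(if j ∈ S then 1 - t else 1) * inner ℝ (w j) x ^ 2) := by
  rw [← Real.exp_add, ← Real.exp_sum, ← projSq_univ w, projSq, projSq, Finset.mul_sum,
    ← Finset.sum_neg_distrib, ← Finset.univ_inter S, ← Finset.sum_ite_mem, ← Finset.sum_add_distrib]
  congr 1
  refine Finset.sum_congr rfl fun j _ => ?_
  rw [Finset.univ_inter]
  split_ifs <;> ring

variable [FiniteDimensional ℝ E] [MeasurableSpace E] [BorelSpace E]

lemma integrable_prod_inner {g : ι → ℝ → ℝ} (hg : ∀ j, Integrable (g j)) :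
    Integrable fun x : E => ∏ j, g j (inner ℝ (w j) x) := by
  have hpi : Integrable fun y : ι → ℝ => ∏ j, g j (y j) := Integrable.fintype_prod hg
  simpa only [Function.comp_def, w.repr_apply_apply] using
    w.measurePreserving_repr.integrable_comp_of_integrable
      ((PiLp.volume_preserving_ofLp ι).integrable_comp_of_integrable hpi)

lemma integral_prod_inner (g : ι → ℝ → ℝ) :
    ∫ x : E, ∏ j, g j (inner ℝ (w j) x) = ∏ j, ∫ y, g j y := by
  simp_rw [← w.repr_apply_apply]
  rw [w.measurePreserving_repr.integral_comp w.repr.toHomeomorph.measurableEmbedding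
      (fun y : EuclideanSpace ℝ ι => ∏ j, g j (y j)),
    (PiLp.volume_preserving_ofLp ι).integral_comp
      (MeasurableEquiv.toLp 2 (ι → ℝ)).symm.measurableEmbedding
      (fun z : ι → ℝ => ∏ j, g j (z j)), integral_fintype_prod_volume_eq_prod]

/-- The (unnormalized) Gaussian measure with density `exp (-‖x‖²)`, whose radial and angular parts
are independent and whose coordinates in any orthonormal basis are independent. -/
noncomputable def expNormSq (E : Type*) [NormedAddCommGroup E] [InnerProductSpace ℝ E]
    [FiniteDimensional ℝ E] [MeasurableSpace E] [BorelSpace E] : Measure E :=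
  volume.withDensity fun x => ENNReal.ofReal (Real.exp (-‖x‖ ^ 2))

lemma integral_expNormSq (f : E → ℝ) :
    ∫ x, f x ∂expNormSq E = ∫ x, Real.exp (-‖x‖ ^ 2) * f x := by
  rw [expNormSq, integral_withDensity_eq_integral_toReal_smul (by fun_prop)
    (Eventually.of_forall fun x => ENNReal.ofReal_lt_top)]
  simp_rw [ENNReal.toReal_ofReal (Real.exp_pos _).le, smul_eq_mul]

lemma integrable_exp_projSq {t : ℝ} (ht : t < 1) :
    Integrable (fun x => Real.exp (t * projSq w S x)) (expNormSq E) := by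
  classical
  rw [expNormSq, integrable_withDensity_iff_integrable_smul' (by fun_prop)
    (Eventually.of_forall fun x => ENNReal.ofReal_lt_top)]
  simp_rw [ENNReal.toReal_ofReal (Real.exp_pos _).le, smul_eq_mul, exp_neg_normSq_mul_exp_projSq]
  refine integrable_prod_inner w fun j => integrable_exp_neg_mul_sq ?_
  split_ifs <;> linarith

lemma mgf_projSq {t : ℝ} (ht : t < 1) :
    mgf (projSq w S) (expNormSq E) t =
      √π ^ Fintype.card ι * (1 - t) ^ (-(S.card / 2 : ℝ)) := by
  classical
  have ht' : 0 ≤ 1 - t := by linarith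
  have hsqrt (j : ι) : √(π / if j ∈ S then 1 - t else 1) =
      √π * if j ∈ S then (1 - t) ^ (-(1 / 2 : ℝ)) else 1 := by
    split_ifs
    · rw [Real.sqrt_div Real.pi_pos.le, Real.rpow_neg ht', Real.sqrt_eq_rpow (1 - t),
        div_eq_mul_inv]
    · rw [div_one, mul_one]
  rw [mgf, integral_expNormSq]
  simp_rw [exp_neg_normSq_mul_exp_projSq]
  rw [integral_prod_inner w
    fun (j : ι) (y : ℝ) => Real.exp (-(if j ∈ S then 1 - t else 1) * y ^ 2)]
  simp_rw [integral_gaussian, hsqrt]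
  rw [Finset.prod_mul_distrib, Finset.prod_const, Finset.card_univ, Finset.prod_ite_mem,
    Finset.univ_inter, Finset.prod_const, ← Real.rpow_mul_natCast ht']
  congr 2
  ring

lemma iteratedDeriv_mgf_projSq (k : ℕ) {t : ℝ} (ht : t < 1) :
    iteratedDeriv k (mgf (projSq w S) (expNormSq E)) t =
      √π ^ Fintype.card ι * (∏ i ∈ Finset.range k, (S.card / 2 + i : ℝ)) *
        (1 - t) ^ (-(S.card / 2 + k : ℝ)) := by
  induction k generalizing t with
  | zero => simp [mgf_projSq w S ht]
  | succ k ih =>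
    have hev : iteratedDeriv k (mgf (projSq w S) (expNormSq E)) =ᶠ[𝓝 t] fun t =>
        √π ^ Fintype.card ι * (∏ i ∈ Finset.range k, (S.card / 2 + i : ℝ)) *
          (1 - t) ^ (-(S.card / 2 + k : ℝ)) := by
      filter_upwards [isOpen_Iio.mem_nhds ht] with u hu using ih hu
    have hderiv := (((hasDerivAt_id t).const_sub 1).rpow_const (p := -(S.card / 2 + k : ℝ))
      (Or.inl (by simp only [id]; linarith))).const_mul
        (√π ^ Fintype.card ι * (∏ i ∈ Finset.range k, (S.card / 2 + i : ℝ)))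
    rw [iteratedDeriv_succ, hev.deriv_eq]
    simp only [id] at hderiv
    rw [hderiv.deriv, Finset.prod_range_succ]
    push_cast
    rw [show -((S.card : ℝ) / 2 + k) - 1 = -((S.card : ℝ) / 2 + (k + 1)) by ring]
    ring

lemma integral_projSq_pow_expNormSq (k : ℕ) :
    ∫ x, projSq w S x ^ k ∂expNormSq E =
      √π ^ Fintype.card ι * ∏ i ∈ Finset.range k, (S.card / 2 + i : ℝ) := by
  have hzero : 0 ∈ interior (integrableExpSet (projSq w S) (expNormSq E)) :=
    mem_interior.2 ⟨Iio 1, fun t ht => integrable_exp_projSq w S ht, isOpen_Iio,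
      mem_Iio.2 one_pos⟩
  have h := iteratedDeriv_mgf_zero hzero k
  rw [iteratedDeriv_mgf_projSq w S k one_pos, sub_zero, Real.one_rpow, mul_one] at h
  exact h.symm

lemma integral_expNormSq_of_homogeneous [Nontrivial E] {f : E → ℝ} {d : ℕ}
    (hf : ∀ (r : ℝ) x, f (r • x) = r ^ d * f x) :
    ∫ x, f x ∂expNormSq E =
      (∫ u : Metric.sphere (0 : E) 1, f u ∂volume.toSphere) *
      ∫ r : Ioi (0 : ℝ), (r : ℝ) ^ d * Real.exp (-(r : ℝ) ^ 2)
        ∂Measure.volumeIoiPow (Module.finrank ℝ E - 1) := by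
  have hpunctured : ∫ x, Real.exp (-‖x‖ ^ 2) * f x =
      ∫ x : ({0}ᶜ : Set E), Real.exp (-‖x.1‖ ^ 2) * f x.1 ∂((volume : Measure E).comap (↑)) := by
    rw [integral_subtype_comap (measurableSet_singleton _).compl
      fun x : E => Real.exp (-‖x‖ ^ 2) * f x, restrict_compl_singleton]
  rw [integral_expNormSq, ← integral_prod_mul (f := fun u : Metric.sphere (0 : E) 1 => f u)
      (g := fun r : Ioi (0 : ℝ) => (r : ℝ) ^ d * Real.exp (-(r : ℝ) ^ 2)),
    ← (volume : Measure E).measurePreserving_homeomorphUnitSphereProd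
      |>.integral_comp (Homeomorph.measurableEmbedding _), hpunctured]
  congr 1
  funext x
  have hx : ‖(x : E)‖ ≠ 0 := norm_ne_zero_iff.2 x.2
  simp only [homeomorphUnitSphereProd_apply_fst_coe, homeomorphUnitSphereProd_apply_snd_coe]
  rw [hf, inv_pow]
  field_simp

end GaussianMoments

section SphereMoments

variable {n : ℕ} (w : OrthonormalBasis (Fin n) ℝ (EuclideanSpace ℝ (Fin n))) (S : Finset (Fin n))

lemma integral_unifSphere {f : EuclideanSpace ℝ (Fin n) → ℝ} (hf : Continuous f) :
    ∫ v, f v ∂unifSphere n =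
      ((volume : Measure (EuclideanSpace ℝ (Fin n))).toSphere.real univ)⁻¹ *
      ∫ u : Metric.sphere (0 : EuclideanSpace ℝ (Fin n)) 1, f u ∂volume.toSphere := by
  rw [unifSphere, integral_map measurable_subtype_coe.aemeasurable hf.aestronglyMeasurable,
    ProbabilityTheory.cond, Measure.restrict_univ, integral_smul_measure, smul_eq_mul,
    ENNReal.toReal_inv, measureReal_def]

lemma ae_norm_eq_one_unifSphere : ∀ᵐ v ∂unifSphere n, ‖v‖ = 1 := by
  rw [unifSphere, ae_map_iff measurable_subtype_coe.aemeasurable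
    (measurableSet_eq_fun measurable_norm measurable_const)]
  exact Eventually.of_forall norm_eq_of_mem_sphere

variable [NeZero n]

lemma toSphere_univ_ne_zero :
    (volume : Measure (EuclideanSpace ℝ (Fin n))).toSphere univ ≠ 0 :=
  Measure.measure_univ_ne_zero.2 (Measure.toSphere_ne_zero _)

instance isProbabilityMeasure_unifSphere : IsProbabilityMeasure (unifSphere n) := by
  have := cond_isProbabilityMeasure (toSphere_univ_ne_zero (n := n))
  exact Measure.isProbabilityMeasure_map measurable_subtype_coe.aemeasurable

lemma integral_projSq_univ_pow_unifSphere (k : ℕ) :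
    ∫ v, projSq w Finset.univ v ^ k ∂unifSphere n = 1 := by
  have h : ∀ᵐ v ∂unifSphere n, projSq w Finset.univ v ^ k = 1 := by
    filter_upwards [ae_norm_eq_one_unifSphere] with v hv
    rw [projSq_univ, hv, one_pow, one_pow]
  rw [integral_congr_ae h, integral_const, probReal_univ, one_smul]

lemma prod_mul_integral_projSq_pow_unifSphere (k : ℕ) :
    (∏ i ∈ Finset.range k, (n / 2 + i : ℝ)) * ∫ v, projSq w S v ^ k ∂unifSphere n =
      ∏ i ∈ Finset.range k, (S.card / 2 + i : ℝ) := by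
  set σ := (volume : Measure (EuclideanSpace ℝ (Fin n))).toSphere.real univ
  obtain ⟨R, hpolar⟩ : ∃ R, ∀ T : Finset (Fin n), √π ^ n * ∏ i ∈ Finset.range k,
      (T.card / 2 + i : ℝ) = σ * (∫ v, projSq w T v ^ k ∂unifSphere n) * R := by
    refine ⟨∫ r : Ioi (0 : ℝ), (r : ℝ) ^ (2 * k) * Real.exp (-(r : ℝ) ^ 2)
      ∂Measure.volumeIoiPow (Module.finrank ℝ (EuclideanSpace ℝ (Fin n)) - 1), fun T => ?_⟩
    have hmoment := integral_projSq_pow_expNormSq w T k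
    have hσ : σ ≠ 0 := ENNReal.toReal_ne_zero.2 ⟨toSphere_univ_ne_zero, measure_ne_top _ _⟩
    rw [Fintype.card_fin, integral_expNormSq_of_homogeneous (d := 2 * k) fun r x => by
      rw [projSq_smul, mul_pow, ← pow_mul]] at hmoment
    rw [← hmoment, integral_unifSphere (f := fun v => projSq w T v ^ k)
      ((continuous_projSq w T).pow k), mul_inv_cancel_left₀ hσ]
  have hfull := hpolar Finset.univ
  rw [integral_projSq_univ_pow_unifSphere, Finset.card_univ, Fintype.card_fin, mul_one] at hfull
  refine mul_left_cancel₀ (pow_ne_zero n (Real.sqrt_pos.2 Real.pi_pos).ne') ?_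
  rw [hpolar S, ← mul_assoc, hfull]
  ring

/-- This recurrence characterizes the moments of a Beta distribution. -/
lemma integral_projSq_pow_succ_unifSphere (k : ℕ) :
    (n / 2 + k : ℝ) * ∫ v, projSq w S v ^ (k + 1) ∂unifSphere n =
      (S.card / 2 + k : ℝ) * ∫ v, projSq w S v ^ k ∂unifSphere n := by
  have hn : (0 : ℝ) < n := Nat.cast_pos.2 (NeZero.pos n)
  have hprod : ∏ i ∈ Finset.range k, (n / 2 + i : ℝ) ≠ 0 :=
    Finset.prod_ne_zero_iff.2 fun i _ => by positivity
  have hsucc := prod_mul_integral_projSq_pow_unifSphere w S (k + 1)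
  rw [Finset.prod_range_succ, Finset.prod_range_succ,
    ← prod_mul_integral_projSq_pow_unifSphere w S k] at hsucc
  refine mul_left_cancel₀ hprod ?_
  linear_combination hsucc

end SphereMoments

/-! ### Sub-Gaussian bound from the moments of a Beta distribution -/

section IntegratingFactor

variable {d d' : ℝ → ℝ} {γ : ℝ}

/-- The hypothesis says that `t ^ γ * d t` decreases from its value `0` at `t = 0`. -/
lemma nonpos_of_mul_add_mul_deriv_nonpos (hγ : 0 < γ) (hd : ∀ t, HasDerivAt d (d' t) t)
    (h : ∀ t, 0 < t → γ * d t + t * d' t ≤ 0) {t : ℝ} (ht : 0 < t) : d t ≤ 0 := by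
  have hderiv : ∀ t ∈ interior (Ici (0 : ℝ)),
      HasDerivAt (fun t => t ^ γ * d t) (t ^ (γ - 1) * (γ * d t + t * d' t)) t := by
    intro t ht
    rw [interior_Ici, mem_Ioi] at ht
    refine ((Real.hasDerivAt_rpow_const (Or.inl ht.ne')).mul (hd t)).congr_deriv ?_
    rw [mul_add, ← mul_assoc (t ^ (γ - 1)) t, ← Real.rpow_add_one ht.ne', sub_add_cancel]
    ring
  have hanti : AntitoneOn (fun t => t ^ γ * d t) (Ici 0) := by
    refine antitoneOn_of_deriv_nonpos (convex_Ici 0)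
      ((Real.continuous_rpow_const hγ.le).mul
        (continuous_iff_continuousAt.2 fun t => (hd t).continuousAt)).continuousOn
      (fun t ht => (hderiv t ht).differentiableAt.differentiableWithinAt) fun t ht => ?_
    rw [(hderiv t ht).deriv]
    rw [interior_Ici, mem_Ioi] at ht
    exact mul_nonpos_of_nonneg_of_nonpos (Real.rpow_nonneg ht.le _) (h t ht)
  have hle := hanti self_mem_Ici ht.le ht.le
  simp only [Real.zero_rpow hγ.ne', zero_mul] at hle
  exact nonpos_of_mul_nonpos_right hle (Real.rpow_pos_of_pos ht γ)

lemma mul_nonpos_of_mul_add_mul_deriv_nonpos (hγ : 0 < γ) (hd : ∀ t, HasDerivAt d (d' t) t)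
    (h : ∀ t, t * (γ * d t + t * d' t) ≤ 0) (t : ℝ) : t * d t ≤ 0 := by
  rcases lt_trichotomy t 0 with ht | rfl | ht
  · have hreflect : ∀ t, HasDerivAt (fun t => -d (-t)) (d' (-t)) t := fun t =>
      ((hd (-t)).scomp t (hasDerivAt_neg t)).neg.congr_deriv (by simp)
    have hle := nonpos_of_mul_add_mul_deriv_nonpos hγ hreflect
      (fun u hu => by nlinarith [h (-u)]) (neg_pos.2 ht)
    rw [neg_neg, neg_nonpos] at hle
    exact mul_nonpos_of_nonpos_of_nonneg ht.le hle
  · rw [zero_mul]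
  · exact mul_nonpos_of_nonneg_of_nonpos ht.le <| nonpos_of_mul_add_mul_deriv_nonpos hγ hd
      (fun u hu => nonpos_of_mul_nonpos_right (h u) hu) ht

lemma le_apply_zero_of_mul_deriv_nonpos (hd : ∀ t, HasDerivAt d (d' t) t)
    (h : ∀ t, t * d' t ≤ 0) (t : ℝ) : d t ≤ d 0 := by
  have hcont : Continuous d := continuous_iff_continuousAt.2 fun t => (hd t).continuousAt
  have hdiff : Differentiable ℝ d := fun t => (hd t).differentiableAt
  rcases le_total 0 t with ht | ht
  · refine antitoneOn_of_deriv_nonpos (convex_Ici 0) hcont.continuousOn hdiff.differentiableOn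
      (fun u hu => ?_) self_mem_Ici ht ht
    rw [interior_Ici, mem_Ioi] at hu
    rw [(hd u).deriv]
    exact nonpos_of_mul_nonpos_right (h u) hu
  · refine monotoneOn_of_deriv_nonneg (convex_Iic 0) hcont.continuousOn hdiff.differentiableOn
      (fun u hu => ?_) ht self_mem_Iic ht
    rw [interior_Iic, mem_Iio] at hu
    rw [(hd u).deriv]
    exact nonneg_of_mul_nonpos_right (h u) hu

end IntegratingFactor

section BetaMoments

variable {Ω : Type*} [MeasurableSpace Ω] {μ : Measure Ω} {X : Ω → ℝ} {α γ : ℝ}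

/-- The `j`-th derivative `∫ X ^ j exp (t X)` of the moment generating function of `X`. -/
noncomputable def mgfDeriv (X : Ω → ℝ) (μ : Measure Ω) (j : ℕ) (t : ℝ) : ℝ :=
  ∫ ω, X ω ^ j * Real.exp (t * X ω) ∂μ

lemma mgfDeriv_zero (t : ℝ) : mgfDeriv X μ 0 t = mgf X μ t := by
  simp only [mgfDeriv, mgf, pow_zero, one_mul]

section FiniteMeasure

variable [IsFiniteMeasure μ]

lemma hasDerivAt_mgfDeriv (hX : AEMeasurable X μ) (h01 : ∀ᵐ ω ∂μ, X ω ∈ Icc 0 1) (j : ℕ) (t : ℝ) :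
    HasDerivAt (mgfDeriv X μ j) (mgfDeriv X μ (j + 1) t) t := by
  refine hasDerivAt_integral_pow_mul_exp_real ?_ j
  have huniv : integrableExpSet X μ = univ :=
    eq_univ_of_forall fun t => integrable_exp_mul_of_mem_Icc hX h01
  rw [huniv, interior_univ]
  exact mem_univ t

lemma hasSum_mgfDeriv (hX : AEMeasurable X μ) (h01 : ∀ᵐ ω ∂μ, X ω ∈ Icc 0 1) (j : ℕ) (t : ℝ) :
    HasSum (fun k : ℕ => t ^ k / k.factorial * ∫ ω, X ω ^ (k + j) ∂μ) (mgfDeriv X μ j t) := by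
  have hbound (k : ℕ) : ∀ᵐ ω ∂μ,
      ‖t ^ k / k.factorial * X ω ^ (k + j)‖ ≤ |t| ^ k / k.factorial := by
    filter_upwards [h01] with ω hω
    simp only [norm_mul, norm_div, norm_pow, Real.norm_eq_abs, Nat.abs_cast, abs_of_nonneg hω.1]
    exact mul_le_of_le_one_right (by positivity) (pow_le_one₀ hω.1 hω.2)
  have hint (k : ℕ) : Integrable (fun ω => t ^ k / k.factorial * X ω ^ (k + j)) μ :=
    (integrable_const (|t| ^ k / k.factorial : ℝ)).mono'
      ((hX.pow_const _).const_mul _).aestronglyMeasurable (hbound k)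
  have hsum : Summable fun k : ℕ => ∫ ω, ‖t ^ k / k.factorial * X ω ^ (k + j)‖ ∂μ := by
    refine ((Real.summable_pow_div_factorial |t|).mul_left (μ.real univ)).of_nonneg_of_le
      (fun k => integral_nonneg fun _ => norm_nonneg _) fun k => ?_
    refine (integral_mono_ae (hint k).norm (integrable_const _) (hbound k)).trans_eq ?_
    rw [integral_const, smul_eq_mul]
  have hseries (ω : Ω) :
      ∑' k : ℕ, t ^ k / k.factorial * X ω ^ (k + j) = X ω ^ j * Real.exp (t * X ω) := by
    have hexp : HasSum (fun k : ℕ => (t * X ω) ^ k / k.factorial) (Real.exp (t * X ω)) := by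
      rw [Real.exp_eq_exp_ℝ]
      exact NormedSpace.expSeries_div_hasSum_exp _
    rw [← (hexp.mul_left (X ω ^ j)).tsum_eq]
    refine tsum_congr fun k => ?_
    rw [mul_pow, pow_add]
    ring
  have h := hasSum_integral_of_summable_integral_norm hint hsum
  simpa only [mgfDeriv, hseries, integral_const_mul] using h

/-- Kummer's differential equation. Both sides have the power series with coefficients
`k (m_k - m_{k+1}) / k!`, where `m_k` are the moments of `X`. -/
lemma kummer_mgfDeriv (hX : AEMeasurable X μ) (h01 : ∀ᵐ ω ∂μ, X ω ∈ Icc 0 1)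
    (hrec : ∀ k : ℕ, (γ + k) * ∫ ω, X ω ^ (k + 1) ∂μ = (α + k) * ∫ ω, X ω ^ k ∂μ) (t : ℝ) :
    γ * mgfDeriv X μ 1 t - α * mgfDeriv X μ 0 t =
      t * (mgfDeriv X μ 1 t - mgfDeriv X μ 2 t) := by
  set m : ℕ → ℝ := fun k => ∫ ω, X ω ^ k ∂μ
  set c : ℕ → ℝ := fun k => t ^ k / k.factorial * k * (m k - m (k + 1)) with hc
  have hsum (j : ℕ) : HasSum (fun k : ℕ => t ^ k / k.factorial * m (k + j)) (mgfDeriv X μ j t) :=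
    hasSum_mgfDeriv hX h01 j t
  have hleft : HasSum c (γ * mgfDeriv X μ 1 t - α * mgfDeriv X μ 0 t) := by
    refine (((hsum 1).mul_left γ).sub ((hsum 0).mul_left α)).congr_fun fun k => ?_
    linear_combination (-(t ^ k / k.factorial)) * hrec k
  have hright : HasSum (fun k => c (k + 1)) (t * (mgfDeriv X μ 1 t - mgfDeriv X μ 2 t)) := by
    refine (((hsum 1).sub (hsum 2)).mul_left t).congr_fun fun k => ?_
    have hfac : (k.factorial : ℝ) ≠ 0 := Nat.cast_ne_zero.2 k.factorial_ne_zero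
    simp only [hc, Nat.factorial_succ]
    push_cast
    field_simp
    ring_nf
  rw [hasSum_nat_add_iff 1] at hright
  simpa [hc] using hleft.unique hright

end FiniteMeasure

variable [IsProbabilityMeasure μ]

/-- The function `d` is the derivative of `log (mgf X) - (α / γ) t - t² / (8 (γ + 1))`; by Kummer's
equation, `γ d + t d' = -t (mgf' / mgf - 1 / 2)²`. -/
lemma mul_logDeriv_mgf_sub_nonpos (hX : AEMeasurable X μ) (h01 : ∀ᵐ ω ∂μ, X ω ∈ Icc 0 1)
    (hγ : 0 < γ)
    (hrec : ∀ k : ℕ, (γ + k) * ∫ ω, X ω ^ (k + 1) ∂μ = (α + k) * ∫ ω, X ω ^ k ∂μ) (t : ℝ) :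
    t * (mgfDeriv X μ 1 t / mgfDeriv X μ 0 t - α / γ - t / (4 * (γ + 1))) ≤ 0 := by
  have hpos (t : ℝ) : 0 < mgfDeriv X μ 0 t :=
    mgfDeriv_zero (X := X) t ▸ mgf_pos (integrable_exp_mul_of_mem_Icc hX h01)
  have hder := hasDerivAt_mgfDeriv hX h01
  refine mul_nonpos_of_mul_add_mul_deriv_nonpos (d := fun t =>
    mgfDeriv X μ 1 t / mgfDeriv X μ 0 t - α / γ - t / (4 * (γ + 1))) hγ
    (fun t => (((hder 1 t).div (hder 0 t) (hpos t).ne').sub_const (α / γ)).sub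
      ((hasDerivAt_id t).div_const _)) (fun t => ?_) t
  have hkummer := kummer_mgfDeriv hX h01 hrec t
  have hpos_t := hpos t
  simp only [zero_add, one_add_one_eq_two]
  generalize mgfDeriv X μ 0 t = x, mgfDeriv X μ 1 t = y, mgfDeriv X μ 2 t = z at *
  have hriccati : t * (γ * (y / x - α / γ - t / (4 * (γ + 1))) +
      t * ((z * x - y * y) / x ^ 2 - 1 / (4 * (γ + 1)))) = -(t * (y / x - 1 / 2)) ^ 2 := by
    field_simp
    linear_combination (16 * x * (γ + 1) * t) * hkummer
  rw [hriccati]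
  exact neg_nonpos.2 (sq_nonneg _)

lemma mgf_le_of_beta_moments (hX : AEMeasurable X μ) (h01 : ∀ᵐ ω ∂μ, X ω ∈ Icc 0 1)
    (hγ : 0 < γ)
    (hrec : ∀ k : ℕ, (γ + k) * ∫ ω, X ω ^ (k + 1) ∂μ = (α + k) * ∫ ω, X ω ^ k ∂μ) (t : ℝ) :
    mgf X μ t ≤ Real.exp (α / γ * t + t ^ 2 / (8 * (γ + 1))) := by
  have hpos (t : ℝ) : 0 < mgfDeriv X μ 0 t :=
    mgfDeriv_zero (X := X) t ▸ mgf_pos (integrable_exp_mul_of_mem_Icc hX h01)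
  have hderiv (t : ℝ) : HasDerivAt
      (fun t => Real.log (mgfDeriv X μ 0 t) - α / γ * t - t ^ 2 / (8 * (γ + 1)))
      (mgfDeriv X μ 1 t / mgfDeriv X μ 0 t - α / γ - t / (4 * (γ + 1))) t := by
    refine ((((hasDerivAt_mgfDeriv hX h01 0 t).log (hpos t).ne').sub
      ((hasDerivAt_id t).const_mul (α / γ))).sub
        ((hasDerivAt_pow 2 t).div_const (8 * (γ + 1)))).congr_deriv ?_
    field_simp
    push_cast
    ring
  have hle := le_apply_zero_of_mul_deriv_nonpos hderiv
    (mul_logDeriv_mgf_sub_nonpos hX h01 hγ hrec) t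
  simp only [mgfDeriv_zero, mgf_zero, Real.log_one, mul_zero, zero_pow two_ne_zero, zero_div,
    sub_zero] at hle
  rw [← mgfDeriv_zero, ← Real.log_le_iff_le_exp (hpos t), mgfDeriv_zero]
  linarith

end BetaMoments

/-! ### Quadratic forms on the sphere are sub-Gaussian -/

lemma exists_finset_eq_indicator_of_forall_mem_pair {ι : Type*} [Finite ι] {β : ι → ℝ}
    (hβ : ∀ j, β j ∈ ({0, 1} : Set ℝ)) : ∃ S : Finset ι, β = indicator (S : Set ι) 1 := by
  refine ⟨(toFinite {j | β j = 1}).toFinset, funext fun j => ?_⟩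
  rcases hβ j with h | h
  · simp [h]
  · rw [mem_singleton_iff] at h
    simp [h]

section DiagForm

variable {ι E : Type*} [Fintype ι] [NormedAddCommGroup E] [InnerProductSpace ℝ E]
  (w : OrthonormalBasis ι ℝ E)

/-- The quadratic form with eigenvalues `β` in the orthonormal basis `w`. -/
noncomputable def diagForm (β : ι → ℝ) (v : E) : ℝ :=
  ∑ j, β j * inner ℝ (w j) v ^ 2

lemma continuous_diagForm (β : ι → ℝ) : Continuous (diagForm w β) := by
  unfold diagForm
  fun_prop

lemma diagForm_add_smul (p q : ℝ) (β β' : ι → ℝ) (v : E) :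
    diagForm w (p • β + q • β') v = p * diagForm w β v + q * diagForm w β' v := by
  simp only [diagForm, Pi.add_apply, Pi.smul_apply, smul_eq_mul, add_mul, mul_assoc,
    Finset.sum_add_distrib, Finset.mul_sum]

lemma diagForm_indicator_one (S : Finset ι) (v : E) :
    diagForm w (indicator (S : Set ι) 1) v = projSq w S v := by
  classical
  simp only [diagForm, projSq, indicator_apply, Finset.mem_coe, Pi.one_apply, ite_mul, one_mul,
    zero_mul, Finset.sum_ite_mem, Finset.univ_inter]

lemma projSq_mem_Icc_of_norm_eq_one (S : Finset ι) {v : E} (hv : ‖v‖ = 1) :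
    projSq w S v ∈ Icc 0 1 := by
  classical
  have hadd := projSq_add_compl w S v
  rw [hv, one_pow] at hadd
  exact ⟨projSq_nonneg w S v, by linarith [projSq_nonneg w Sᶜ v]⟩

end DiagForm

section SphereSubgaussian

variable {n : ℕ} [NeZero n] (w : OrthonormalBasis (Fin n) ℝ (EuclideanSpace ℝ (Fin n)))

lemma mgf_projSq_unifSphere_le (S : Finset (Fin n)) (t : ℝ) :
    mgf (projSq w S) (unifSphere n) t ≤ Real.exp (S.card / n * t + t ^ 2 / (4 * (n + 2))) := by
  have hn : (0 : ℝ) < n := Nat.cast_pos.2 (NeZero.pos n)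
  refine (mgf_le_of_beta_moments (continuous_projSq w S).aemeasurable
    (ae_norm_eq_one_unifSphere.mono fun v hv => projSq_mem_Icc_of_norm_eq_one w S hv)
    (half_pos hn) (integral_projSq_pow_succ_unifSphere w S) t).trans_eq ?_
  congr 1
  field_simp
  ring

lemma integrable_unifSphere_of_continuous {f : EuclideanSpace ℝ (Fin n) → ℝ} (hf : Continuous f) :
    Integrable f (unifSphere n) := by
  obtain ⟨C, hC⟩ := (isCompact_sphere (0 : EuclideanSpace ℝ (Fin n)) 1).exists_bound_of_continuousOn
    hf.continuousOn
  refine (integrable_const C).mono' hf.aestronglyMeasurable ?_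
  filter_upwards [ae_norm_eq_one_unifSphere] with v hv using hC v (by simpa using hv)

lemma integrable_exp_diagForm_sub (β : Fin n → ℝ) (t : ℝ) :
    Integrable (fun v => Real.exp (t * (diagForm w β v - (∑ j, β j) / n))) (unifSphere n) := by
  have := continuous_diagForm w β
  exact integrable_unifSphere_of_continuous (by fun_prop)

lemma convexOn_mgf_diagForm_sub (t : ℝ) :
    ConvexOn ℝ univ fun β : Fin n → ℝ =>
      mgf (fun v => diagForm w β v - (∑ j, β j) / n) (unifSphere n) t := by
  have hint (β : Fin n → ℝ) := integrable_exp_diagForm_sub w β t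
  refine ⟨convex_univ, fun β _ β' _ p q hp hq hpq => ?_⟩
  simp only [mgf, smul_eq_mul]
  rw [← integral_const_mul, ← integral_const_mul,
    ← integral_add ((hint β).const_mul p) ((hint β').const_mul q)]
  refine integral_mono (hint _) (((hint β).const_mul p).add ((hint β').const_mul q)) fun v => ?_
  refine Eq.trans_le ?_ (convexOn_exp.2 (mem_univ (t * (diagForm w β v - (∑ j, β j) / n)))
    (mem_univ (t * (diagForm w β' v - (∑ j, β' j) / n))) hp hq hpq)
  simp only [smul_eq_mul, diagForm_add_smul, Pi.add_apply, Pi.smul_apply, Finset.sum_add_distrib,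
    ← Finset.mul_sum]
  congr 1
  ring

lemma mgf_diagForm_indicator_sub_le (S : Finset (Fin n)) (t : ℝ) :
    mgf (fun v => diagForm w (indicator (S : Set (Fin n)) 1) v -
      (∑ j, indicator (S : Set (Fin n)) (1 : Fin n → ℝ) j) / n) (unifSphere n) t ≤
      Real.exp (t ^ 2 / (4 * (n + 2))) := by
  have hcard : ∑ j, indicator (S : Set (Fin n)) (1 : Fin n → ℝ) j = S.card := by
    simp [indicator_apply]
  simp_rw [diagForm_indicator_one, hcard, sub_eq_add_neg, mgf_add_const]
  refine (mul_le_mul_of_nonneg_right (mgf_projSq_unifSphere_le w S t)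
    (Real.exp_pos _).le).trans_eq ?_
  rw [← Real.exp_add]
  congr 1
  ring

/-- The moment generating function is convex in `β`, so it is largest at a vertex of the cube,
where the form is a squared projection. -/
lemma hasSubgaussianMGF_diagForm_sub {β : Fin n → ℝ} (hβ : ∀ j, β j ∈ Icc 0 1) :
    HasSubgaussianMGF (fun v => diagForm w β v - (∑ j, β j) / n) (1 / (2 * (n + 2)))
      (unifSphere n) := by
  refine ⟨integrable_exp_diagForm_sub w β, fun t => ?_⟩
  have hmem : β ∈ convexHull ℝ (univ.pi fun _ : Fin n => ({0, 1} : Set ℝ)) := by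
    rw [convexHull_pi, mem_univ_pi]
    intro j
    rw [convexHull_pair, segment_eq_Icc zero_le_one]
    exact hβ j
  obtain ⟨β', hβ', hle⟩ :=
    (convexOn_mgf_diagForm_sub w t).exists_ge_of_mem_convexHull (subset_univ _) hmem
  obtain ⟨S, rfl⟩ := exists_finset_eq_indicator_of_forall_mem_pair (mem_univ_pi.1 hβ')
  refine (hle.trans (mgf_diagForm_indicator_sub_le w S t)).trans_eq ?_
  congr 1
  push_cast
  field_simp
  norm_num

end SphereSubgaussian

/-! ### The weighted spectral measure of a real vector -/

section DiagFormOfSymmetric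

variable {n : ℕ} {E : Type*} [NormedAddCommGroup E] [InnerProductSpace ℝ E]

lemma diagForm_self {ι : Type*} [Fintype ι] (w : OrthonormalBasis ι ℝ E) (β : ι → ℝ) (j : ι) :
    diagForm w β (w j) = β j := by
  classical
  simp [diagForm, w.inner_eq_ite]

lemma inner_apply_self_eq_diagForm [FiniteDimensional ℝ E] {T : E →ₗ[ℝ] E} (hT : T.IsSymmetric)
    (hn : Module.finrank ℝ E = n) (v : E) :
    inner ℝ (T v) v = diagForm (hT.eigenvectorBasis hn) (hT.eigenvalues hn) v := by
  rw [← (hT.eigenvectorBasis hn).sum_inner_mul_inner (T v) v, diagForm]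
  refine Finset.sum_congr rfl fun j _ => ?_
  rw [hT v, hT.apply_eigenvectorBasis hn, inner_smul_right, real_inner_comm]
  simp only [RCLike.ofReal_real_eq_id, id]
  ring

end DiagFormOfSymmetric

section Spectral

variable {𝕜 : Type*} [RCLike 𝕜] {n : ℕ}

lemma norm_toField (v : EuclideanSpace ℝ (Fin n)) : ‖toField 𝕜 v‖ = ‖v‖ := by
  simp [toField, EuclideanSpace.norm_eq]

/-- The entrywise real part of a vector. -/
noncomputable def reVec (u : EuclideanSpace 𝕜 (Fin n)) : EuclideanSpace ℝ (Fin n) :=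
  WithLp.toLp 2 fun j => RCLike.re (u j)

/-- The entrywise imaginary part of a vector. -/
noncomputable def imVec (u : EuclideanSpace 𝕜 (Fin n)) : EuclideanSpace ℝ (Fin n) :=
  WithLp.toLp 2 fun j => RCLike.im (u j)

lemma norm_sq_reVec_add_norm_sq_imVec (u : EuclideanSpace 𝕜 (Fin n)) :
    ‖reVec u‖ ^ 2 + ‖imVec u‖ ^ 2 = ‖u‖ ^ 2 := by
  simp only [EuclideanSpace.norm_sq_eq, reVec, imVec, ← Finset.sum_add_distrib]
  refine Finset.sum_congr rfl fun j _ => ?_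
  rw [RCLike.norm_sq_eq_def (z := u j), Real.norm_eq_abs, Real.norm_eq_abs, sq_abs, sq_abs, sq, sq]

lemma norm_sq_inner_toField (v : EuclideanSpace ℝ (Fin n)) (u : EuclideanSpace 𝕜 (Fin n)) :
    ‖inner 𝕜 (toField 𝕜 v) u‖ ^ 2 = inner ℝ (reVec u) v ^ 2 + inner ℝ (imVec u) v ^ 2 := by
  rw [RCLike.norm_sq_eq_def]
  simp only [PiLp.inner_apply, toField, reVec, imVec, RCLike.inner_apply, map_sum]
  simp [sq, mul_comm]

lemma sum_norm_sq_inner_toField_basis {ι : Type*} [Fintype ι]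
    (w : OrthonormalBasis ι ℝ (EuclideanSpace ℝ (Fin n))) (u : EuclideanSpace 𝕜 (Fin n)) :
    ∑ j, ‖inner 𝕜 (toField 𝕜 (w j)) u‖ ^ 2 = ‖u‖ ^ 2 := by
  simp only [norm_sq_inner_toField, Finset.sum_add_distrib, ← norm_sq_reVec_add_norm_sq_imVec u,
    ← w.sum_sq_norm_inner_left, Real.norm_eq_abs, sq_abs]

variable {A : Matrix (Fin n) (Fin n) 𝕜} (hA : A.IsHermitian)

lemma lamMin_le (i : Fin n) : lamMin hA ≤ hA.eigenvalues i :=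
  ciInf_le (finite_range _).bddBelow i

lemma le_lamMax (i : Fin n) : hA.eigenvalues i ≤ lamMax hA :=
  le_ciSup (finite_range _).bddAbove i

lemma lamMin_le_lamMax [NeZero n] : lamMin hA ≤ lamMax hA :=
  (lamMin_le hA 0).trans (le_lamMax hA 0)

/-- The indices of the eigenvalues that are at most `x`. -/
noncomputable def eigIdx (x : ℝ) : Finset (Fin n) :=
  Finset.univ.filter fun i => hA.eigenvalues i ≤ x

lemma eigIdx_eq_empty {x : ℝ} (hx : x < lamMin hA) : eigIdx hA x = ∅ :=
  Finset.filter_eq_empty_iff.2 fun i _ => not_le.2 (hx.trans_le (lamMin_le hA i))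

lemma eigIdx_eq_univ {x : ℝ} (hx : lamMax hA ≤ x) : eigIdx hA x = Finset.univ :=
  Finset.filter_true_of_mem fun i _ => (le_lamMax hA i).trans hx

lemma exists_eigIdx_eigenvalues_eq [NeZero n] {x : ℝ} (hx : lamMin hA ≤ x) :
    ∃ i, eigIdx hA (hA.eigenvalues i) = eigIdx hA x := by
  obtain ⟨i₀, hi₀⟩ := exists_eq_ciInf_of_finite (f := hA.eigenvalues)
  obtain ⟨i, hi, hmax⟩ := (eigIdx hA x).exists_max_image hA.eigenvalues
    ⟨i₀, by simpa [eigIdx, hi₀, lamMin] using hx⟩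
  refine ⟨i, ?_⟩
  ext j
  simp only [eigIdx, Finset.mem_filter, Finset.mem_univ, true_and] at hi hmax ⊢
  exact ⟨fun h => h.trans hi, hmax j⟩

lemma cesm_eq_card (x : ℝ) : cesm hA x = (eigIdx hA x).card / n := by
  simp only [cesm, eigIdx, mul_ite, mul_one, mul_zero]
  rw [← Finset.sum_filter, Finset.sum_const, nsmul_eq_mul, mul_one_div]

lemma measurable_cesm : Measurable (cesm hA) :=
  Finset.measurable_sum _ fun _ _ =>
    (Measurable.ite measurableSet_Ici measurable_const measurable_const).const_mul _

lemma weightedSpectralMeasure_eq_atomicMeasure (v : EuclideanSpace ℝ (Fin n)) :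
    weightedSpectralMeasure hA v = atomicMeasure Finset.univ
      (fun i => ‖inner 𝕜 (toField 𝕜 v) (hA.eigenvectorBasis i)‖ ^ 2) hA.eigenvalues := rfl

instance (v : EuclideanSpace ℝ (Fin n)) : IsFiniteMeasure (weightedSpectralMeasure hA v) :=
  inferInstanceAs (IsFiniteMeasure (atomicMeasure _ _ _))

lemma weightedSpectralMeasure_compl_Icc {a b : ℝ} (ha : a ≤ lamMin hA) (hb : lamMax hA ≤ b)
    (v : EuclideanSpace ℝ (Fin n)) : weightedSpectralMeasure hA v (Icc a b)ᶜ = 0 :=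
  atomicMeasure_compl_Icc fun i _ => ⟨ha.trans (lamMin_le hA i), (le_lamMax hA i).trans hb⟩

lemma measureReal_Iic_weightedSpectralMeasure (v : EuclideanSpace ℝ (Fin n)) (x : ℝ) :
    (weightedSpectralMeasure hA v).real (Iic x) =
      ∑ i ∈ eigIdx hA x, ‖inner 𝕜 (toField 𝕜 v) (hA.eigenvectorBasis i)‖ ^ 2 := by
  rw [← integral_indicator_one measurableSet_Iic, weightedSpectralMeasure_eq_atomicMeasure,
    integral_atomicMeasure (fun i _ => by positivity), eigIdx, Finset.sum_filter]
  simp only [indicator_apply, mem_Iic, Pi.one_apply, ite_mul, one_mul, zero_mul]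

lemma sum_norm_sq_inner_toField_eigenvectorBasis (v : EuclideanSpace ℝ (Fin n)) :
    ∑ i, ‖inner 𝕜 (toField 𝕜 v) (hA.eigenvectorBasis i)‖ ^ 2 = ‖v‖ ^ 2 := by
  rw [hA.eigenvectorBasis.sum_sq_norm_inner_left, norm_toField]

lemma measureReal_Iic_weightedSpectralMeasure_of_lamMax_le {x : ℝ} (hx : lamMax hA ≤ x)
    (v : EuclideanSpace ℝ (Fin n)) : (weightedSpectralMeasure hA v).real (Iic x) = ‖v‖ ^ 2 := by
  rw [measureReal_Iic_weightedSpectralMeasure, eigIdx_eq_univ hA hx,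
    sum_norm_sq_inner_toField_eigenvectorBasis]

lemma isProbabilityMeasure_weightedSpectralMeasure {v : EuclideanSpace ℝ (Fin n)} (hv : ‖v‖ = 1) :
    IsProbabilityMeasure (weightedSpectralMeasure hA v) := by
  have hint := integral_atomicMeasure (I := Finset.univ) (x := hA.eigenvalues)
    (fun i _ => sq_nonneg ‖inner 𝕜 (toField 𝕜 v) (hA.eigenvectorBasis i)‖) fun _ => 1
  simp only [one_mul, sum_norm_sq_inner_toField_eigenvectorBasis, hv, one_pow, integral_const,
    smul_eq_mul, mul_one] at hint
  exact isProbabilityMeasure_iff_real.2 hint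

/-- The real part of the orthogonal projection to the span of the eigenvectors whose eigenvalues
are at most `x`, as an operator on `ℝⁿ`. -/
noncomputable def reSpectralProj (x : ℝ) :
    EuclideanSpace ℝ (Fin n) →ₗ[ℝ] EuclideanSpace ℝ (Fin n) :=
  ∑ i ∈ eigIdx hA x, ((InnerProductSpace.rankOne ℝ (reVec (hA.eigenvectorBasis i))
      (reVec (hA.eigenvectorBasis i))).toLinearMap +
    (InnerProductSpace.rankOne ℝ (imVec (hA.eigenvectorBasis i))
      (imVec (hA.eigenvectorBasis i))).toLinearMap)

lemma isSymmetric_reSpectralProj (x : ℝ) : (reSpectralProj hA x).IsSymmetric :=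
  LinearMap.isSymmetric_sum _ fun _ _ =>
    (InnerProductSpace.isSymmetric_rankOne_self _).add
      (InnerProductSpace.isSymmetric_rankOne_self _)

lemma inner_reSpectralProj_self (x : ℝ) (v : EuclideanSpace ℝ (Fin n)) :
    inner ℝ (reSpectralProj hA x v) v = (weightedSpectralMeasure hA v).real (Iic x) := by
  simp only [measureReal_Iic_weightedSpectralMeasure, norm_sq_inner_toField]
  simp [reSpectralProj, LinearMap.sum_apply, sum_inner, inner_add_left, inner_smul_left, sq]

lemma exists_measureReal_Iic_weightedSpectralMeasure_eq_diagForm (x : ℝ) :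
    ∃ (w : OrthonormalBasis (Fin n) ℝ (EuclideanSpace ℝ (Fin n))) (β : Fin n → ℝ),
      (∀ j, β j ∈ Icc 0 1) ∧ ∑ j, β j = (eigIdx hA x).card ∧
      ∀ v, (weightedSpectralMeasure hA v).real (Iic x) = diagForm w β v := by
  set T := isSymmetric_reSpectralProj hA x
  set w := T.eigenvectorBasis finrank_euclideanSpace_fin
  set β := T.eigenvalues finrank_euclideanSpace_fin
  have hform (v : EuclideanSpace ℝ (Fin n)) :
      (weightedSpectralMeasure hA v).real (Iic x) = diagForm w β v := by
    rw [← inner_reSpectralProj_self, inner_apply_self_eq_diagForm T finrank_euclideanSpace_fin]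
  have hβ (j : Fin n) : β j = (weightedSpectralMeasure hA (w j)).real (Iic x) := by
    rw [hform, diagForm_self]
  refine ⟨w, β, fun j => ?_, ?_, hform⟩
  · have := isProbabilityMeasure_weightedSpectralMeasure hA (w.norm_eq_one j)
    rw [hβ]
    exact ⟨measureReal_nonneg, measureReal_le_one⟩
  · simp only [hβ, measureReal_Iic_weightedSpectralMeasure]
    rw [Finset.sum_comm]
    simp only [sum_norm_sq_inner_toField_basis, OrthonormalBasis.norm_eq_one, one_pow,
      Finset.sum_const, nsmul_eq_mul, mul_one]

lemma continuous_measureReal_Iic_weightedSpectralMeasure (x : ℝ) :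
    Continuous fun v => (weightedSpectralMeasure hA v).real (Iic x) := by
  obtain ⟨w, β, -, -, hform⟩ := exists_measureReal_Iic_weightedSpectralMeasure_eq_diagForm hA x
  simp_rw [hform]
  exact continuous_diagForm w β

lemma hasSubgaussianMGF_measureReal_Iic_weightedSpectralMeasure [NeZero n] (x : ℝ) :
    HasSubgaussianMGF (fun v => (weightedSpectralMeasure hA v).real (Iic x) - cesm hA x)
      (1 / (2 * (n + 2))) (unifSphere n) := by
  obtain ⟨w, β, hβ, hsum, hform⟩ :=
    exists_measureReal_Iic_weightedSpectralMeasure_eq_diagForm hA x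
  simp_rw [hform, cesm_eq_card, ← hsum]
  exact hasSubgaussianMGF_diagForm_sub w hβ

end Spectral

/-! ### Concentration of the averaged weighted spectral measures -/

section Concentration

lemma measureReal_le_abs_of_hasSubgaussianMGF {Ω : Type*} [MeasurableSpace Ω] {P : Measure Ω}
    {X : Ω → ℝ} {c : ℝ≥0} (h : HasSubgaussianMGF X c P) {t : ℝ} (ht : 0 ≤ t) :
    P.real {ω | t ≤ |X ω|} ≤ 2 * Real.exp (-t ^ 2 / (2 * c)) := by
  have hsplit : {ω | t ≤ |X ω|} = {ω | t ≤ X ω} ∪ {ω | t ≤ (-X) ω} := by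
    ext ω
    simp only [mem_ofPred_eq, mem_union, Pi.neg_apply, le_abs]
  rw [hsplit, two_mul]
  exact (measureReal_union_le _ _).trans (add_le_add (h.measure_ge_le ht) (h.neg.measure_ge_le ht))

variable {𝕜 : Type*} [RCLike 𝕜] {n N : ℕ} {A : Matrix (Fin n) (Fin n) 𝕜} (hA : A.IsHermitian)

/-- The average `⟨Ψ_ℓ⟩` of the weighted CESMs of the vectors `v_ℓ`. -/
noncomputable def avgCDF (v : Fin N → EuclideanSpace ℝ (Fin n)) : ℝ → ℝ :=
  average fun l x => (weightedSpectralMeasure hA (v l)).real (Iic x)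

lemma avgCDF_eq_of_eigIdx_eq (v : Fin N → EuclideanSpace ℝ (Fin n)) {x y : ℝ}
    (h : eigIdx hA x = eigIdx hA y) : avgCDF hA v x = avgCDF hA v y := by
  simp only [avgCDF, average, measureReal_Iic_weightedSpectralMeasure, h]

variable {Ω : Type*} [MeasurableSpace Ω] {P : Measure Ω} {v : Fin N → Ω → EuclideanSpace ℝ (Fin n)}

lemma ae_norm_eq_one (hlaw : ∀ l, HasLaw (v l) (unifSphere n) P) :
    ∀ᵐ ω ∂P, ∀ l, ‖v l ω‖ = 1 :=
  ae_all_iff.2 fun l =>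
    ae_of_ae_map (hlaw l).aemeasurable ((hlaw l).map_eq ▸ ae_norm_eq_one_unifSphere)

variable [NeZero n] [NeZero N]

lemma avgCDF_eq_cesm_of_notMem_Ico {v : Fin N → EuclideanSpace ℝ (Fin n)} (hv : ∀ l, ‖v l‖ = 1)
    {x : ℝ} (hx : x ∉ Ico (lamMin hA) (lamMax hA)) : avgCDF hA v x = cesm hA x := by
  rcases lt_or_ge x (lamMin hA) with hlt | hge
  · simp [avgCDF, average, measureReal_Iic_weightedSpectralMeasure, cesm_eq_card,
      eigIdx_eq_empty hA hlt]
  · have hmax : lamMax hA ≤ x := not_lt.1 fun h => hx ⟨hge, h⟩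
    simp [avgCDF, average, measureReal_Iic_weightedSpectralMeasure_of_lamMax_le hA hmax, hv,
      cesm_eq_card, eigIdx_eq_univ hA hmax]

lemma wassersteinDist_cesm_avgCDF_le {v : Fin N → EuclideanSpace ℝ (Fin n)}
    (hv : ∀ l, ‖v l‖ = 1) {t : ℝ}
    (h : ∀ i, |avgCDF hA v (hA.eigenvalues i) - cesm hA (hA.eigenvalues i)| ≤ t) :
    wassersteinDist (cesm hA) (avgCDF hA v) ≤ ENNReal.ofReal (t * (lamMax hA - lamMin hA)) := by
  rw [ENNReal.ofReal_mul ((abs_nonneg _).trans (h 0)), ← Real.volume_Ico,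
    ← lintegral_indicator_const measurableSet_Ico]
  refine lintegral_mono fun x => ?_
  by_cases hx : x ∈ Ico (lamMin hA) (lamMax hA)
  · obtain ⟨i, hi⟩ := exists_eigIdx_eigenvalues_eq hA hx.1
    have hi' := h i
    rw [avgCDF_eq_of_eigIdx_eq hA v hi, cesm_eq_card, hi, ← cesm_eq_card] at hi'
    rw [indicator_of_mem hx, abs_sub_comm]
    exact ENNReal.ofReal_le_ofReal hi'
  · simp [avgCDF_eq_cesm_of_notMem_Ico hA hv hx]

lemma wassersteinDist_cesm_avgCDF_eq_zero {v : Fin N → EuclideanSpace ℝ (Fin n)}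
    (hv : ∀ l, ‖v l‖ = 1) (h : lamMin hA = lamMax hA) :
    wassersteinDist (cesm hA) (avgCDF hA v) = 0 := by
  simp [wassersteinDist, avgCDF_eq_cesm_of_notMem_Ico hA hv, h]

lemma hasSubgaussianMGF_avgCDF_sub_cesm (hindep : iIndepFun v P)
    (hlaw : ∀ l, HasLaw (v l) (unifSphere n) P) (x : ℝ) :
    HasSubgaussianMGF (fun ω => avgCDF hA (fun l => v l ω) x - cesm hA x)
      (1 / (2 * N * (n + 2))) P := by
  set Y : EuclideanSpace ℝ (Fin n) → ℝ :=
    fun u => (weightedSpectralMeasure hA u).real (Iic x) - cesm hA x with hY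
  have hmeas : Measurable Y :=
    ((continuous_measureReal_Iic_weightedSpectralMeasure hA x).sub continuous_const).measurable
  have hsub (l : Fin N) : HasSubgaussianMGF (Y ∘ v l) (1 / (2 * (n + 2))) P :=
    .of_map (hlaw l).aemeasurable <|
      (hlaw l).map_eq ▸ hasSubgaussianMGF_measureReal_Iic_weightedSpectralMeasure hA x
  have hsum := (HasSubgaussianMGF.sum_of_iIndepFun (hindep.comp _ fun _ => hmeas)
    (s := Finset.univ) fun l _ => hsub l).const_mul (N : ℝ)⁻¹
  have hN : (N : ℝ) ≠ 0 := NeZero.ne _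
  convert hsum using 1
  · funext ω
    simp only [hY, avgCDF, average, Function.comp_apply, Finset.sum_sub_distrib, Finset.sum_const,
      Finset.card_univ, Fintype.card_fin, nsmul_eq_mul, mul_sub, inv_mul_cancel_left₀ hN]
  · ext
    change _ = (N : ℝ)⁻¹ ^ 2 * ((∑ _l : Fin N, 1 / (2 * (n + 2)) : ℝ≥0) : ℝ)
    push_cast
    simp only [Finset.sum_const, Finset.card_univ, Fintype.card_fin, nsmul_eq_mul]
    field_simp

lemma measure_le_abs_avgCDF_sub_cesm (hindep : iIndepFun v P)
    (hlaw : ∀ l, HasLaw (v l) (unifSphere n) P) (x : ℝ) {t : ℝ} (ht : 0 ≤ t) :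
    P {ω | t ≤ |avgCDF hA (fun l => v l ω) x - cesm hA x|} ≤
      ENNReal.ofReal (2 * Real.exp (-(N * (n + 2) * t ^ 2))) := by
  have := hindep.isProbabilityMeasure
  have htail := measureReal_le_abs_of_hasSubgaussianMGF
    (hasSubgaussianMGF_avgCDF_sub_cesm hA hindep hlaw x) ht
  rw [← ofReal_measureReal]
  refine ENNReal.ofReal_le_ofReal (htail.trans_eq ?_)
  congr 2
  push_cast
  have hN : (N : ℝ) ≠ 0 := NeZero.ne _
  field_simp

lemma measure_exists_le_abs_avgCDF_sub_cesm (hindep : iIndepFun v P)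
    (hlaw : ∀ l, HasLaw (v l) (unifSphere n) P) (hlt : lamMin hA < lamMax hA) {ε : ℝ}
    (hε : 0 ≤ ε) :
    P {ω | ∃ i, ε / (2 * (lamMax hA - lamMin hA)) ≤
        |avgCDF hA (fun l => v l ω) (hA.eigenvalues i) - cesm hA (hA.eigenvalues i)|} ≤
      ENNReal.ofReal (failureBound n N (lamMax hA - lamMin hA) ε) := by
  have hw : 0 < lamMax hA - lamMin hA := sub_pos.2 hlt
  set w := lamMax hA - lamMin hA
  have htail (x : ℝ) := measure_le_abs_avgCDF_sub_cesm hA hindep hlaw x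
    (t := ε / (2 * w)) (by positivity)
  rw [ofPred_exists]
  refine (measure_iUnion_fintype_le _ _).trans
    ((Finset.sum_le_sum fun i _ => htail (hA.eigenvalues i)).trans_eq ?_)
  rw [Finset.sum_const, Finset.card_univ, Fintype.card_fin, nsmul_eq_mul, failureBound,
    if_neg hw.ne', ← ENNReal.ofReal_natCast, ← ENNReal.ofReal_mul (by positivity)]
  congr 1
  rw [div_pow, mul_pow, mul_div_assoc]
  norm_num
  ring

lemma measure_le_failureBound (hindep : iIndepFun v P)
    (hlaw : ∀ l, HasLaw (v l) (unifSphere n) P) {ε : ℝ} (hε : 0 < ε) {B : Set Ω}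
    (hB : ∀ ω ∈ B, (∀ l, ‖v l ω‖ = 1) →
      ENNReal.ofReal (ε / 2) < wassersteinDist (cesm hA) (avgCDF hA fun l => v l ω)) :
    P B ≤ ENNReal.ofReal (failureBound n N (lamMax hA - lamMin hA) ε) := by
  rcases (lamMin_le_lamMax hA).eq_or_lt with heq | hlt
  · have hnull : P B = 0 := measure_eq_zero_iff_ae_notMem.2 <| by
      filter_upwards [ae_norm_eq_one hlaw] with ω hv hω
      exact not_lt_zero ((hB ω hω hv).trans_eq (wassersteinDist_cesm_avgCDF_eq_zero hA hv heq))
    exact hnull.trans_le zero_le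
  · refine (measure_mono_ae ?_).trans
      (measure_exists_le_abs_avgCDF_sub_cesm hA hindep hlaw hlt hε.le)
    filter_upwards [ae_norm_eq_one hlaw] with ω hv hω
    change ∃ i, _ ≤ _
    by_contra! hfar
    have hnear := wassersteinDist_cesm_avgCDF_le hA hv fun i => (hfar i).le
    have hw : lamMax hA - lamMin hA ≠ 0 := (sub_pos.2 hlt).ne'
    rw [← div_div, div_mul_cancel₀ _ hw] at hnear
    exact (hB ω hω hv).not_ge hnear

end Concentration

/-! ### Averages of quadrature approximations -/

section Average

lemma wassersteinDist_triangle {f g h : ℝ → ℝ} (hf : Measurable f) (hg : Measurable g) :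
    wassersteinDist f h ≤ wassersteinDist f g + wassersteinDist g h := by
  simp only [wassersteinDist]
  rw [← lintegral_add_left (by fun_prop)]
  refine lintegral_mono fun x => ?_
  rw [← ENNReal.ofReal_add (abs_nonneg _) (abs_nonneg _)]
  exact ENNReal.ofReal_le_ofReal (abs_sub_le _ _ _)

variable {N : ℕ}

lemma ofReal_abs_average_sub_le (f g : Fin N → ℝ → ℝ) (x : ℝ) :
    ENNReal.ofReal |average f x - average g x| ≤
      (N : ℝ≥0∞)⁻¹ * ∑ l, ENNReal.ofReal |f l x - g l x| := by
  rcases N.eq_zero_or_pos with rfl | hN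
  · simp [average]
  have hpos : (0 : ℝ) < N := Nat.cast_pos.2 hN
  rw [average, average, ← mul_sub, ← Finset.sum_sub_distrib, abs_mul, abs_of_pos (inv_pos.2 hpos),
    ENNReal.ofReal_mul (inv_nonneg.2 hpos.le), ENNReal.ofReal_inv_of_pos hpos,
    ENNReal.ofReal_natCast, ← ENNReal.ofReal_sum_of_nonneg fun l _ => abs_nonneg _]
  gcongr
  exact Finset.abs_sum_le_sum_abs _ _

lemma wassersteinDist_average_le {f g : Fin N → ℝ → ℝ} (hf : ∀ l, Measurable (f l))
    (hg : ∀ l, Measurable (g l)) {C : ℝ≥0∞} (h : ∀ l, wassersteinDist (f l) (g l) ≤ C) :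
    wassersteinDist (average f) (average g) ≤ C :=
  calc wassersteinDist (average f) (average g)
      ≤ ∫⁻ x, (N : ℝ≥0∞)⁻¹ * ∑ l, ENNReal.ofReal |f l x - g l x| :=
        lintegral_mono fun x => ofReal_abs_average_sub_le f g x
    _ = (N : ℝ≥0∞)⁻¹ * ∑ l, wassersteinDist (f l) (g l) := by
        rw [lintegral_const_mul _ (by fun_prop), lintegral_finsetSum _ (by fun_prop)]
        rfl
    _ ≤ (N : ℝ≥0∞)⁻¹ * ∑ _l : Fin N, C := by
        gcongr with l
        exact h l
    _ ≤ C := by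
        rw [Finset.sum_const, Finset.card_univ, Fintype.card_fin, nsmul_eq_mul, ← mul_assoc]
        exact mul_le_of_le_one_left' (ENNReal.inv_mul_le_one _)

/-- The equal-weight mixture of `N` measures, whose distribution function is the `average` of
theirs. -/
noncomputable def avgMeasure (ν : Fin N → Measure ℝ) : Measure ℝ := (N : ℝ≥0∞)⁻¹ • ∑ l, ν l

variable {ν : Fin N → Measure ℝ}

lemma integral_avgMeasure {f : ℝ → ℝ} (hf : ∀ l, Integrable f (ν l)) :
    ∫ x, f x ∂avgMeasure ν = (N : ℝ)⁻¹ * ∑ l, ∫ x, f x ∂ν l := by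
  rw [avgMeasure, integral_smul_measure, integral_finsetSum_measure fun l _ => hf l,
    ENNReal.toReal_inv, ENNReal.toReal_natCast, smul_eq_mul]

lemma average_inducedQuad (h : ∀ l, PolyIntegrable (ν l)) (op : (ℝ → ℝ) → ℝ[X]) :
    (average fun l => inducedQuad op (ν l)) = inducedQuad op (avgMeasure ν) := by
  funext x
  exact (integral_avgMeasure fun l => h l _).symm

lemma avgMeasure_compl_Icc {a b : ℝ} (hν : ∀ l, ν l (Icc a b)ᶜ = 0) :
    avgMeasure ν (Icc a b)ᶜ = 0 := by
  simp [avgMeasure, hν]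

lemma isProbabilityMeasure_avgMeasure [NeZero N] [∀ l, IsProbabilityMeasure (ν l)] :
    IsProbabilityMeasure (avgMeasure ν) := by
  refine ⟨?_⟩
  have hN : (N : ℝ≥0∞) ≠ 0 := NeZero.ne _
  simp [avgMeasure, ENNReal.inv_mul_cancel hN]

lemma average_measureReal_Iic [NeZero N] [∀ l, IsProbabilityMeasure (ν l)] :
    (average fun l x => (ν l).real (Iic x)) = cdf (avgMeasure ν) := by
  have := isProbabilityMeasure_avgMeasure (ν := ν)
  funext x
  rw [cdf_eq_real, ← integral_indicator_one measurableSet_Iic,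
    integral_avgMeasure (f := (Iic x).indicator 1) fun l =>
      (integrable_const (1 : ℝ)).indicator measurableSet_Iic]
  simp only [average, integral_indicator_one measurableSet_Iic]

lemma measurable_measureReal_Iic (κ : Measure ℝ) [IsFiniteMeasure κ] :
    Measurable fun x => κ.real (Iic x) :=
  Monotone.measurable fun _ _ h => measureReal_mono (Iic_subset_Iic.2 h)

lemma quadGauss_eq_measureReal_gaussMeasure {κ : Measure ℝ} (h : PolyIntegrable κ) (k : ℕ) :
    quadGauss k κ = fun x => (gaussMeasure κ k).real (Iic x) := by
  funext x
  rw [← integral_indicator_one measurableSet_Iic, integral_gaussMeasure h]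
  rfl

end Average

/-! ### Deterministic error bounds -/

section Deterministic

variable {𝕜 : Type*} [RCLike 𝕜] {n N : ℕ} {A : Matrix (Fin n) (Fin n) 𝕜} (hA : A.IsHermitian)

lemma measurable_avgCDF (v : Fin N → EuclideanSpace ℝ (Fin n)) : Measurable (avgCDF hA v) :=
  (Finset.measurable_sum _ fun _ _ => measurable_measureReal_Iic _).const_mul _

lemma protoOutput_inducedQuad (op : (ℝ → ℝ) → ℝ[X]) (v : Fin N → EuclideanSpace ℝ (Fin n)) :
    protoOutput hA (inducedQuad op) v =
      inducedQuad op (avgMeasure fun l => weightedSpectralMeasure hA (v l)) :=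
  average_inducedQuad (fun l => polyIntegrable_of_compl_Icc
    (weightedSpectralMeasure_compl_Icc hA le_rfl le_rfl (v l))) op

variable {v : Fin N → EuclideanSpace ℝ (Fin n)}

lemma lt_wassersteinDist_avgCDF {f : ℝ → ℝ} {ε : ℝ} (hε : 0 < ε)
    (hf : wassersteinDist (avgCDF hA v) f ≤ ENNReal.ofReal (ε / 2))
    (h : ENNReal.ofReal ε < wassersteinDist (cesm hA) f) :
    ENNReal.ofReal (ε / 2) < wassersteinDist (cesm hA) (avgCDF hA v) := by
  by_contra! hnear
  refine h.not_ge ?_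
  calc wassersteinDist (cesm hA) f
      ≤ wassersteinDist (cesm hA) (avgCDF hA v) + wassersteinDist (avgCDF hA v) f :=
        wassersteinDist_triangle (measurable_cesm hA) (measurable_avgCDF hA v)
    _ ≤ ENNReal.ofReal (ε / 2) + ENNReal.ofReal (ε / 2) := add_le_add hnear hf
    _ = ENNReal.ofReal ε := by
        rw [← ENNReal.ofReal_add (by positivity) (by positivity), add_halves]

section Bounds

variable (hv : ∀ l, ‖v l‖ = 1) {a b : ℝ} (ha : a ≤ lamMin hA) (hb : lamMax hA ≤ b) {s : ℕ}
include hv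

lemma wassersteinDist_avgCDF_protoOutput_quadGauss_le [NeZero n] {k : ℕ} (hk : 1 ≤ k) :
    wassersteinDist (avgCDF hA v) (protoOutput hA (quadGauss k) v) ≤
      ENNReal.ofReal (π * (lamMax hA - lamMin hA) / (2 * k)) := by
  have hsupp (l : Fin N) := weightedSpectralMeasure_compl_Icc hA le_rfl le_rfl (v l)
  have (l : Fin N) := isProbabilityMeasure_weightedSpectralMeasure hA (hv l)
  refine wassersteinDist_average_le (fun l => measurable_measureReal_Iic _) (fun l => ?_)
    fun l => ?_
  · rw [quadGauss_eq_measureReal_gaussMeasure (polyIntegrable_of_compl_Icc (hsupp l))]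
    exact measurable_measureReal_Iic _
  · simpa only [wassersteinDist, cdf_eq_real] using
      wassersteinDist_quadGauss_le (lamMin_le_lamMax hA) (hsupp l) hk

variable [NeZero N]

lemma avgCDF_eq_cdf_avgMeasure :
    avgCDF hA v = cdf (avgMeasure fun l => weightedSpectralMeasure hA (v l)) :=
  have (l : Fin N) := isProbabilityMeasure_weightedSpectralMeasure hA (hv l)
  average_measureReal_Iic

include ha hb

lemma wassersteinDist_avgCDF_protoOutput_le {op : (ℝ → ℝ) → ℝ[X]}
    {C : (ℝ → ℝ) → ℝ≥0∞}
    (hop : ∀ (ν : Measure ℝ) [IsProbabilityMeasure ν], ν (Icc a b)ᶜ = 0 →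
      wassersteinDist (cdf ν) (inducedQuad op ν) ≤ C (inducedQuad op ν)) :
    wassersteinDist (avgCDF hA v) (protoOutput hA (inducedQuad op) v) ≤
      C (protoOutput hA (inducedQuad op) v) := by
  have (l : Fin N) := isProbabilityMeasure_weightedSpectralMeasure hA (hv l)
  have := isProbabilityMeasure_avgMeasure (ν := fun l => weightedSpectralMeasure hA (v l))
  rw [avgCDF_eq_cdf_avgMeasure hA hv, protoOutput_inducedQuad]
  exact hop _ (avgMeasure_compl_Icc fun l => weightedSpectralMeasure_compl_Icc hA ha hb (v l))

lemma wassersteinDist_avgCDF_protoOutput_le_totalVar [NeZero n] {μ : Measure ℝ}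
    [IsProbabilityMeasure μ]
    (hμ : μ (Icc a b)ᶜ = 0) (hs : (s : ℕ∞) + 1 ≤ μ.support.encard)
    {Q : ℕ → Measure ℝ → ℝ → ℝ} (hQ : Q = quadInterp μ ∨ Q = quadApprox μ) :
    wassersteinDist (avgCDF hA v) (protoOutput hA (Q s) v) ≤
      ENNReal.ofReal (π * (b - a) / (2 * (s + 2))) *
        (1 + totalVar (protoOutput hA (Q s) v)) := by
  have hab : a ≤ b := ha.trans ((lamMin_le_lamMax hA).trans hb)
  have hpoly := polyIntegrable_of_compl_Icc hμ
  have hnd : OrthNondeg μ (s + 1) := orthNondeg_of_encard_support_le hpoly (by exact_mod_cast hs)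
  rcases hQ with rfl | rfl
  · exact wassersteinDist_avgCDF_protoOutput_le hA hv ha hb (op := opInterp μ s)
      (C := fun Υ => _ * (1 + totalVar Υ)) fun _ _ hν =>
        wassersteinDist_quadInterp_le hab hpoly hμ hν hnd
  · exact wassersteinDist_avgCDF_protoOutput_le hA hv ha hb (op := opApprox μ s)
      (C := fun Υ => _ * (1 + totalVar Υ)) fun _ _ hν =>
        wassersteinDist_quadApprox_le hab hμ hν hnd

lemma wassersteinDist_avgCDF_protoOutput_quadDamped_le (hab : a < b)
    {Q : ℕ → Measure ℝ → ℝ → ℝ} (hQ : Q = quadDampedInterp a b ∨ Q = quadDampedApprox a b) :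
    wassersteinDist (avgCDF hA v) (protoOutput hA (Q s) v) ≤
      ENNReal.ofReal (π * (b - a) / (2 * (s + 2))) := by
  rcases hQ with rfl | rfl
  · exact wassersteinDist_avgCDF_protoOutput_le hA hv ha hb
      (op := opDampedInterp (chebMeasure a b) s) (C := fun _ => _) fun _ _ hν =>
        wassersteinDist_quadDampedInterp_le hab hν s
  · exact wassersteinDist_avgCDF_protoOutput_le hA hv ha hb
      (op := opDampedApprox (chebMeasure a b) s) (C := fun _ => _) fun _ _ hν =>
        wassersteinDist_quadDampedApprox_le hab hν s

end Bounds

section Thresholds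

variable {c ε : ℝ} (hε : 0 < ε) {s : ℕ}
include hε

lemma div_two_mul_le_half {r : ℝ} (hr : 0 < r) (h : c * ε⁻¹ ≤ r) : c / (2 * r) ≤ ε / 2 := by
  rw [← div_eq_mul_inv, div_le_iff₀ hε] at h
  rw [div_le_div_iff₀ (by positivity) two_pos]
  linarith

lemma gauss_rate_le_half {k : ℕ} (hk : 1 ≤ k) (h : -1 + 2 * π * c * ε⁻¹ ≤ 2 * (k : ℝ) - 1) :
    π * c / (2 * k) ≤ ε / 2 :=
  div_two_mul_le_half hε (Nat.cast_pos.2 hk) (by linarith)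

lemma damped_rate_le_half (hc : 0 ≤ c) (h : -2 + π ^ 2 * c * ε⁻¹ ≤ s) :
    π * c / (2 * (s + 2)) ≤ ε / 2 := by
  refine div_two_mul_le_half hε (by positivity) ?_
  have hπ : π * c * ε⁻¹ ≤ π * (π * c * ε⁻¹) :=
    le_mul_of_one_le_left (by positivity) (by linarith [Real.pi_gt_three])
  linarith

lemma totalVar_rate_le_half {T : ℝ≥0∞} (h : ENNReal.ofReal (c * ε⁻¹) * T ≤ (s : ℝ≥0∞) + 1) :
    ENNReal.ofReal (c / (2 * (s + 2))) * T ≤ ENNReal.ofReal (ε / 2) := by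
  have hsplit : c / (2 * (s + 2)) = ε / (2 * (s + 2)) * (c * ε⁻¹) := by field_simp
  have hcast : (s : ℝ≥0∞) + 1 = ENNReal.ofReal (s + 1) := by
    rw [ENNReal.ofReal_add (by positivity) zero_le_one, ENNReal.ofReal_natCast, ENNReal.ofReal_one]
  rw [hsplit, ENNReal.ofReal_mul (by positivity), mul_assoc]
  refine (mul_le_mul_right h _).trans ?_
  rw [hcast, ← ENNReal.ofReal_mul (by positivity)]
  refine ENNReal.ofReal_le_ofReal ?_
  rw [div_mul_eq_mul_div, div_le_div_iff₀ (by positivity) two_pos]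
  nlinarith

end Thresholds

end Deterministic

end RandQuad

theorem mainTheorem1 {𝕜 : Type*} [RCLike 𝕜] {n : ℕ} (hn : 0 < n)
    (A : Matrix (Fin n) (Fin n) 𝕜) (hA : A.IsHermitian)
    {Ω : Type*} [MeasurableSpace Ω] (P : Measure Ω) [IsProbabilityMeasure P]
    {N : ℕ} (hN : 0 < N) (v : Fin N → Ω → EuclideanSpace ℝ (Fin n))
    (hindep : iIndepFun v P) (hlaw : ∀ l, HasLaw (v l) (RandQuad.unifSphere n) P)
    (ε : ℝ) (hε : 0 < ε) :
    -- Gaussian quadrature, of degree `s = 2k - 1`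
    (∀ k : ℕ, 1 ≤ k →
      -1 + 2 * Real.pi * (RandQuad.lamMax hA - RandQuad.lamMin hA) * ε⁻¹ ≤ 2 * (k : ℝ) - 1 →
      P {ω | ENNReal.ofReal ε < RandQuad.wassersteinDist (RandQuad.cesm hA)
          (RandQuad.protoOutput hA (RandQuad.quadGauss k) fun l => v l ω)} ≤
        ENNReal.ofReal
          (RandQuad.failureBound n N (RandQuad.lamMax hA - RandQuad.lamMin hA) ε)) ∧
    -- quadrature by interpolation and by approximation, `μ` arbitrary; the degree `s` and the
    -- threshold may depend on the sample
    (∀ (a b : ℝ), a ≤ RandQuad.lamMin hA → RandQuad.lamMax hA ≤ b →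
      ∀ (μ : Measure ℝ) [IsProbabilityMeasure μ], μ (Set.Icc a b)ᶜ = 0 →
      ∀ s : Ω → ℕ, (∀ ω, (s ω : ℕ∞) + 1 ≤ μ.support.encard) →
      ∀ Q : ℕ → Measure ℝ → ℝ → ℝ, (Q = RandQuad.quadInterp μ ∨ Q = RandQuad.quadApprox μ) →
      P {ω |
          ENNReal.ofReal (Real.pi * (b - a) * ε⁻¹) *
              (1 + RandQuad.totalVar (RandQuad.protoOutput hA (Q (s ω)) fun l => v l ω)) ≤
            (s ω : ℝ≥0∞) + 1 ∧
          ENNReal.ofReal ε < RandQuad.wassersteinDist (RandQuad.cesm hA)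
            (RandQuad.protoOutput hA (Q (s ω)) fun l => v l ω)} ≤
        ENNReal.ofReal
          (RandQuad.failureBound n N (RandQuad.lamMax hA - RandQuad.lamMin hA) ε)) ∧
    -- Jackson-damped quadrature for the Chebyshev distribution on `[a, b]`
    (∀ (a b : ℝ), a < b → a ≤ RandQuad.lamMin hA → RandQuad.lamMax hA ≤ b →
      ∀ s : ℕ, -2 + Real.pi ^ 2 * (b - a) * ε⁻¹ ≤ (s : ℝ) →
      ∀ Q : ℕ → Measure ℝ → ℝ → ℝ,
        (Q = RandQuad.quadDampedInterp a b ∨ Q = RandQuad.quadDampedApprox a b) →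
      P {ω | ENNReal.ofReal ε < RandQuad.wassersteinDist (RandQuad.cesm hA)
          (RandQuad.protoOutput hA (Q s) fun l => v l ω)} ≤
        ENNReal.ofReal
          (RandQuad.failureBound n N (RandQuad.lamMax hA - RandQuad.lamMin hA) ε)) := by
  have : NeZero n := ⟨hn.ne'⟩
  have : NeZero N := ⟨hN.ne'⟩
  refine ⟨fun k hk hs => ?_, fun a b ha hb μ _ hμ s hs Q hQ => ?_,
    fun a b hab ha hb s hs Q hQ => ?_⟩ <;>
    refine RandQuad.measure_le_failureBound hA hindep hlaw hε fun ω hω hv => ?_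
  · have hrate := RandQuad.gauss_rate_le_half hε hk hs
    have hquad := RandQuad.wassersteinDist_avgCDF_protoOutput_quadGauss_le hA hv hk
    exact RandQuad.lt_wassersteinDist_avgCDF hA hε
      (hquad.trans (ENNReal.ofReal_le_ofReal hrate)) hω
  · have hrate := RandQuad.totalVar_rate_le_half hε hω.1
    have hquad :=
      RandQuad.wassersteinDist_avgCDF_protoOutput_le_totalVar hA hv ha hb hμ (hs ω) hQ
    exact RandQuad.lt_wassersteinDist_avgCDF hA hε (hquad.trans hrate) hω.2
  · have hrate := RandQuad.damped_rate_le_half hε (sub_nonneg.2 hab.le) hs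
    have hquad :=
      RandQuad.wassersteinDist_avgCDF_protoOutput_quadDamped_le (s := s) hA hv ha hb hab hQ
    exact RandQuad.lt_wassersteinDist_avgCDF hA hε
      (hquad.trans (ENNReal.ofReal_le_ofReal hrate)) hω
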